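/- Let $D^2$ be the unit disk in the plane, write $S^1=\mathbb{R}/\mathbb{Z}$, and embed $D^2\times S^1\times S^1$ naturally in $\mathbb{R}^4$ by $$\bigl((x,y),u,v\bigr)\mapsto\bigl((2+x)\cos 2\pi u,\ (2+x)\sin 2\pi u,\ (2+y)\cos 2\pi v,\ (2+y)\sin 2\pi v\bigr)$$ (the standard solid torus in a half-space $\mathbb{R}^3_+$, rotated around the boundary plane of the half-space). Let $B_m$ be the group of geometric $m$-braids in $\operatorname{int}D^2\times[0,1]$ with a fixed standard starting point set $Q_m$ of $m$ points on a diameter, with concatenation as product and standard generators $\sigma_1,\dots,\sigma_{m-1}$. For $a,b\in B_m$, a torus-covering $T^2$-link of degree $m$ with boundary braids $a$ and $b$ is (the image in $\mathbb{R}^4$ of) a subset $S\subset \operatorname{int}D^2\times S^1\times S^1$ such that the projection $S\to S^1\times S^1$ is an unbranched covering map of degree $m$, and such that the parts of $S$ over $S^1\times\{0\}$ and over $\{0\}\times S^1$, cut open over $(0,0)$, are geometric braids starting at $Q_m$ which represent $a$ and $b$ respectively. Theorem. For every integer $n$ there is a torus-covering $T^2$-link $S_n$ of degree $3$ with boundary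 braids $\sigma_1^2\sigma_2^{2n}$ and $\Delta^2$, where $\Delta=\sigma_1\sigma_2\sigma_1$; and for every such $S_n$ the link group $\pi_1(\mathbb{R}^4-S_n)$ (with any base point) is free abelian of rank three, $\pi_1(\mathbb{R}^4-S_n)\cong\mathbb{Z}\oplus\mathbb{Z}\oplus\mathbb{Z}$. -/

import Mathlib

noncomputable section

namespace TorusCovering

/-- The (open) unit disk in the plane; it plays the role of the interior of the 2-disk `D²`. -/
abbrev Disk : Type := {z : ℂ // ‖z‖ < 1}

/-- Ordered configurations of `m` distinct points of the disk. -/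
abbrev OrderedConf (m : ℕ) : Type := {x : Fin m → Disk // Function.Injective x}

/-- Two ordered configurations are equivalent when they differ by a permutation of the labels. -/
instance confSetoid (m : ℕ) : Setoid (OrderedConf m) where
  r x y := ∃ τ : Equiv.Perm (Fin m), ∀ j, y.1 j = x.1 (τ j)
  iseqv :=
    { refl := fun _ => ⟨1, fun _ => rfl⟩
      symm := by
        rintro x y ⟨τ, h⟩
        exact ⟨τ⁻¹, fun j => by rw [h]; simp⟩
      trans := by
        rintro x y z ⟨τ, h⟩ ⟨υ, k⟩
        exact ⟨τ * υ, fun j => by rw [k, h]; rfl⟩ }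

/-- The configuration space of `m` unordered distinct points of the disk, with the quotient
topology. -/
abbrev Conf (m : ℕ) : Type := Quotient (confSetoid m)

/-- The underlying set of points of an unordered configuration. -/
def Conf.points {m : ℕ} (c : Conf m) : Set Disk :=
  Quotient.lift (fun x : OrderedConf m => Set.range x.1)
    (by
      rintro x y ⟨τ, h⟩
      have hy : y.1 = x.1 ∘ τ := funext h
      change Set.range x.1 = Set.range y.1
      rw [hy, τ.surjective.range_comp]) c

/-- The positions of the `m` points at time `t` of the elementary half twist: the points number
`i` and `i + 1` (counted from `0`) of the standard configuration
`(2 * j + 1 - m) / m`, `j = 0, …, m - 1`, turn counterclockwise through the angle `π * t`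
around their midpoint, and all other points stay fixed. -/
def twistPos (m i : ℕ) (t : ℝ) (j : Fin m) : ℂ :=
  (if (j : ℕ) = i then (2 * i + 2 - m : ℂ) - Complex.exp (Real.pi * t * Complex.I)
    else if (j : ℕ) = i + 1 then (2 * i + 2 - m : ℂ) + Complex.exp (Real.pi * t * Complex.I)
    else (2 * (j : ℕ) + 1 - m : ℂ)) / m

lemma norm_exp_pi (t : ℝ) : ‖Complex.exp (Real.pi * t * Complex.I)‖ = 1 := by
  have h := Complex.norm_exp_ofReal_mul_I (Real.pi * t)
  push_cast at h
  exact h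

lemma twistPos_norm_lt (m i : ℕ) (hi : i + 1 < m) (t : ℝ) (j : Fin m) :
    ‖twistPos m i t j‖ < 1 := by
  have hj : (j : ℕ) + 1 ≤ m := j.2
  have hj' : ((j : ℕ) : ℝ) + 1 ≤ m := by exact_mod_cast hj
  have hi' : (i : ℝ) + 2 ≤ m := by exact_mod_cast hi
  have hi0 : (0 : ℝ) ≤ i := Nat.cast_nonneg i
  have hj0 : (0 : ℝ) ≤ (j : ℕ) := Nat.cast_nonneg _
  have hm : (0 : ℝ) < m := by linarith
  have he := norm_exp_pi t
  have hc : ‖(2 * i + 2 - m : ℂ)‖ < m - 1 := by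
    have h : (2 * i + 2 - m : ℂ) = ((2 * i + 2 - m : ℝ) : ℂ) := by push_cast; ring
    rw [h, Complex.norm_real, Real.norm_eq_abs, abs_lt]
    constructor <;> linarith
  have hq : ‖(2 * (j : ℕ) + 1 - m : ℂ)‖ < m := by
    have h : (2 * (j : ℕ) + 1 - m : ℂ) = ((2 * (j : ℕ) + 1 - m : ℝ) : ℂ) := by push_cast; ring
    rw [h, Complex.norm_real, Real.norm_eq_abs, abs_lt]
    constructor <;> linarith
  unfold twistPos
  rw [norm_div, Complex.norm_natCast, div_lt_one hm]
  split_ifs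
  · exact (norm_sub_le _ _).trans_lt (by linarith)
  · exact (norm_add_le _ _).trans_lt (by linarith)
  · exact hq

lemma twistPos_injective (m i : ℕ) (hi : i + 1 < m) (t : ℝ) :
    Function.Injective (twistPos m i t) := by
  have hm : (m : ℂ) ≠ 0 := by
    have : m ≠ 0 := by omega
    exact_mod_cast this
  have he := norm_exp_pi t
  set e := Complex.exp (Real.pi * t * Complex.I) with hedef
  have hne : e ≠ 0 := by
    intro h
    rw [h] at he
    simp at he
  have far : ∀ k : ℕ, k ≠ i → k ≠ i + 1 → ∀ w : ℂ, ‖w‖ = 1 →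
      (2 * (k : ℂ) + 1 - m) ≠ (2 * i + 2 - m : ℂ) + w := by
    intro k h1 h2 w hw h
    have h3 : w = (((2 * (k : ℤ) - 2 * i - 1 : ℤ) : ℝ) : ℂ) := by
      push_cast
      linear_combination -h
    rw [h3, Complex.norm_real, Real.norm_eq_abs] at hw
    have h4 : |(2 * (k : ℤ) - 2 * i - 1 : ℤ)| = 1 := by exact_mod_cast hw
    rcases (abs_eq (by norm_num)).1 h4 with h5 | h5 <;> omega
  have he' : ‖-e‖ = 1 := by rw [norm_neg]; exact he
  intro j k h
  unfold twistPos at h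
  rw [← hedef, div_left_inj' hm] at h
  have two : (2 * i + 2 - m : ℂ) - e ≠ (2 * i + 2 - m : ℂ) + e := by
    intro h
    apply hne
    linear_combination (-1 / 2 : ℂ) * h
  apply Fin.ext
  split_ifs at h with h1 h2 h3 h4 h5 h6 h7 h8
  · omega
  · exact absurd h two
  · exact absurd (h.symm.trans (sub_eq_add_neg _ _)) (far _ h2 h3 _ he')
  · exact absurd h.symm two
  · omega
  · exact absurd h.symm (far _ h5 h6 _ he)
  · exact absurd (h.trans (sub_eq_add_neg _ _)) (far _ h1 h4 _ he')
  · exact absurd h (far _ h1 h4 _ he)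
  · have h9 : ((j : ℕ) : ℂ) = (k : ℕ) := by linear_combination (1 / 2 : ℂ) * h
    exact_mod_cast h9

lemma twistPos_continuous (m i : ℕ) (j : Fin m) : Continuous fun t : ℝ => twistPos m i t j := by
  unfold twistPos
  split_ifs <;> fun_prop

/-- The standard position of the points of the base configuration: `m` equally spaced points
`(2 * j + 1 - m) / m` of the real diameter of the disk. -/
def basePos (m : ℕ) (j : Fin m) : ℂ := (2 * (j : ℕ) + 1 - m : ℂ) / m

lemma basePos_norm_lt (m : ℕ) (j : Fin m) : ‖basePos m j‖ < 1 := by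
  have hj' : ((j : ℕ) : ℝ) + 1 ≤ m := by exact_mod_cast j.2
  have hj0 : (0 : ℝ) ≤ (j : ℕ) := Nat.cast_nonneg _
  have hm : (0 : ℝ) < m := by linarith
  have h : (2 * (j : ℕ) + 1 - m : ℂ) = ((2 * (j : ℕ) + 1 - m : ℝ) : ℂ) := by push_cast; ring
  unfold basePos
  rw [norm_div, Complex.norm_natCast, div_lt_one hm, h, Complex.norm_real, Real.norm_eq_abs,
    abs_lt]
  constructor <;> linarith

lemma basePos_injective (m : ℕ) : Function.Injective (basePos m) := by
  intro j k h
  have hm : (m : ℂ) ≠ 0 := by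
    have : m ≠ 0 := by have := j.2; omega
    exact_mod_cast this
  unfold basePos at h
  rw [div_left_inj' hm] at h
  apply Fin.ext
  have h9 : ((j : ℕ) : ℂ) = (k : ℕ) := by linear_combination (1 / 2 : ℂ) * h
  exact_mod_cast h9

/-- The base configuration, with its points ordered from left to right. -/
def orderedBase (m : ℕ) : OrderedConf m :=
  ⟨fun j => ⟨basePos m j, basePos_norm_lt m j⟩,
    fun _ _ h => basePos_injective m (congrArg Subtype.val h)⟩

/-- The starting point set of `m`-braids. -/
def baseConf (m : ℕ) : Conf m := Quotient.mk _ (orderedBase m)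

/-- The ordered configuration at time `t` of the elementary half twist. -/
def orderedTwist (m i : ℕ) (hi : i + 1 < m) (t : ℝ) : OrderedConf m :=
  ⟨fun j => ⟨twistPos m i t j, twistPos_norm_lt m i hi t j⟩,
    fun _ _ h => twistPos_injective m i hi t (congrArg Subtype.val h)⟩

lemma orderedTwist_continuous (m i : ℕ) (hi : i + 1 < m) :
    Continuous (orderedTwist m i hi) :=
  Continuous.subtype_mk
    (continuous_pi fun j => Continuous.subtype_mk (twistPos_continuous m i j) _) _

lemma twist_zero (m i : ℕ) (hi : i + 1 < m) :
    (Quotient.mk _ (orderedTwist m i hi 0) : Conf m) = baseConf m := by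
  have : orderedTwist m i hi 0 = orderedBase m := by
    apply Subtype.ext
    funext j
    apply Subtype.ext
    change twistPos m i 0 j = basePos m j
    unfold twistPos basePos
    split_ifs with h1 h2
    · rw [h1]; simp; ring
    · rw [h2]; simp; ring
    · rfl
  rw [this]
  rfl

lemma twist_one (m i : ℕ) (hi : i + 1 < m) :
    (Quotient.mk _ (orderedTwist m i hi 1) : Conf m) = baseConf m := by
  apply Quotient.sound
  refine ⟨Equiv.swap ⟨i, by omega⟩ ⟨i + 1, hi⟩, fun j => ?_⟩
  apply Subtype.ext
  change basePos m j = twistPos m i 1 (Equiv.swap ⟨i, by omega⟩ ⟨i + 1, hi⟩ j)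
  rw [Equiv.swap_apply_def]
  unfold twistPos basePos
  split_ifs with h1 h2 h3 h4 h5 h6 h7 h8 <;> simp_all [Fin.ext_iff] <;> ring

/-- The geometric braid in which the points number `i` and `i + 1` (counted from `0`) exchange
their places by a counterclockwise half turn, as a loop of configurations. -/
def twistLoop (m i : ℕ) (hi : i + 1 < m) : Path (baseConf m) (baseConf m) where
  toFun t := Quotient.mk _ (orderedTwist m i hi t)
  continuous_toFun :=
    continuous_quotient_mk'.comp ((orderedTwist_continuous m i hi).comp continuous_subtype_val)
  source' := by simpa using twist_zero m i hi
  target' := by simpa using twist_one m i hi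

/-- The braid group of degree `m`: geometric `m`-braids in the cylinder over the disk, i.e. loops of
unordered configurations based at the standard one, up to homotopy relative to the end points.
The opposite group is taken so that the product `β * γ` is the concatenation "first `β`, then `γ`"
(the multiplication of `FundamentalGroup` is in the other order). -/
abbrev BraidGroup (m : ℕ) : Type := (FundamentalGroup (Conf m) (baseConf m))ᵐᵒᵖ

/-- The braid represented by a loop of configurations. -/
def braidClass {m : ℕ} (γ : Path (baseConf m) (baseConf m)) : BraidGroup m :=
  MulOpposite.op (FundamentalGroup.fromPath (Path.Homotopic.Quotient.mk γ))

/-- The product of braids is concatenation. -/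
lemma braidClass_mul {m : ℕ} (β γ : Path (baseConf m) (baseConf m)) :
    braidClass β * braidClass γ = braidClass (β.trans γ) := rfl

/-- The standard generators of the braid group of degree `m`. The index `i` is counted from `0`. -/
def stdGen (m i : ℕ) (hi : i + 1 < m) : BraidGroup m := braidClass (twistLoop m i hi)

/-- The standard generator `σ₁` of the braid group of degree `3`. -/
def sigma1 : BraidGroup 3 := stdGen 3 0 (by norm_num)

/-- The standard generator `σ₂` of the braid group of degree `3`. -/
def sigma2 : BraidGroup 3 := stdGen 3 1 (by norm_num)

/-- Garside's `Δ = σ₁ σ₂ σ₁` in the braid group of degree `3`. -/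
def garside : BraidGroup 3 := sigma1 * sigma2 * sigma1

/-- Euclidean 4-space. -/
abbrev R4 : Type := EuclideanSpace ℝ (Fin 4)

/-- The natural embedding of `D² × S¹ × S¹` into `ℝ⁴`, where `S¹ = ℝ / ℤ`: the product `D² × S¹` is
the standard solid torus in a half-space `ℝ³₊`, which is then rotated in `ℝ⁴` around the boundary
plane of the half-space. So `(x + y I, u, v)` goes to the point with polar coordinates
`(2 + x, 2 π u)` in the first and `(2 + y, 2 π v)` in the second coordinate plane. -/
def torusEmb (p : Disk × UnitAddCircle × UnitAddCircle) : R4 :=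
  !₂[(2 + p.1.1.re) * (p.2.1.toCircle : ℂ).re, (2 + p.1.1.re) * (p.2.1.toCircle : ℂ).im,
     (2 + p.1.1.im) * (p.2.2.toCircle : ℂ).re, (2 + p.1.1.im) * (p.2.2.toCircle : ℂ).im]

/-- `S ⊆ ℝ⁴` is a torus-covering `T²`-link of degree `m` with boundary braids `a` and `b`
(associated with a chart on the torus without black vertices, i.e. without branch points):
`S` is the image of a subset `L` of `D² × S¹ × S¹` such that

* the projection of `L` to `S¹ × S¹` is an (unbranched) covering map of degree `m`;
* the part of `L` over `S¹ × {0}`, cut open over the base point, is a geometric `m`-braid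
  representing `a`;
* the part of `L` over `{0} × S¹`, cut open over the base point, is a geometric `m`-braid
  representing `b`. -/
def IsTorusCoveringLink (m : ℕ) (a b : BraidGroup m) (S : Set R4) : Prop :=
  ∃ L : Set (Disk × UnitAddCircle × UnitAddCircle),
    S = torusEmb '' L ∧
    IsCoveringMap (fun p : L => p.1.2) ∧
    (∀ θ : UnitAddCircle × UnitAddCircle, {z : Disk | (z, θ) ∈ L}.encard = m) ∧
    (∃ α : Path (baseConf m) (baseConf m), braidClass α = a ∧
      ∀ t : unitInterval, (α t).points = {z | (z, ((t : ℝ) : UnitAddCircle), 0) ∈ L}) ∧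
    (∃ β : Path (baseConf m) (baseConf m), braidClass β = b ∧
      ∀ t : unitInterval, (β t).points = {z | (z, 0, ((t : ℝ) : UnitAddCircle)) ∈ L})

end TorusCovering

end

/-!
# The group of a torus-covering link of degree three

Identify `ℝ⁴` with `ℂ × ℂ` and use polar coordinates in both factors. Outside the coordinate axes, the
complement of a torus-covering link is a bundle over the torus of pairs of angles; its fibre `Fiber`
is the quadrant of pairs of radii without three points, whose group is free of rank three. A
neighbourhood of the axes misses the link. It contains, in each fibre, the corner of the quadrant,
and makes the loops that only the angles perform there null-homotopic.

Three consequences determine the group.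

* The fibre generates (`IsTraced.eq_top`): a loop outside the axes is pushed into one fibre by
  isotopy extension, while the base point moves along a null-homotopic loop
  (`IsTraced.exists_loop_fiber`), and loops near an axis contribute nothing
  (`eq_top_of_open_cover`). As generators of the group of the fibre serve three nested circles
  `y₁, y₂, y₃`, tangent to each other at one point, where `yⱼ` goes around the first `j` punctures
  (`fiber_eq_top`).
* The boundary braids are relations: if a homeomorphism `ψ` is the end of an isotopy that traces out
  a boundary braid, then a loop in the fibre is homotopic to its image under `ψ`
  (`IsTraced.mk_map_eq`). The braid `Δ²` is realized by a full twist along `y₃`. This twist conjugates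
  the loops inside `y₃` by `y₃`, so `y₃` is central. The braid `σ₁² σ₂²ⁿ` is realized by a full twist
  along `y₂`, followed by a homeomorphism supported away from `y₁`, so `y₁` and `y₂` commute, whatever
  `n` is. Here `Δ` has to be recognized as a half rotation (`braidClass_halfRotation`).
* The group is not smaller: both boundary braids are pure, so the link has three components, and the
  winding numbers about them form a unitriangular matrix on `y₁, y₂, y₃`
  (`IsTraced.exists_winding_gen`).

For the existence, `Δ²` is a full rotation. Rotating a loop of configurations that represents
`σ₁² σ₂²ⁿ` gives a family of configurations over the torus (`exists_isTorusCoveringLink`).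
-/

noncomputable section

namespace TorusCovering

open Set unitInterval Topology

/-- The homotopy class, relative to the end points, of a path. -/
local notation "⟪" γ "⟫" => Path.Homotopic.Quotient.mk γ

/-- Concatenation of classes of paths. -/
local infixl:70 " ⬝ " => Path.Homotopic.Quotient.trans


/-! ### Homotopy classes of paths -/

section Paths

variable {X Y : Type*} [TopologicalSpace X] [TopologicalSpace Y]

/-- The two ways around a square are homotopic. -/
lemma mk_trans_eq_of_square (G : C(I × I, X)) {a b c d : X} (l : Path a b) (t : Path b d)
    (m : Path a c) (r : Path c d) (hl : ∀ s, l s = G (0, s)) (ht : ∀ s, t s = G (s, 1))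
    (hm : ∀ s, m s = G (s, 0)) (hr : ∀ s, r s = G (1, s)) : ⟪l⟫ ⬝ ⟪t⟫ = ⟪m⟫ ⬝ ⟪r⟫ := by
  obtain rfl : G (0, 0) = a := by rw [← l.source, hl]
  obtain rfl : G (0, 1) = b := by rw [← l.target, hl]
  obtain rfl : G (1, 0) = c := by rw [← r.source, hr]
  obtain rfl : G (1, 1) = d := by rw [← r.target, hr]
  let L : Path ((0, 0) : I × I) (0, 1) := ⟨⟨fun s => (0, s), by fun_prop⟩, rfl, rfl⟩
  let T : Path ((0, 1) : I × I) (1, 1) := ⟨⟨fun s => (s, 1), by fun_prop⟩, rfl, rfl⟩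
  let M : Path ((0, 0) : I × I) (1, 0) := ⟨⟨fun s => (s, 0), by fun_prop⟩, rfl, rfl⟩
  let R : Path ((1, 0) : I × I) (1, 1) := ⟨⟨fun s => (1, s), by fun_prop⟩, rfl, rfl⟩
  obtain rfl : l = L.map G.continuous := by ext s; exact hl s
  obtain rfl : t = T.map G.continuous := by ext s; exact ht s
  obtain rfl : m = M.map G.continuous := by ext s; exact hm s
  obtain rfl : r = R.map G.continuous := by ext s; exact hr s
  rw [← Path.Homotopic.Quotient.mk_trans, ← Path.Homotopic.Quotient.mk_trans, ← Path.map_trans,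
    ← Path.map_trans, Path.Homotopic.Quotient.eq]
  have hI : ContractibleSpace I := (convex_Icc (0 : ℝ) 1).contractibleSpace ⟨0, by simp⟩
  exact (SimplyConnectedSpace.paths_homotopic _ _).map G

/-- Two paths in a subset of a vector space are homotopic if the segments joining their points at
equal times lie in the subset. -/
lemma homotopic_of_lineMap {E : Type*} [AddCommGroup E] [Module ℝ E] [TopologicalSpace E]
    [IsTopologicalAddGroup E] [ContinuousSMul ℝ E] {P : E → Prop} {x y : Subtype P}
    (γ γ' : Path x y)
    (h : ∀ t s : I, P (AffineMap.lineMap (γ t : E) (γ' t : E) (s : ℝ))) : γ.Homotopic γ' := by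
  refine ⟨⟨⟨⟨fun st => ⟨_, h st.2 st.1⟩, ?_⟩, ?_, ?_⟩, ?_⟩⟩
  · refine Continuous.subtype_mk ?_ _
    simp only [AffineMap.lineMap_apply_module]
    fun_prop
  · intro t; simp
  · intro t; simp
  · rintro s t (rfl | rfl) <;> simp [AffineMap.lineMap_same]

/-- Two paths with the same end points in a convex subset of the total space of a subtype are
homotopic. -/
lemma mk_eq_mk_of_convex {E : Type*} [AddCommGroup E] [Module ℝ E] [TopologicalSpace E]
    [IsTopologicalAddGroup E] [ContinuousSMul ℝ E] {P : E → Prop} {x y : Subtype P}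
    {K : Set E} (hK : Convex ℝ K) (hP : ∀ z ∈ K, P z)
    (γ γ' : Path x y) (h : ∀ t, (γ t : E) ∈ K) (h' : ∀ t, (γ' t : E) ∈ K) :
    ⟪γ⟫ = ⟪γ'⟫ :=
  Path.Homotopic.Quotient.eq.2 <| homotopic_of_lineMap _ _ fun t s =>
    hP _ (hK.lineMap_mem (h t) (h' t) s.2)

lemma trans_mem {x : X} {H : Subgroup (FundamentalGroup X x)}
    {a b : Path.Homotopic.Quotient x x} (ha : FundamentalGroup.fromPath a ∈ H)
    (hb : FundamentalGroup.fromPath b ∈ H) : FundamentalGroup.fromPath (a ⬝ b) ∈ H :=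
  H.mul_mem hb ha

lemma symm_mem {x : X} {H : Subgroup (FundamentalGroup X x)}
    {a : Path.Homotopic.Quotient x x} (ha : FundamentalGroup.fromPath a ∈ H) :
    FundamentalGroup.fromPath a.symm ∈ H :=
  H.inv_mem ha

@[simp] lemma symm_trans_cancel_left {x y z : X} (a : Path.Homotopic.Quotient x y)
    (b : Path.Homotopic.Quotient y z) : a.symm ⬝ (a ⬝ b) = b := by
  rw [← Path.Homotopic.Quotient.trans_assoc, Path.Homotopic.Quotient.symm_trans,
    Path.Homotopic.Quotient.refl_trans]

@[simp] lemma trans_symm_cancel_left {x y z : X} (a : Path.Homotopic.Quotient x y)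
    (b : Path.Homotopic.Quotient x z) : a ⬝ (a.symm ⬝ b) = b := by
  rw [← Path.Homotopic.Quotient.trans_assoc, Path.Homotopic.Quotient.trans_symm,
    Path.Homotopic.Quotient.refl_trans]

@[simp] lemma class_symm_trans {x y z : X} (a : Path.Homotopic.Quotient x y)
    (b : Path.Homotopic.Quotient y z) : (a ⬝ b).symm = b.symm ⬝ a.symm := by
  induction a using Path.Homotopic.Quotient.ind with | mk a => ?_
  induction b using Path.Homotopic.Quotient.ind with | mk b => ?_
  rw [← Path.Homotopic.Quotient.mk_trans, ← Path.Homotopic.Quotient.mk_symm, Path.trans_symm]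
  rfl

@[simp] lemma class_symm_symm {x y : X} (a : Path.Homotopic.Quotient x y) : a.symm.symm = a := by
  induction a using Path.Homotopic.Quotient.ind with | mk a => ?_
  rw [← Path.Homotopic.Quotient.mk_symm, ← Path.Homotopic.Quotient.mk_symm, Path.symm_symm]

lemma mulEquivOfPath_fromPath {x y : X} (p : Path x y) (q : Path.Homotopic.Quotient x x) :
    FundamentalGroup.fundamentalGroupMulEquivOfPath p (FundamentalGroup.fromPath q) =
      FundamentalGroup.fromPath ((⟪p⟫).symm ⬝ (q ⬝ ⟪p⟫)) := rfl

/-- The initial piece of a path, up to time `s`. -/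
def initialPiece {x y : X} (γ : Path x y) (s : I) : Path x (γ s) :=
  (γ.subpath 0 s).cast γ.source.symm rfl

lemma mk_initialPiece {x y : X} (γ : Path x y) (s t : I) :
    ⟪initialPiece γ t⟫ = ⟪initialPiece γ s⟫ ⬝ ⟪γ.subpath s t⟫ := by
  have h : (initialPiece γ s).trans (γ.subpath s t) =
      ((γ.subpath 0 s).trans (γ.subpath s t)).cast γ.source.symm rfl := by
    ext r; simp [initialPiece, Path.trans_apply]
  rw [← Path.Homotopic.Quotient.mk_trans, h, initialPiece, Path.Homotopic.Quotient.mk_cast,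
    Path.Homotopic.Quotient.mk_cast]
  congr 1
  exact (Path.Homotopic.Quotient.eq.2 ⟨Path.Homotopy.subpathTransSubpath γ 0 s t⟩).symm

/-- Generation half of van Kampen's theorem, for an open cover `U` and a base point common to its
members: a subgroup contains all loops if it contains the loops lying in one member of the cover,
and those that go out in one member to any point of an intersection and return in another member,
for some choice of the way out and the way back. The intersections need not be connected. -/
theorem eq_top_of_open_cover {ι : Type*} (U : ι → Set X) (hU : ∀ i, IsOpen (U i))
    (hcov : ∀ x, ∃ i, x ∈ U i) (x₀ : X) (H : Subgroup (FundamentalGroup X x₀))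
    (hloop : ∀ i (γ : Path x₀ x₀), (∀ t, γ t ∈ U i) → FundamentalGroup.fromPath ⟪γ⟫ ∈ H)
    (hpath : ∀ i j y, y ∈ U i → y ∈ U j → ∃ δ δ' : Path x₀ y, (∀ t, δ t ∈ U i) ∧
      (∀ t, δ' t ∈ U j) ∧ FundamentalGroup.fromPath (⟪δ⟫ ⬝ (⟪δ'⟫).symm) ∈ H) : H = ⊤ := by
  rw [Subgroup.eq_top_iff']
  intro g
  obtain ⟨γ, rfl⟩ := Path.Homotopic.Quotient.mk_surjective g
  change FundamentalGroup.fromPath ⟪γ⟫ ∈ H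
  obtain ⟨t, t0, tmono, ⟨N, hN⟩, hsub⟩ := exists_monotone_Icc_subset_open_cover_unitInterval
    (fun i => (hU i).preimage γ.continuous)
    (fun s _ => by obtain ⟨i, hi⟩ := hcov (γ s); exact mem_iUnion.2 ⟨i, hi⟩)
  -- Up to the subgroup, the initial pieces of the loop can be replaced by paths in one member.
  have key : ∀ n, ∀ i, γ (t n) ∈ U i → ∃ δ : Path x₀ (γ (t n)), (∀ s, δ s ∈ U i) ∧
      FundamentalGroup.fromPath (⟪initialPiece γ (t n)⟫ ⬝ (⟪δ⟫).symm) ∈ H := by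
    intro n
    induction n with
    | zero =>
      intro i hi
      obtain ⟨δ, -, h1, -, -⟩ := hpath i i _ hi hi
      refine ⟨δ, h1, ?_⟩
      rw [← Path.Homotopic.Quotient.mk_symm, ← Path.Homotopic.Quotient.mk_trans]
      refine hloop i _ fun s => ?_
      have h0 : ∀ r, initialPiece γ (t 0) r ∈ U i := by
        intro r
        rw [t0] at hi ⊢
        simpa [initialPiece] using hi
      rw [Path.trans_apply]
      split_ifs
      · exact h0 _
      · exact h1 _
    | succ n ih =>
      intro i hi
      obtain ⟨j, hj⟩ := hsub n
      have hle := tmono (Nat.le_succ n)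
      obtain ⟨δ, hδ, hδH⟩ := ih j (hj ⟨le_rfl, hle⟩)
      obtain ⟨δ₁, δ₂, h1, h2, h12⟩ := hpath j i _ (hj ⟨hle, le_rfl⟩) hi
      refine ⟨δ₂, h2, ?_⟩
      have hmid : FundamentalGroup.fromPath
          (⟪δ⟫ ⬝ ⟪γ.subpath (t n) (t (n + 1))⟫ ⬝ (⟪δ₁⟫).symm) ∈ H := by
        rw [← Path.Homotopic.Quotient.mk_symm, ← Path.Homotopic.Quotient.mk_trans,
          ← Path.Homotopic.Quotient.mk_trans]
        refine hloop j _ fun s => ?_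
        have hs : ∀ r, γ.subpath (t n) (t (n + 1)) r ∈ U j := by
          intro r
          have : γ.subpath (t n) (t (n + 1)) r ∈ range (γ.subpath (t n) (t (n + 1))) := ⟨r, rfl⟩
          rw [Path.range_subpath_of_le _ _ _ hle] at this
          obtain ⟨r', hr', h⟩ := this
          rw [← h]
          exact hj hr'
        simp only [Path.trans_apply]
        split_ifs
        · exact hδ _
        · exact hs _
        · exact h1 _
      have h := trans_mem (trans_mem hδH hmid) h12
      convert h using 2
      rw [mk_initialPiece γ (t n)]
      simp [Path.Homotopic.Quotient.trans_assoc]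
  obtain ⟨i, hi⟩ := hcov (γ (t N))
  obtain ⟨δ, hδ, hδH⟩ := key N i hi
  have h1 : t N = 1 := hN N le_rfl
  generalize t N = s at *
  subst h1
  have h2 : FundamentalGroup.fromPath ⟪δ.cast rfl γ.target.symm⟫ ∈ H := hloop i _ hδ
  have h3 : ∀ {z : X} (hz : z = x₀) (p : Path x₀ z) (δ : Path x₀ z),
      FundamentalGroup.fromPath (⟪p⟫ ⬝ (⟪δ⟫).symm) ∈ H →
      FundamentalGroup.fromPath ⟪δ.cast rfl hz.symm⟫ ∈ H →
      FundamentalGroup.fromPath ⟪p.cast rfl hz.symm⟫ ∈ H := by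
    rintro z rfl p δ h h'
    simpa [Path.Homotopic.Quotient.trans_assoc] using trans_mem h h'
  have h4 := h3 γ.target _ δ hδH h2
  convert h4 using 3
  ext s
  simp [initialPiece, Path.subpath_zero_one]

end Paths

/-! ### Configurations and coverings -/

lemma Conf.points_mk {m : ℕ} (x : OrderedConf m) :
    Conf.points (Quotient.mk _ x : Conf m) = range x.1 := rfl

lemma Conf.points_injective {m : ℕ} : Function.Injective (Conf.points (m := m)) := by
  intro c d h
  induction c using Quotient.inductionOn with | _ x
  induction d using Quotient.inductionOn with | _ y
  rw [Conf.points_mk, Conf.points_mk] at h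
  let τ : Equiv.Perm (Fin m) := (Equiv.ofInjective _ y.2).trans
    ((Equiv.setCongr h.symm).trans (Equiv.ofInjective _ x.2).symm)
  refine Quotient.sound ⟨τ, fun j => ?_⟩
  exact (Equiv.apply_ofInjective_symm x.2 ⟨y.1 j, h ▸ mem_range_self j⟩).symm

/-- The symmetric group permutes the labels of an ordered configuration. -/
instance relabel (m : ℕ) : MulAction (Equiv.Perm (Fin m)) (OrderedConf m) where
  smul τ x := ⟨fun j => x.1 (τ⁻¹ j), x.2.comp τ⁻¹.injective⟩
  one_smul _ := rfl
  mul_smul τ υ x := by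
    apply Subtype.ext
    funext j
    change x.1 ((τ * υ)⁻¹ j) = x.1 (υ⁻¹ (τ⁻¹ j))
    rw [mul_inv_rev]
    rfl

lemma relabel_apply {m : ℕ} (τ : Equiv.Perm (Fin m)) (x : OrderedConf m) (j : Fin m) :
    (τ • x).1 j = x.1 (τ⁻¹ j) := rfl

/-- Forgetting the labels is a covering map: the symmetric group acts freely on the ordered
configurations. -/
lemma isCoveringMap_mk (m : ℕ) : IsCoveringMap (Quotient.mk (confSetoid m)) := by
  suffices h : IsQuotientCoveringMap (Quotient.mk (confSetoid m)) (Equiv.Perm (Fin m)) from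
    h.isCoveringMap
  refine
    { toIsQuotientMap := isQuotientMap_quotient_mk'
      continuous_const_smul := fun τ => ?_
      apply_eq_iff_mem_orbit := fun {x y} => ?_
      disjoint := fun x => ?_ }
  · refine Continuous.subtype_mk (continuous_pi fun j => ?_) _
    exact (continuous_apply (τ⁻¹ j)).comp continuous_subtype_val
  · constructor
    · intro h
      obtain ⟨τ, hτ⟩ := Quotient.exact h
      refine ⟨τ, Subtype.ext (funext fun j => ?_)⟩
      change y.1 (τ⁻¹ j) = _
      rw [hτ]
      simp
    · rintro ⟨τ, rfl⟩
      refine Quotient.sound ⟨τ, fun j => ?_⟩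
      rw [relabel_apply]
      simp
  · obtain ⟨V, hV, hdis⟩ := (finite_range x.1).t2_separation
    refine ⟨{y | ∀ j, y.1 j ∈ V (x.1 j)}, ?_, ?_⟩
    · refine IsOpen.mem_nhds ?_ fun j => (hV _).1
      simp only [ofPred_forall]
      exact isOpen_iInter_of_finite fun j =>
        (hV _).2.preimage ((continuous_apply j).comp continuous_subtype_val)
    · rintro τ ⟨-, ⟨y, hy, rfl⟩, hy'⟩
      ext j
      have h1 := hy (τ⁻¹ j)
      have h2 : y.1 (τ⁻¹ j) ∈ V (x.1 j) := hy' j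
      have h3 : x.1 (τ⁻¹ j) = x.1 j := by
        by_contra hne
        exact Set.disjoint_left.1 (hdis (mem_range_self _) (mem_range_self _) hne) h1 h2
      have h4 := x.2 h3
      conv_lhs => rw [← h4]
      simp

/-- The points of a continuous family of unordered configurations form a covering of the space of
parameters. -/
lemma isCoveringMap_points {m : ℕ} {B : Type*} [TopologicalSpace B] (A : C(B, Conf m)) :
    IsCoveringMap (fun p : {p : Disk × B | p.1 ∈ (A p.2).points} => p.1.2) := by
  intro b₀
  suffices h : IsEvenlyCovered _ b₀ (Fin m) from h.to_isEvenlyCovered_preimage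
  obtain ⟨x₀, hx₀⟩ := Quotient.exists_rep (A b₀)
  obtain ⟨e, hxe, he⟩ := (isCoveringMap_mk m).isLocalHomeomorph x₀
  let U : Set B := A ⁻¹' e.target
  have hU : IsOpen U := e.open_target.preimage A.continuous
  let s : U → OrderedConf m := fun b => e.symm (A b)
  have hs : Continuous s := e.continuousOn_symm.comp_continuous
    (A.continuous.comp continuous_subtype_val) fun b => b.2
  have hmk : ∀ b : U, A b = Quotient.mk _ (s b) := fun b => by
    have h := e.right_inv b.2
    rw [← he] at h
    exact h.symm
  let f : {p : Disk × B | p.1 ∈ (A p.2).points} → B := fun p => p.1.2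
  have hf : Continuous f := continuous_snd.comp continuous_subtype_val
  have hex : ∀ p : f ⁻¹' U, ∃ i, (s ⟨f p, p.2⟩).1 i = p.1.1.1 := by
    rintro ⟨⟨⟨z, b⟩, hz⟩, hb⟩
    have h : z ∈ (A b).points := hz
    rw [hmk ⟨b, hb⟩, Conf.points_mk] at h
    exact h
  choose idx hidx using hex
  have hidxc : Continuous idx := by
    rw [continuous_discrete_rng]
    intro i
    have : (idx ⁻¹' {i} : Set (f ⁻¹' U)) =
        (⋃ j ∈ {j | j ≠ i}, {p : f ⁻¹' U | (s ⟨f p, p.2⟩).1 j = p.1.1.1})ᶜ := by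
      ext p
      simp only [mem_preimage, mem_singleton_iff, mem_compl_iff, mem_iUnion, mem_ofPred_eq,
        not_exists]
      constructor
      · rintro rfl j hj h
        exact hj ((s ⟨f p, p.2⟩).2 (h.trans (hidx p).symm))
      · intro h
        by_contra hne
        exact h _ hne (hidx p)
    rw [this, isOpen_compl_iff]
    refine Set.Finite.isClosed_biUnion (Set.toFinite _) fun j _ => ?_
    refine isClosed_eq ?_ ?_
    · exact (continuous_apply j).comp (continuous_subtype_val.comp (hs.comp
        ((hf.comp continuous_subtype_val).subtype_mk _)))
    · exact continuous_fst.comp (continuous_subtype_val.comp continuous_subtype_val)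
  refine ⟨inferInstance, U, ?_, hU, hU.preimage hf,
    { toFun := fun p => (⟨f p, p.2⟩, idx p)
      invFun := fun q => ⟨⟨((s q.1).1 q.2, q.1), ?_⟩, q.1.2⟩
      left_inv := ?_
      right_inv := ?_
      continuous_toFun := ?_
      continuous_invFun := ?_ }, fun _ => rfl⟩
  · change A b₀ ∈ e.target
    rw [← hx₀]
    have h := e.map_source hxe
    rw [← he] at h
    exact h
  · change (s q.1).1 q.2 ∈ (A q.1).points
    rw [hmk, Conf.points_mk]
    exact mem_range_self _
  · intro p
    apply Subtype.ext
    apply Subtype.ext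
    exact Prod.ext (hidx p) rfl
  · intro q
    refine Prod.ext rfl ((s q.1).2 ?_)
    exact hidx ⟨⟨((s q.1).1 q.2, q.1), _⟩, q.1.2⟩
  · exact ((hf.comp continuous_subtype_val).subtype_mk _).prodMk hidxc
  · refine Continuous.subtype_mk (Continuous.subtype_mk (Continuous.prodMk ?_ ?_) _) _
    · rw [continuous_prod_of_discrete_right]
      intro i
      exact (continuous_apply i).comp (continuous_subtype_val.comp hs)
    · exact continuous_subtype_val.comp continuous_fst

/-- The points of a covering of degree `m` of the torus, contained in the trivial disk bundle, can
be labelled consistently over the universal cover `ℝ × ℝ`. -/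
lemma exists_ordered_lift {m : ℕ} {L : Set (Disk × UnitAddCircle × UnitAddCircle)}
    (hcov : IsCoveringMap (fun p : L => p.1.2))
    (hcard : ∀ θ : UnitAddCircle × UnitAddCircle, {z : Disk | (z, θ) ∈ L}.encard = m)
    (x : OrderedConf m) (hx : range x.1 = {z : Disk | (z, 0, 0) ∈ L}) :
    ∃ ζ : C(ℝ × ℝ, OrderedConf m), ζ 0 = x ∧ ∀ k : ℝ × ℝ,
      range (ζ k).1 = {z : Disk | (z, (k.1 : UnitAddCircle), (k.2 : UnitAddCircle)) ∈ L} := by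
  have hmem : ∀ i, (x.1 i, (0 : UnitAddCircle), (0 : UnitAddCircle)) ∈ L := fun i => by
    have : x.1 i ∈ {z : Disk | (z, 0, 0) ∈ L} := hx ▸ mem_range_self i
    exact this
  let π : C(ℝ × ℝ, UnitAddCircle × UnitAddCircle) :=
    ⟨fun k => ((k.1 : UnitAddCircle), (k.2 : UnitAddCircle)), by
      exact (AddCircle.continuous_mk' 1 |>.comp continuous_fst).prodMk
        (AddCircle.continuous_mk' 1 |>.comp continuous_snd)⟩
  have hlift : ∀ i, ∃ F : C(ℝ × ℝ, L), F 0 = ⟨_, hmem i⟩ ∧ (fun p : L => p.1.2) ∘ F = π :=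
    fun i => (hcov.existsUnique_continuousMap_lifts π 0 ⟨_, hmem i⟩ rfl).exists
  choose F hF0 hF using hlift
  have hFk : ∀ i k, (F i k).1.2 = ((k.1 : UnitAddCircle), (k.2 : UnitAddCircle)) :=
    fun i k => congrFun (hF i) k
  have hinj : ∀ k, Function.Injective fun i => (F i k).1.1 := by
    intro k i j hij
    have h : F i k = F j k := Subtype.ext (Prod.ext hij ((hFk i k).trans (hFk j k).symm))
    have h' := hcov.eq_of_comp_eq (F i).continuous (F j).continuous
      ((hF i).trans (hF j).symm) k h
    have h0 := congrFun h' 0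
    rw [hF0, hF0] at h0
    exact x.2 (congrArg (fun p : L => p.1.1) h0)
  refine ⟨⟨fun k => ⟨fun i => (F i k).1.1, hinj k⟩, ?_⟩, ?_, ?_⟩
  · refine Continuous.subtype_mk (continuous_pi fun i => ?_) _
    exact continuous_fst.comp (continuous_subtype_val.comp (F i).continuous)
  · apply Subtype.ext
    funext i
    change (F i 0).1.1 = x.1 i
    rw [hF0]
  · intro k
    have hsub : range (fun i => (F i k).1.1) ⊆
        {z : Disk | (z, (k.1 : UnitAddCircle), (k.2 : UnitAddCircle)) ∈ L} := by
      rintro _ ⟨i, rfl⟩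
      have h := (F i k).2
      rw [mem_ofPred_eq, ← hFk i k]
      exact h
    have hfin : {z : Disk | (z, (k.1 : UnitAddCircle), (k.2 : UnitAddCircle)) ∈ L}.Finite :=
      finite_of_encard_eq_coe (hcard _)
    refine (hfin.subset hsub).eq_of_subset_of_encard_le hsub ?_
    rw [hcard, ← image_univ, (hinj k).encard_image, encard_univ]
    simp

/-- Two paths of ordered configurations with the same starting point, whose underlying paths of
unordered configurations are homotopic, are homotopic. In particular they have the same end. -/
lemma homotopic_of_homotopic_mk {m : ℕ} {c d : Conf m} {γ γ' : Path c d} (h : γ.Homotopic γ')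
    {ω ω' : C(I, OrderedConf m)} (h0 : ω 0 = ω' 0)
    (hω : ∀ t, γ t = Quotient.mk _ (ω t)) (hω' : ∀ t, γ' t = Quotient.mk _ (ω' t)) :
    ∃ G : C(I × I, OrderedConf m), (∀ t, G (0, t) = ω t) ∧ (∀ t, G (1, t) = ω' t) ∧
      (∀ s, G (s, 0) = ω 0) ∧ (∀ s, G (s, 1) = ω 1) := by
  have hc := isCoveringMap_mk m
  have e1 : ContinuousMap.comp ⟨_, hc.continuous⟩ ω = (γ : C(I, Conf m)) := by
    ext t; exact (hω t).symm
  have e2 : ContinuousMap.comp ⟨_, hc.continuous⟩ ω' = (γ' : C(I, Conf m)) := by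
    ext t; exact (hω' t).symm
  have := (hc.homotopicRel_iff_comp (f₀ := ω) (f₁ := ω') (S := {0, 1}) ⟨0, by simp, h0⟩).2
    (by rw [e1, e2]; exact h)
  obtain ⟨G⟩ := this
  exact ⟨G.toContinuousMap, fun t => G.apply_zero t, fun t => G.apply_one t,
    fun s => G.eq_fst s (by simp), fun s => G.eq_fst s (by simp)⟩

/-! ### Pushing points along a motion of configurations -/

/-- A fibrewise perturbation of the identity by a contraction is a homeomorphism. -/
lemma exists_homeomorph_add_of_contraction {Y : Type*} [TopologicalSpace Y] (g : Y × ℂ → ℂ)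
    (hg : Continuous g) (hlip : ∀ y z w, ‖g (y, z) - g (y, w)‖ ≤ 1 / 2 * ‖z - w‖) :
    ∃ Φ : Y × ℂ ≃ₜ Y × ℂ, ∀ p, Φ p = (p.1, p.2 + g p) := by
  let f : Y × ℂ → Y × ℂ := fun p => (p.1, p.2 + g p)
  -- The map expands distances in the fibres at least by the factor `1 / 2`.
  have hexp : ∀ y z w, ‖z - w‖ ≤ 2 * ‖(z + g (y, z)) - (w + g (y, w))‖ := by
    intro y z w
    have h := norm_sub_le ((z + g (y, z)) - (w + g (y, w))) (g (y, z) - g (y, w))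
    have h2 := hlip y z w
    have h3 : (z + g (y, z)) - (w + g (y, w)) - (g (y, z) - g (y, w)) = z - w := by ring
    rw [h3] at h
    linarith
  have hinj : Function.Injective f := by
    rintro ⟨y, z⟩ ⟨y', w⟩ h
    obtain rfl : y = y' := congrArg Prod.fst h
    have h2 : z + g (y, z) = w + g (y, w) := congrArg Prod.snd h
    have h3 := hexp y z w
    rw [h2, sub_self, norm_zero, mul_zero] at h3
    rw [sub_eq_zero.1 (norm_le_zero_iff.1 h3)]
  have hsurj : Function.Surjective f := by
    rintro ⟨y, w⟩
    have hc : ContractingWith (1 / 2) fun z => w - g (y, z) := by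
      refine ⟨by norm_num, LipschitzWith.of_dist_le_mul fun z z' => ?_⟩
      rw [dist_eq_norm, dist_eq_norm, sub_sub_sub_cancel_left, norm_sub_rev z]
      simpa using hlip y z' z
    refine ⟨(y, hc.fixedPoint), Prod.ext rfl ?_⟩
    have h : w - g (y, hc.fixedPoint) = hc.fixedPoint := hc.fixedPoint_isFixedPt
    change hc.fixedPoint + g (y, hc.fixedPoint) = w
    linear_combination -h
  let e := Equiv.ofBijective f ⟨hinj, hsurj⟩
  have hright : ∀ p, f (e.symm p) = p := e.apply_symm_apply
  refine ⟨⟨e, by change Continuous f; fun_prop, ?_⟩, fun _ => rfl⟩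
  change Continuous e.symm
  have h1 : ∀ p, (e.symm p).1 = p.1 := fun p => by
    have h : (f (e.symm p)).1 = p.1 := congrArg Prod.fst (hright p)
    exact h
  have h2 : ∀ p, (e.symm p).2 + g (p.1, (e.symm p).2) = p.2 := fun p => by
    have h : (f (e.symm p)).2 = p.2 := congrArg Prod.snd (hright p)
    rw [← h1 p]
    exact h
  have hsnd : Continuous fun p => (e.symm p).2 := by
    rw [continuous_iff_continuousAt]
    intro p₀
    set w := (e.symm p₀).2 with hw
    rw [ContinuousAt, tendsto_iff_norm_sub_tendsto_zero]
    have hlim : Filter.Tendsto (fun p : Y × ℂ => 2 * ‖p.2 - (w + g (p.1, w))‖) (𝓝 p₀) (𝓝 0) := by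
      have hcont : Continuous fun p : Y × ℂ => 2 * ‖p.2 - (w + g (p.1, w))‖ := by fun_prop
      have h := hcont.tendsto p₀
      rwa [← h2 p₀, sub_self, norm_zero, mul_zero] at h
    refine squeeze_zero (fun _ => norm_nonneg _) (fun p => ?_) hlim
    have h := hexp p.1 (e.symm p).2 w
    rwa [h2] at h
  have : (e.symm : Y × ℂ → Y × ℂ) = fun p => (p.1, (e.symm p).2) :=
    funext fun p => Prod.ext (h1 p) rfl
  rw [this]
  exact continuous_fst.prodMk hsnd

/-- If the points `p y i` are `r`-separated and `r`-far from the unit circle, then they can be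
moved to points `q y i` close to them by homeomorphisms fixing the outside of the disk. The
displacement `q y i - p y i` is damped linearly on the disk of radius `r` around `p y i`. -/
lemma exists_push_of_close {m : ℕ} {Y : Type*} [TopologicalSpace Y] (p q : Y → Fin m → ℂ)
    (hp : Continuous p) (hq : Continuous q) {r : ℝ} (hr : 0 < r)
    (hsep : ∀ y i j, i ≠ j → r ≤ ‖p y i - p y j‖) (hfar : ∀ y i, ‖p y i‖ + r ≤ 1)
    (hclose : ∀ y i, m * ‖q y i - p y i‖ ≤ r / 2) :
    ∃ Φ : Y × ℂ ≃ₜ Y × ℂ, (∀ x, (Φ x).1 = x.1) ∧ (∀ y i, (Φ (y, p y i)).2 = q y i) ∧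
      (∀ y z, 1 ≤ ‖z‖ → (Φ (y, z)).2 = z) ∧ (∀ y, p y = q y → ∀ z, (Φ (y, z)).2 = z) := by
  let g : Y × ℂ → ℂ := fun x =>
    ∑ i, ((max 0 (1 - ‖x.2 - p x.1 i‖ / r) : ℝ) : ℂ) * (q x.1 i - p x.1 i)
  have hg : Continuous g := by
    refine continuous_finsetSum _ fun i _ => ?_
    have hpi : Continuous fun y => p y i := (continuous_apply i).comp hp
    have hqi : Continuous fun y => q y i := (continuous_apply i).comp hq
    refine (Complex.continuous_ofReal.comp ?_).mul ?_ <;> fun_prop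
  have hlip : ∀ y z w, ‖g (y, z) - g (y, w)‖ ≤ 1 / 2 * ‖z - w‖ := by
    intro y z w
    have hterm : ∀ i ∈ Finset.univ, ‖((max 0 (1 - ‖z - p y i‖ / r) : ℝ) : ℂ) * (q y i - p y i) -
        ((max 0 (1 - ‖w - p y i‖ / r) : ℝ) : ℂ) * (q y i - p y i)‖ ≤
        ‖z - w‖ / r * ‖q y i - p y i‖ := by
      intro i _
      rw [← sub_mul, norm_mul, ← Complex.ofReal_sub, Complex.norm_real, Real.norm_eq_abs]
      refine mul_le_mul_of_nonneg_right ?_ (norm_nonneg _)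
      rw [max_comm, max_comm 0]
      refine (abs_max_sub_max_le_abs _ _ _).trans ?_
      have h1 : 1 - ‖z - p y i‖ / r - (1 - ‖w - p y i‖ / r) =
          (‖w - p y i‖ - ‖z - p y i‖) / r := by ring
      rw [h1, abs_div, abs_of_pos hr]
      refine div_le_div_of_nonneg_right ?_ hr.le
      refine (abs_norm_sub_norm_le _ _).trans ?_
      rw [norm_sub_rev z w]
      apply le_of_eq
      congr 1
      ring
    have hsum : ‖g (y, z) - g (y, w)‖ ≤ ∑ i, ‖z - w‖ / r * ‖q y i - p y i‖ := by
      simp only [g]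
      rw [← Finset.sum_sub_distrib]
      exact norm_sum_le_of_le _ hterm
    refine hsum.trans ?_
    rcases Nat.eq_zero_or_pos m with rfl | hm
    · simp
    have hm' : (0 : ℝ) < m := by exact_mod_cast hm
    have hcl : ∀ i ∈ Finset.univ, ‖z - w‖ / r * ‖q y i - p y i‖ ≤ ‖z - w‖ / r * (r / 2 / m) := by
      intro i _
      refine mul_le_mul_of_nonneg_left ?_ (by positivity)
      rw [le_div_iff₀ hm', mul_comm]
      exact hclose y i
    refine (Finset.sum_le_sum hcl).trans (le_of_eq ?_)
    simp only [Finset.sum_const, Finset.card_univ, Fintype.card_fin, nsmul_eq_mul]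
    field_simp
  obtain ⟨Φ, hΦ⟩ := exists_homeomorph_add_of_contraction g hg hlip
  refine ⟨Φ, fun x => by rw [hΦ], fun y i => ?_, fun y z hz => ?_, fun y hy z => ?_⟩
  · rw [hΦ]
    change p y i + g (y, p y i) = q y i
    have : g (y, p y i) = q y i - p y i := by
      simp only [g]
      rw [Finset.sum_eq_single i]
      · simp
      · intro j _ hj
        have h := hsep y i j (Ne.symm hj)
        have : 1 - ‖p y i - p y j‖ / r ≤ 0 := by
          rw [sub_nonpos, le_div_iff₀ hr]
          linarith
        rw [max_eq_left this]
        simp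
      · simp
    rw [this]
    ring
  · rw [hΦ]
    change z + g (y, z) = z
    have : g (y, z) = 0 := by
      refine Finset.sum_eq_zero fun i _ => ?_
      have h1 := norm_sub_norm_le z (p y i)
      have h2 := hfar y i
      have : 1 - ‖z - p y i‖ / r ≤ 0 := by
        rw [sub_nonpos, le_div_iff₀ hr]
        linarith
      simp only
      rw [max_eq_left this]
      simp
    rw [this, add_zero]
  · rw [hΦ]
    change z + g (y, z) = z
    have : g (y, z) = 0 := by
      refine Finset.sum_eq_zero fun i _ => ?_
      simp [hy]
    rw [this, add_zero]

/-- A positive continuous function on a compact space is bounded away from zero. -/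
lemma exists_pos_le {K : Type*} [TopologicalSpace K] [CompactSpace K] {f : K → ℝ}
    (hf : Continuous f) (hpos : ∀ x, 0 < f x) : ∃ r, 0 < r ∧ ∀ x, r ≤ f x := by
  rcases isEmpty_or_nonempty K with h | h
  · exact ⟨1, one_pos, fun x => h.elim x⟩
  · obtain ⟨x, -, hx⟩ := isCompact_univ.exists_isMinOn univ_nonempty hf.continuousOn
    exact ⟨f x, hpos x, fun y => hx (mem_univ y)⟩

/-- The coordinates of an ordered configuration of points in the disk, as complex numbers. -/
def coords {m : ℕ} (x : OrderedConf m) (i : Fin m) : ℂ := (x.1 i : ℂ)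

@[fun_prop]
lemma continuous_coords {m : ℕ} : Continuous (coords (m := m)) :=
  continuous_pi fun i =>
    continuous_subtype_val.comp ((continuous_apply i).comp continuous_subtype_val)

lemma coords_injective {m : ℕ} (x : OrderedConf m) : Function.Injective (coords x) :=
  Subtype.val_injective.comp x.2

lemma norm_coords_lt {m : ℕ} (x : OrderedConf m) (i : Fin m) : ‖coords x i‖ < 1 := (x.1 i).2

/-- Isotopy extension: a motion of configurations, depending on a parameter in a compact space, is
followed by homeomorphisms of the plane that depend continuously on the parameter, fix the outside
of the disk, and are the identity for each parameter whose motion is constant. -/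
theorem exists_push {m : ℕ} {Y : Type*} [TopologicalSpace Y] [CompactSpace Y]
    (c : C(I × Y, OrderedConf m)) :
    ∃ Φ : Y × ℂ ≃ₜ Y × ℂ, (∀ x, (Φ x).1 = x.1) ∧
      (∀ y i, (Φ (y, coords (c (0, y)) i)).2 = coords (c (1, y)) i) ∧
      (∀ y z, 1 ≤ ‖z‖ → (Φ (y, z)).2 = z) ∧
      (∀ y, (∀ s, c (s, y) = c (0, y)) → ∀ z, (Φ (y, z)).2 = z) := by
  -- By compactness, the motion is a composition of finitely many motions that are so small that the
  -- points stay separated, compared with the distances that they move.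
  obtain ⟨r₁, hr₁, hsep⟩ := exists_pos_le
    (K := (I × Y) × {ij : Fin m × Fin m // ij.1 ≠ ij.2})
    (f := fun x => ‖coords (c x.1) x.2.1.1 - coords (c x.1) x.2.1.2‖)
    (by
      rw [continuous_prod_of_discrete_right]
      intro ij
      have h : ∀ i, Continuous fun x => coords (c x) i := fun i =>
        (continuous_apply i).comp (continuous_coords.comp c.continuous)
      exact ((h ij.1.1).sub (h ij.1.2)).norm)
    (fun x => norm_pos_iff.2 (sub_ne_zero.2 fun h => x.2.2 (coords_injective _ h)))
  obtain ⟨r₂, hr₂, hfar⟩ := exists_pos_le (K := (I × Y) × Fin m)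
    (f := fun x => 1 - ‖coords (c x.1) x.2‖)
    (by
      rw [continuous_prod_of_discrete_right]
      intro i
      exact continuous_const.sub
        ((continuous_apply i).comp (continuous_coords.comp c.continuous)).norm)
    (fun x => sub_pos.2 (norm_coords_lt _ _))
  obtain ⟨r, hr, hrr₁, hrr₂⟩ : ∃ r, 0 < r ∧ r ≤ r₁ ∧ r ≤ r₂ :=
    ⟨min r₁ r₂, lt_min hr₁ hr₂, min_le_left _ _, min_le_right _ _⟩
  let C : C(I, C(Y, Fin m → ℂ)) :=
    ContinuousMap.curry ⟨fun x => coords (c x), continuous_coords.comp c.continuous⟩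
  have hε : 0 < r / 2 / (m + 1) / 2 := by positivity
  obtain ⟨t, t0, tm, ⟨N, hN⟩, hsub⟩ := exists_monotone_Icc_subset_open_cover_unitInterval
    (fun s : I => (Metric.isOpen_ball (x := C s) (ε := r / 2 / (m + 1) / 2)).preimage C.continuous)
    (fun s _ => mem_iUnion.2 ⟨s, Metric.mem_ball_self hε⟩)
  have tmono : ∀ n, t n ≤ t (n + 1) := fun n => tm n.le_succ
  have hclose : ∀ n y i, m * ‖coords (c (t (n + 1), y)) i - coords (c (t n, y)) i‖ ≤ r / 2 := by
    intro n y i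
    obtain ⟨s, hs⟩ := hsub n
    have h1 : dist (C (t n)) (C s) < _ := hs ⟨le_rfl, tmono n⟩
    have h2 : dist (C (t (n + 1))) (C s) < _ := hs ⟨tmono n, le_rfl⟩
    have h3 : dist (C (t (n + 1))) (C (t n)) ≤ r / 2 / (m + 1) := by
      have := dist_triangle_right (C (t (n + 1))) (C (t n)) (C s)
      linarith
    have h4 : dist (C (t (n + 1)) y i) (C (t n) y i) ≤ r / 2 / (m + 1) :=
      ((dist_le_pi_dist _ _ i).trans (ContinuousMap.dist_apply_le_dist y)).trans h3
    rw [dist_eq_norm] at h4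
    have h5 : ‖coords (c (t (n + 1), y)) i - coords (c (t n, y)) i‖ ≤ r / 2 / (m + 1) := h4
    have hm : (0 : ℝ) ≤ m := Nat.cast_nonneg m
    calc m * ‖coords (c (t (n + 1), y)) i - coords (c (t n, y)) i‖
        ≤ (m + 1) * (r / 2 / (m + 1)) := by gcongr; linarith
      _ = r / 2 := by field_simp
  have key : ∀ n, ∃ Φ : Y × ℂ ≃ₜ Y × ℂ, (∀ x, (Φ x).1 = x.1) ∧
      (∀ y i, (Φ (y, coords (c (0, y)) i)).2 = coords (c (t n, y)) i) ∧
      (∀ y z, 1 ≤ ‖z‖ → (Φ (y, z)).2 = z) ∧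
      (∀ y, (∀ s, c (s, y) = c (0, y)) → ∀ z, (Φ (y, z)).2 = z) := by
    intro n
    induction n with
    | zero =>
      refine ⟨Homeomorph.refl _, fun _ => rfl, fun y i => ?_, fun _ _ _ => rfl, fun _ _ _ => rfl⟩
      rw [t0]
      rfl
    | succ n ih =>
      obtain ⟨Φ, h1, h2, h3, h4⟩ := ih
      have hcont : ∀ s, Continuous fun y => coords (c (s, y)) := fun s =>
        continuous_coords.comp (c.continuous.comp (by fun_prop))
      obtain ⟨Ψ, g1, g2, g3, g4⟩ := exists_push_of_close
        (fun y => coords (c (t n, y))) (fun y => coords (c (t (n + 1), y)))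
        (hcont _) (hcont _) hr
        (fun y i j hij => hrr₁.trans (hsep ((t n, y), ⟨(i, j), hij⟩)))
        (fun y i => by have := hfar ((t n, y), i); simp only at this; linarith) (hclose n)
      have hmk : ∀ y z, Φ (y, z) = (y, (Φ (y, z)).2) := fun y z => Prod.ext (h1 _) rfl
      refine ⟨Φ.trans Ψ, fun x => ?_, fun y i => ?_, fun y z hz => ?_, fun y hy z => ?_⟩
      · rw [Homeomorph.trans_apply, g1, h1]
      · rw [Homeomorph.trans_apply, hmk, h2, g2]
      · rw [Homeomorph.trans_apply, hmk, h3 y z hz, g3 y z hz]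
      · rw [Homeomorph.trans_apply, hmk, h4 y hy, g4]
        simp only [hy]
  obtain ⟨Φ, h1, h2, h3, h4⟩ := key N
  exact ⟨Φ, h1, fun y i => by rw [h2, hN N le_rfl], h3, h4⟩

/-! ### Twists -/

/-- The cut-off function of the twists: `1` up to radius `R` and `0` from radius `R + 1 / 12` on. -/
def damp (R ρ : ℝ) : ℝ := max 0 (min 1 ((R + 1 / 12 - ρ) * 12))

lemma damp_of_le {R ρ : ℝ} (h : ρ ≤ R) : damp R ρ = 1 := by
  unfold damp
  rw [min_eq_left (by linarith), max_eq_right zero_le_one]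

lemma damp_of_ge {R ρ : ℝ} (h : R + 1 / 12 ≤ ρ) : damp R ρ = 0 := by
  unfold damp
  rw [min_eq_right (by linarith), max_eq_left (by linarith)]

@[fun_prop]
lemma continuous_damp (R : ℝ) : Continuous (damp R) := by
  unfold damp
  fun_prop

/-- The twist about `c`: it rotates the disk of radius `R` about `c` through the angle `π * θ`, and
fixes the points at distance at least `R + 1 / 12` from `c`. -/
def twist (c : ℂ) (R θ : ℝ) (z : ℂ) : ℂ :=
  c + (z - c) * Complex.exp (((Real.pi * (θ * damp R ‖z - c‖) : ℝ) : ℂ) * Complex.I)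

lemma norm_twist_sub (c : ℂ) (R θ : ℝ) (z : ℂ) : ‖twist c R θ z - c‖ = ‖z - c‖ := by
  unfold twist
  rw [add_sub_cancel_left, norm_mul, Complex.norm_exp_ofReal_mul_I, mul_one]

lemma twist_twist (c : ℂ) (R θ θ' : ℝ) (z : ℂ) :
    twist c R θ (twist c R θ' z) = twist c R (θ + θ') z := by
  conv_lhs => rw [twist, norm_twist_sub]
  rw [twist, twist, add_sub_cancel_left, mul_assoc, ← Complex.exp_add]
  congr 3
  push_cast
  ring

@[simp] lemma twist_zero_apply (c : ℂ) (R : ℝ) (z : ℂ) : twist c R 0 z = z := by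
  simp [twist]

lemma twist_of_le {c : ℂ} {R : ℝ} {z : ℂ} (θ : ℝ) (h : ‖z - c‖ ≤ R) :
    twist c R θ z = c + (z - c) * Complex.exp (Real.pi * θ * Complex.I) := by
  rw [twist, damp_of_le h]
  push_cast
  rw [mul_one]

lemma twist_of_ge {c : ℂ} {R : ℝ} {z : ℂ} (θ : ℝ) (h : R + 1 / 12 ≤ ‖z - c‖) :
    twist c R θ z = z := by
  rw [twist, damp_of_ge h]
  simp

@[fun_prop]
lemma continuous_twist (c : ℂ) (R : ℝ) : Continuous fun p : ℝ × ℂ => twist c R p.1 p.2 := by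
  unfold twist
  fun_prop

/-- The twist as a homeomorphism of the plane. -/
def twistHomeo (c : ℂ) (R θ : ℝ) : ℂ ≃ₜ ℂ where
  toFun := twist c R θ
  invFun := twist c R (-θ)
  left_inv z := by rw [twist_twist]; simp
  right_inv z := by rw [twist_twist]; simp
  continuous_toFun := (continuous_twist c R).comp (by fun_prop : Continuous fun z => (θ, z))
  continuous_invFun := (continuous_twist c R).comp (by fun_prop : Continuous fun z => (-θ, z))

/-! ### Braids realized by isotopies -/

/-- The braid `g` is traced out by the base configuration under an isotopy of the plane that fixes
the outside of the disk, starts at the identity and ends at `ψ`. -/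
def Realizes {m : ℕ} (g : BraidGroup m) (ψ : ℂ ≃ₜ ℂ) : Prop :=
  ∃ Ψ : C(I × ℂ, ℂ), (∀ t, Function.Injective fun z => Ψ (t, z)) ∧ (∀ z, Ψ (0, z) = z) ∧
    (∀ z, Ψ (1, z) = ψ z) ∧ (∀ t z, 1 ≤ ‖z‖ → Ψ (t, z) = z) ∧
    ∃ γ : Path (baseConf m) (baseConf m), braidClass γ = g ∧
      ∀ t, Subtype.val '' (γ t).points = (fun z => Ψ (t, z)) '' range (basePos m)

lemma val_image_points_baseConf (m : ℕ) :
    Subtype.val '' (baseConf m).points = range (basePos m) := by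
  rw [baseConf, Conf.points_mk, ← range_comp]
  rfl

lemma Realizes.image_range {m : ℕ} {g : BraidGroup m} {ψ : ℂ ≃ₜ ℂ} (h : Realizes g ψ) :
    ψ '' range (basePos m) = range (basePos m) := by
  obtain ⟨Ψ, -, -, h1, -, γ, -, hγ⟩ := h
  have h := hγ 1
  rw [γ.target, val_image_points_baseConf] at h
  rw [← image_congr fun z _ => h1 z, ← h]

lemma Realizes.one (m : ℕ) : Realizes (1 : BraidGroup m) (Homeomorph.refl ℂ) :=
  ⟨⟨Prod.snd, continuous_snd⟩, fun _ _ _ h => h, fun _ => rfl, fun _ => rfl, fun _ _ _ => rfl,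
    Path.refl _, rfl, fun t => by
      rw [Path.refl_apply, val_image_points_baseConf]
      exact (image_id _).symm⟩

lemma Realizes.mul {m : ℕ} {g g' : BraidGroup m} {ψ ψ' : ℂ ≃ₜ ℂ} (h : Realizes g ψ)
    (h' : Realizes g' ψ') : Realizes (g * g') (ψ.trans ψ') := by
  have himg := h.image_range
  obtain ⟨Ψ, hinj, h0, h1, hout, γ, rfl, hγ⟩ := h
  obtain ⟨Ψ', hinj', h0', h1', hout', γ', rfl, hγ'⟩ := h'
  let F : ContinuousMap.Homotopy (ContinuousMap.id ℂ) (ψ : C(ℂ, ℂ)) := ⟨Ψ, h0, h1⟩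
  let F' : ContinuousMap.Homotopy (ψ : C(ℂ, ℂ)) (ψ.trans ψ' : C(ℂ, ℂ)) :=
    ⟨Ψ'.comp ⟨fun p => (p.1, ψ p.2), by fun_prop⟩, fun z => h0' _, fun z => h1' _⟩
  have hF : ∀ t z, F (t, z) = Ψ (t, z) := fun _ _ => rfl
  have hF' : ∀ t z, F' (t, z) = Ψ' (t, ψ z) := fun _ _ => rfl
  have hψ : ∀ z, 1 ≤ ‖z‖ → ψ z = z := fun z hz => by rw [← h1, hout _ _ hz]
  refine ⟨(F.trans F').toContinuousMap, fun t => ?_, fun z => (F.trans F').apply_zero z,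
    fun z => (F.trans F').apply_one z, fun t z hz => ?_, γ.trans γ', rfl, fun t => ?_⟩
  · change Function.Injective fun z => (F.trans F') (t, z)
    simp only [ContinuousMap.Homotopy.trans_apply, hF, hF']
    split_ifs
    · exact fun z w h => hinj _ h
    · exact fun z w h => ψ.injective (hinj' _ h)
  · change (F.trans F') (t, z) = z
    simp only [ContinuousMap.Homotopy.trans_apply, hF, hF']
    split_ifs
    · exact hout _ _ hz
    · rw [hψ z hz, hout' _ _ hz]
  · change _ = (fun z => (F.trans F') (t, z)) '' _
    simp only [ContinuousMap.Homotopy.trans_apply, hF, hF', Path.trans_apply]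
    split_ifs
    · exact hγ _
    · rw [hγ', ← himg, image_image, himg]

lemma Realizes.inv {m : ℕ} {g : BraidGroup m} {ψ : ℂ ≃ₜ ℂ} (h : Realizes g ψ) :
    Realizes g⁻¹ ψ.symm := by
  have himg := h.image_range
  obtain ⟨Ψ, hinj, h0, h1, hout, γ, rfl, hγ⟩ := h
  have himg' : ψ.symm '' range (basePos m) = range (basePos m) := by
    conv_lhs => rw [← himg]
    rw [image_image]
    simp
  have hψ : ∀ z, 1 ≤ ‖z‖ → ψ.symm z = z := fun z hz => by
    rw [Homeomorph.symm_apply_eq, ← h1, hout _ _ hz]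
  refine ⟨⟨fun p => Ψ (σ p.1, ψ.symm p.2), by fun_prop⟩, fun t z w h => ψ.symm.injective (hinj _ h),
    fun z => ?_, fun z => ?_, fun t z hz => ?_, γ.symm, rfl, fun t => ?_⟩
  · simp [h1]
  · simp [h0]
  · simp only [ContinuousMap.coe_mk]
    rw [hψ z hz, hout _ _ hz]
  · simp only [ContinuousMap.coe_mk]
    rw [Path.symm_apply, Function.comp_apply, hγ]
    conv_lhs => rw [← himg', image_image]

/-- The labelled points of the base configuration, carried along by the isotopy. -/
lemma Realizes.exists_ordered {m : ℕ} {g : BraidGroup m} {ψ : ℂ ≃ₜ ℂ} (h : Realizes g ψ) :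
    ∃ Ψ : C(I × ℂ, ℂ), (∀ t, Function.Injective fun z => Ψ (t, z)) ∧ (∀ z, Ψ (0, z) = z) ∧
      (∀ z, Ψ (1, z) = ψ z) ∧ (∀ t z, 1 ≤ ‖z‖ → Ψ (t, z) = z) ∧
      ∃ (γ : Path (baseConf m) (baseConf m)) (ω : C(I, OrderedConf m)), braidClass γ = g ∧
        (∀ t, γ t = Quotient.mk _ (ω t)) ∧ ∀ t i, coords (ω t) i = Ψ (t, basePos m i) := by
  obtain ⟨Ψ, hinj, h0, h1, hout, γ, hg, hγ⟩ := h
  have hlt : ∀ t i, ‖Ψ (t, basePos m i)‖ < 1 := by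
    intro t i
    have : Ψ (t, basePos m i) ∈ Subtype.val '' (γ t).points := by
      rw [hγ]
      exact ⟨_, mem_range_self i, rfl⟩
    obtain ⟨z, -, hz⟩ := this
    rw [← hz]
    exact z.2
  let ω : I → OrderedConf m := fun t => ⟨fun i => ⟨_, hlt t i⟩, fun i j hij =>
    basePos_injective m (hinj t (congrArg Subtype.val hij))⟩
  have hω : Continuous ω := by
    refine Continuous.subtype_mk (continuous_pi fun i => Continuous.subtype_mk ?_ _) _
    fun_prop
  refine ⟨Ψ, hinj, h0, h1, hout, γ, ⟨ω, hω⟩, hg, fun t => ?_, fun t i => rfl⟩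
  apply Conf.points_injective
  apply Subtype.val_injective.image_injective
  rw [hγ, ← range_comp]
  exact range_comp Subtype.val (fun i => (ω t).1 i)

/-- A loop of configurations in which the points of the base configuration are twisted is realized
by that twist. -/
lemma realizes_twist {m : ℕ} {c : ℂ} {R : ℝ} (hc : ‖c‖ + R + 1 / 12 ≤ 1)
    (γ : Path (baseConf m) (baseConf m)) (ω : I → OrderedConf m)
    (hγ : ∀ t, γ t = Quotient.mk _ (ω t))
    (hω : ∀ t i, coords (ω t) i = twist c R t (basePos m i)) :
    Realizes (braidClass γ) (twistHomeo c R 1) := by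
  refine ⟨⟨fun p => twist c R p.1 p.2, (continuous_twist c R).comp
    (by fun_prop : Continuous fun p : I × ℂ => ((p.1 : ℝ), p.2))⟩,
    fun t => (twistHomeo c R t).injective, fun z => twist_zero_apply c R z,
    fun z => ?_, fun t z hz => ?_, γ, rfl, fun t => ?_⟩
  · simp [twistHomeo]
  · refine twist_of_ge _ ?_
    have := norm_sub_norm_le z c
    linarith
  · rw [hγ, Conf.points_mk, ← range_comp, ← range_comp]
    exact congrArg range (funext fun i => hω t i)

lemma basePos_three_zero : basePos 3 0 = -2 / 3 := by
  unfold basePos; norm_num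

lemma basePos_three_one : basePos 3 1 = 0 := by
  unfold basePos; norm_num

lemma basePos_three_two : basePos 3 2 = 2 / 3 := by
  unfold basePos; norm_num

lemma realizes_sigma1 : Realizes sigma1 (twistHomeo (-1 / 3) (1 / 2) 1) := by
  refine realizes_twist (by norm_num) (twistLoop 3 0 _) (fun t => orderedTwist 3 0 (by norm_num) t)
    (fun _ => rfl) fun t i => ?_
  change twistPos 3 0 t i = _
  fin_cases i
  · simp only [Fin.zero_eta, basePos_three_zero]
    rw [twist_of_le _ (by norm_num)]
    simp [twistPos]
    ring
  · simp only [Fin.mk_one, basePos_three_one]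
    rw [twist_of_le _ (by norm_num)]
    simp [twistPos]
    ring
  · simp only [Fin.reduceFinMk, basePos_three_two]
    rw [twist_of_ge _ (by norm_num)]
    norm_num [twistPos]

lemma realizes_sigma2 : Realizes sigma2 (twistHomeo (1 / 3) (1 / 2) 1) := by
  refine realizes_twist (by norm_num) (twistLoop 3 1 _) (fun t => orderedTwist 3 1 (by norm_num) t)
    (fun _ => rfl) fun t i => ?_
  change twistPos 3 1 t i = _
  fin_cases i
  · simp only [Fin.zero_eta, basePos_three_zero]
    rw [twist_of_ge _ (by norm_num)]
    norm_num [twistPos]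
  · simp only [Fin.mk_one, basePos_three_one]
    rw [twist_of_le _ (by norm_num)]
    norm_num [twistPos]
    ring
  · simp only [Fin.reduceFinMk, basePos_three_two]
    rw [twist_of_le _ (by norm_num)]
    norm_num [twistPos]
    ring

/-! ### The half twist of Garside -/

/-- Homotopic paths of ordered configurations represent the same braid. -/
lemma braidClass_eq_of_ordered {m : ℕ} {γ γ' : Path (baseConf m) (baseConf m)}
    {x y : OrderedConf m} {ω ω' : Path x y} (h : ω.Homotopic ω')
    (hγ : ∀ t, γ t = Quotient.mk _ (ω t)) (hγ' : ∀ t, γ' t = Quotient.mk _ (ω' t)) :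
    braidClass γ = braidClass γ' := by
  unfold braidClass
  congr 2
  rw [Path.Homotopic.Quotient.eq]
  have hx : baseConf m = Quotient.mk _ x := by rw [← γ.source, hγ, ω.source]
  have hy : baseConf m = Quotient.mk _ y := by rw [← γ.target, hγ, ω.target]
  have h' := (h.map ⟨_, (isCoveringMap_mk m).continuous⟩).pathCast hx hy
  convert h' using 1
  · ext t; exact hγ t
  · ext t; exact hγ' t

/-- The configuration `y` is the rotation by `f` of the base configuration, and for all `i < j` the
vectors from point `i` to point `j` in `x` and `y` form an angle of at most `π / 2`. -/
def AlignedAt {m : ℕ} (f : ℂ) (x y : OrderedConf m) : Prop :=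
  ‖f‖ = 1 ∧ (∀ i, coords y i = basePos m i * f) ∧
    ∀ i j, i < j → 0 ≤ ((coords x j - coords x i) * (starRingEnd ℂ) f).re

/-- Two ordered configurations are aligned if the segments between them avoid collisions because
corresponding differences of points form an angle of at most `π / 2`. -/
def Aligned {m : ℕ} (x y : OrderedConf m) : Prop := ∃ f, AlignedAt f x y

lemma Aligned.lineMap_ne {m : ℕ} {x y : OrderedConf m} (h : Aligned x y) (s : I) {i j : Fin m}
    (hij : i ≠ j) : AffineMap.lineMap (coords x i) (coords y i) (s : ℝ) ≠
      AffineMap.lineMap (coords x j) (coords y j) (s : ℝ) := by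
  wlog hlt : i < j generalizing i j
  · exact fun h' => this hij.symm (lt_of_le_of_ne (not_lt.1 hlt) hij.symm) h'.symm
  obtain ⟨f, hf, hy, hx⟩ := h
  have hs0 := s.2.1
  have hs1 := s.2.2
  have hff : f * (starRingEnd ℂ) f = 1 := by
    rw [Complex.mul_conj, Complex.normSq_eq_norm_sq, hf]; simp
  have hpos : 0 < (2 * ((j : ℕ) - (i : ℕ) : ℝ)) / m := by
    have h1 : ((i : ℕ) : ℝ) < (j : ℕ) := by exact_mod_cast hlt
    have h2 : (0 : ℝ) < m := by
      have := i.2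
      exact_mod_cast (by omega : 0 < m)
    exact div_pos (by linarith) h2
  have hbase : basePos m j - basePos m i = (((2 * ((j : ℕ) - (i : ℕ) : ℝ)) / m : ℝ) : ℂ) := by
    unfold basePos; push_cast; ring
  set c := (2 * ((j : ℕ) - (i : ℕ) : ℝ)) / m
  intro heq
  simp only [AffineMap.lineMap_apply_module, Complex.real_smul] at heq
  set w := (coords x j - coords x i) * (starRingEnd ℂ) f with hw
  have h0 : ((1 - s : ℝ) : ℂ) * w + ((s * c : ℝ) : ℂ) = 0 := by
    rw [hy, hy] at heq
    push_cast at heq ⊢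
    rw [← hbase, hw]
    linear_combination (-(starRingEnd ℂ) f) * heq - s * (basePos m j - basePos m i) * hff
  have hre := congrArg Complex.re h0
  rw [Complex.add_re, Complex.re_ofReal_mul, Complex.ofReal_re, Complex.zero_re] at hre
  have hw0 : 0 ≤ w.re := hx i j hlt
  have h1 : 0 ≤ (1 - (s : ℝ)) * w.re := mul_nonneg (by linarith) hw0
  have h2 : 0 ≤ (s : ℝ) * c := by positivity
  have h3 : (s : ℝ) = 0 := by
    have : (s : ℝ) * c = 0 := by linarith
    rcases mul_eq_zero.1 this with h | h
    · exact h
    · exact absurd h hpos.ne'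
  rw [h3] at h0
  have h4 : w = 0 := by simpa using h0
  rcases mul_eq_zero.1 h4 with h | h
  · exact hij (coords_injective x (sub_eq_zero.1 h)).symm
  · rw [h, mul_zero] at hff
    exact zero_ne_one hff

lemma homotopic_of_aligned {m : ℕ} {x y : OrderedConf m} {ω ω' : Path x y}
    (h : ∀ t, Aligned (ω t) (ω' t)) : ω.Homotopic ω' := by
  have hlt : ∀ (s t : I) i,
      ‖AffineMap.lineMap (coords (ω t) i) (coords (ω' t) i) (s : ℝ)‖ < 1 := by
    intro s t i
    have h1 := (convex_ball (0 : ℂ) 1).lineMap_mem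
      (mem_ball_zero_iff.2 (norm_coords_lt (ω t) i))
      (mem_ball_zero_iff.2 (norm_coords_lt (ω' t) i)) s.2
    exact mem_ball_zero_iff.1 h1
  have hend : ∀ (x : OrderedConf m) (s : ℝ) i,
      AffineMap.lineMap (coords x i) (coords x i) s = coords x i := fun x s i => by simp
  refine ⟨⟨⟨⟨fun p => ⟨fun i => ⟨_, hlt p.1 p.2 i⟩, fun i j hij => ?_⟩, ?_⟩, ?_, ?_⟩, ?_⟩⟩
  · by_contra hne
    exact (h p.2).lineMap_ne p.1 hne (congrArg Subtype.val hij)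
  · refine Continuous.subtype_mk (continuous_pi fun i => Continuous.subtype_mk ?_ _) _
    have h1 : Continuous fun p : I × I => coords (ω p.2) i :=
      (continuous_apply i).comp (continuous_coords.comp (ω.continuous.comp continuous_snd))
    have h2 : Continuous fun p : I × I => coords (ω' p.2) i :=
      (continuous_apply i).comp (continuous_coords.comp (ω'.continuous.comp continuous_snd))
    simp only [AffineMap.lineMap_apply_module]
    fun_prop
  · intro t
    apply Subtype.ext; funext i; apply Subtype.ext
    simp [coords]
  · intro t
    apply Subtype.ext; funext i; apply Subtype.ext
    simp [coords]
  · rintro s t (rfl | rfl) <;>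
    · apply Subtype.ext; funext i; apply Subtype.ext
      simp [coords]

lemma forall_aligned_trans {m : ℕ} {x y z y' z' : OrderedConf m} {ω₁ : Path x y} {ω₂ : Path y z}
    {ω₁' : Path x y'} {ω₂' : Path y' z'} (h₁ : ∀ t, Aligned (ω₁ t) (ω₁' t))
    (h₂ : ∀ t, Aligned (ω₂ t) (ω₂' t)) (t : I) :
    Aligned ((ω₁.trans ω₂) t) ((ω₁'.trans ω₂') t) := by
  simp only [Path.trans_apply]
  split_ifs
  · exact h₁ _
  · exact h₂ _

/-! ### Full and half rotations of the base configuration -/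

lemma coords_ext {m : ℕ} {x y : OrderedConf m} (h : ∀ i, coords x i = coords y i) : x = y :=
  Subtype.ext (funext fun i => Subtype.ext (h i))

lemma coords_relabel {m : ℕ} (τ : Equiv.Perm (Fin m)) (x : OrderedConf m) (i : Fin m) :
    coords (τ • x) i = coords x (τ⁻¹ i) := rfl

lemma mk_relabel {m : ℕ} (τ : Equiv.Perm (Fin m)) (x : OrderedConf m) :
    (Quotient.mk _ (τ • x) : Conf m) = Quotient.mk _ x :=
  Quotient.sound ⟨τ, fun j => by rw [relabel_apply]; simp⟩

lemma continuous_relabel {m : ℕ} (τ : Equiv.Perm (Fin m)) :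
    Continuous fun x : OrderedConf m => τ • x := by
  refine Continuous.subtype_mk (continuous_pi fun j => ?_) _
  exact (continuous_apply (τ⁻¹ j)).comp continuous_subtype_val

/-- The base configuration, rotated through the angle `π * θ`. -/
def rotated (m : ℕ) : C(ℝ, OrderedConf m) where
  toFun θ := ⟨fun i => ⟨basePos m i * Complex.exp (Real.pi * θ * Complex.I), by
      rw [norm_mul, norm_exp_pi, mul_one]; exact basePos_norm_lt m i⟩,
    fun i j h => basePos_injective m
      (mul_right_cancel₀ (Complex.exp_ne_zero _) (congrArg Subtype.val h))⟩
  continuous_toFun := by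
    refine Continuous.subtype_mk (continuous_pi fun i => Continuous.subtype_mk ?_ _) _
    fun_prop

lemma coords_rotated (m : ℕ) (θ : ℝ) (i : Fin m) :
    coords (rotated m θ) i = basePos m i * Complex.exp (Real.pi * θ * Complex.I) := rfl

lemma rotated_zero (m : ℕ) : rotated m 0 = orderedBase m :=
  coords_ext fun i => by
    rw [coords_rotated]
    simp only [Complex.ofReal_zero, mul_zero, zero_mul, Complex.exp_zero, mul_one]
    rfl

/-- A half turn permutes the points of the base configuration. -/
lemma rotated_add_one (m : ℕ) (θ : ℝ) :
    (Quotient.mk _ (rotated m (θ + 1)) : Conf m) = Quotient.mk _ (rotated m θ) := by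
  have h : rotated m (θ + 1) = (Fin.revPerm : Equiv.Perm (Fin m)) • rotated m θ := by
    refine coords_ext fun i => ?_
    rw [coords_rotated, coords_relabel, coords_rotated]
    change _ = basePos m i.rev * _
    have hi : ((i.rev : ℕ) : ℂ) = m - (i + 1) := by
      rw [Fin.val_rev, Nat.cast_sub i.2]; push_cast; ring
    have he : Complex.exp (Real.pi * (θ + 1 : ℝ) * Complex.I) =
        -Complex.exp (Real.pi * θ * Complex.I) := by
      rw [show (Real.pi * (θ + 1 : ℝ) * Complex.I : ℂ) =
        Real.pi * θ * Complex.I + Real.pi * Complex.I by push_cast; ring, Complex.exp_add,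
        Complex.exp_pi_mul_I, mul_neg_one]
    unfold basePos
    rw [hi, he]
    ring
  rw [h, mk_relabel]

lemma rotated_one (m : ℕ) : (Quotient.mk _ (rotated m 1) : Conf m) = baseConf m := by
  have h := rotated_add_one m 0
  rw [zero_add, rotated_zero] at h
  exact h

/-- The half rotation of the base configuration, as a loop of unordered configurations. -/
def halfRotation (m : ℕ) : Path (baseConf m) (baseConf m) where
  toFun t := Quotient.mk _ (rotated m t)
  continuous_toFun :=
    continuous_quotient_mk'.comp ((rotated m).continuous.comp continuous_subtype_val)
  source' := by rw [Icc.coe_zero, rotated_zero]; rfl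
  target' := by rw [Icc.coe_one, rotated_one]

lemma coords_orderedTwist_zero (t : ℝ) :
    coords (orderedTwist 3 0 (by norm_num) t) 0 =
      (-1 - Complex.exp (Real.pi * t * Complex.I)) / 3 ∧
    coords (orderedTwist 3 0 (by norm_num) t) 1 =
      (-1 + Complex.exp (Real.pi * t * Complex.I)) / 3 ∧
    coords (orderedTwist 3 0 (by norm_num) t) 2 = 2 / 3 := by
  refine ⟨?_, ?_, ?_⟩
  · change twistPos 3 0 t 0 = _
    norm_num [twistPos]
  · change twistPos 3 0 t 1 = _
    norm_num [twistPos]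
  · change twistPos 3 0 t 2 = _
    norm_num [twistPos]

lemma coords_orderedTwist_one (t : ℝ) :
    coords (orderedTwist 3 1 (by norm_num) t) 0 = -2 / 3 ∧
    coords (orderedTwist 3 1 (by norm_num) t) 1 =
      (1 - Complex.exp (Real.pi * t * Complex.I)) / 3 ∧
    coords (orderedTwist 3 1 (by norm_num) t) 2 =
      (1 + Complex.exp (Real.pi * t * Complex.I)) / 3 := by
  refine ⟨?_, ?_, ?_⟩
  · change twistPos 3 1 t 0 = _
    norm_num [twistPos]
  · change twistPos 3 1 t 1 = _
    norm_num [twistPos]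
  · change twistPos 3 1 t 2 = _
    norm_num [twistPos]

lemma aligned_of_degree_three {f : ℂ} {x y : OrderedConf 3} (hf : ‖f‖ = 1)
    (hy : ∀ i, coords y i = basePos 3 i * f)
    (h01 : 0 ≤ ((coords x 1 - coords x 0) * (starRingEnd ℂ) f).re)
    (h02 : 0 ≤ ((coords x 2 - coords x 0) * (starRingEnd ℂ) f).re)
    (h12 : 0 ≤ ((coords x 2 - coords x 1) * (starRingEnd ℂ) f).re) : Aligned x y := by
  refine ⟨f, hf, hy, fun i j hij => ?_⟩
  fin_cases i <;> fin_cases j <;> first | assumption | exact absurd hij (by decide)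

lemma exp_half_angle (t : I) :
    ‖Complex.exp (((Real.pi * (t / 2) : ℝ) : ℂ) * Complex.I)‖ = 1 ∧
    Complex.exp (((Real.pi * (t / 2) : ℝ) : ℂ) * Complex.I) *
      (starRingEnd ℂ) (Complex.exp (((Real.pi * (t / 2) : ℝ) : ℂ) * Complex.I)) = 1 ∧
    Complex.exp (Real.pi * t * Complex.I) =
      Complex.exp (((Real.pi * (t / 2) : ℝ) : ℂ) * Complex.I) *
      Complex.exp (((Real.pi * (t / 2) : ℝ) : ℂ) * Complex.I) ∧
    0 ≤ (Complex.exp (((Real.pi * (t / 2) : ℝ) : ℂ) * Complex.I)).re ∧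
    0 ≤ (Complex.exp (((Real.pi * (t / 2) : ℝ) : ℂ) * Complex.I)).im := by
  have h0 := t.2.1
  have h1 := t.2.2
  have hf := Complex.norm_exp_ofReal_mul_I (Real.pi * (t / 2))
  refine ⟨hf, ?_, ?_, ?_, ?_⟩
  · rw [Complex.mul_conj, Complex.normSq_eq_norm_sq, hf]; simp
  · rw [← Complex.exp_add]
    congr 1
    push_cast
    ring
  · rw [Complex.exp_ofReal_mul_I_re]
    exact Real.cos_nonneg_of_mem_Icc ⟨by nlinarith [Real.pi_pos], by nlinarith [Real.pi_pos]⟩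
  · rw [Complex.exp_ofReal_mul_I_im]
    exact Real.sin_nonneg_of_nonneg_of_le_pi (by positivity) (by nlinarith [Real.pi_pos])

/-- During the first factor of `σ₁ σ₂ σ₁`, the motion is compared with a quarter turn. -/
lemma aligned_initial_sigma1 (t : I) :
    Aligned (orderedTwist 3 0 (by norm_num) t) (rotated 3 (t / 2)) := by
  obtain ⟨hf, hff, hexp, hre, him⟩ := exp_half_angle t
  obtain ⟨k0, k1, k2⟩ := coords_orderedTwist_zero t
  refine aligned_of_degree_three (x := orderedTwist 3 0 (by norm_num) t) hf (fun i => ?_) ?_ ?_ ?_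
  · rw [coords_rotated]
    congr 3
    push_cast
    ring
  · rw [k0, k1, hexp, show ∀ f g : ℂ, ((-1 + f * f) / 3 - (-1 - f * f) / 3) * g =
      ((2 / 3 : ℝ) : ℂ) * f * (f * g) by intros; push_cast; ring, hff, mul_one,
      Complex.re_ofReal_mul]
    positivity
  · rw [k0, k2, hexp, show ∀ f g : ℂ, (2 / 3 - (-1 - f * f) / 3) * g =
      g + ((1 / 3 : ℝ) : ℂ) * f * (f * g) by intros; push_cast; ring, hff, mul_one,
      Complex.add_re, Complex.re_ofReal_mul, Complex.conj_re]
    positivity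
  · rw [k1, k2, hexp, show ∀ f g : ℂ, (2 / 3 - (-1 + f * f) / 3) * g =
      g - ((1 / 3 : ℝ) : ℂ) * f * (f * g) by intros; push_cast; ring, hff, mul_one,
      Complex.sub_re, Complex.re_ofReal_mul, Complex.conj_re]
    linarith

/-- During the second factor of `σ₁ σ₂ σ₁`, the comparison stops after a quarter turn. The
permutation takes care of the labels, since `σ₁` has exchanged the first two points. -/
lemma aligned_middle_sigma2 (t : I) :
    Aligned ((Equiv.swap 0 1 : Equiv.Perm (Fin 3)) • orderedTwist 3 1 (by norm_num) t)
      (rotated 3 (1 / 2 : ℝ)) := by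
  have s0 : (Equiv.swap 0 1 : Equiv.Perm (Fin 3))⁻¹ 0 = 1 := by decide
  have s1 : (Equiv.swap 0 1 : Equiv.Perm (Fin 3))⁻¹ 1 = 0 := by decide
  have s2 : (Equiv.swap 0 1 : Equiv.Perm (Fin 3))⁻¹ 2 = 2 := by decide
  obtain ⟨k0, k1, k2⟩ := coords_orderedTwist_one t
  have him : 0 ≤ (Complex.exp (Real.pi * t * Complex.I)).im := by
    rw [show (Real.pi * t * Complex.I : ℂ) = ((Real.pi * t : ℝ) : ℂ) * Complex.I by
      push_cast; ring, Complex.exp_ofReal_mul_I_im]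
    exact Real.sin_nonneg_of_nonneg_of_le_pi (by have := t.2.1; positivity)
      (mul_le_of_le_one_right Real.pi_pos.le t.2.2)
  refine aligned_of_degree_three (f := Complex.I)
    (x := (Equiv.swap 0 1 : Equiv.Perm (Fin 3)) • orderedTwist 3 1 (by norm_num) t)
    Complex.norm_I (fun i => ?_) ?_ ?_ ?_
  · rw [coords_rotated, show (Real.pi * (1 / 2 : ℝ) * Complex.I : ℂ) = Real.pi / 2 * Complex.I by
      push_cast; ring, Complex.exp_pi_div_two_mul_I]
  all_goals
    simp only [coords_relabel, s0, s1, s2, k0, k1, k2]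
    generalize Complex.exp (Real.pi * t * Complex.I) = e at him
  · rw [show (-2 / 3 - (1 - e) / 3) * (starRingEnd ℂ) Complex.I =
      ((1 / 3 : ℝ) : ℂ) * ((3 - e) * Complex.I) by rw [Complex.conj_I]; push_cast; ring,
      Complex.re_ofReal_mul, Complex.mul_I_re, Complex.sub_im]
    simpa using him
  · rw [show ((1 + e) / 3 - (1 - e) / 3) * (starRingEnd ℂ) Complex.I =
      ((2 / 3 : ℝ) : ℂ) * (-e * Complex.I) by rw [Complex.conj_I]; push_cast; ring,
      Complex.re_ofReal_mul, Complex.mul_I_re, Complex.neg_im]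
    simpa using him
  · rw [show ((1 + e) / 3 - -2 / 3) * (starRingEnd ℂ) Complex.I =
      ((1 / 3 : ℝ) : ℂ) * ((-3 - e) * Complex.I) by rw [Complex.conj_I]; push_cast; ring,
      Complex.re_ofReal_mul, Complex.mul_I_re, Complex.sub_im]
    simpa using him

/-- During the last factor of `σ₁ σ₂ σ₁`, the motion is compared with another quarter turn. -/
lemma aligned_final_sigma1 (t : I) :
    Aligned (finRotate 3 • orderedTwist 3 0 (by norm_num) t) (rotated 3 ((1 + t) / 2)) := by
  have r0 : (finRotate 3)⁻¹ 0 = 2 := by decide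
  have r1 : (finRotate 3)⁻¹ 1 = 0 := by decide
  have r2 : (finRotate 3)⁻¹ 2 = 1 := by decide
  obtain ⟨hf, hff, hexp, hre, him⟩ := exp_half_angle t
  obtain ⟨k0, k1, k2⟩ := coords_orderedTwist_zero t
  refine aligned_of_degree_three
    (f := Complex.I * Complex.exp (((Real.pi * (t / 2) : ℝ) : ℂ) * Complex.I))
    (x := finRotate 3 • orderedTwist 3 0 (by norm_num) t)
    (by rw [norm_mul, Complex.norm_I, hf, mul_one]) (fun i => ?_) ?_ ?_ ?_
  · rw [coords_rotated, show (Real.pi * (((1 + t) / 2 : ℝ) : ℂ) * Complex.I : ℂ) =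
      Real.pi / 2 * Complex.I + ((Real.pi * (t / 2) : ℝ) : ℂ) * Complex.I by push_cast; ring,
      Complex.exp_add, Complex.exp_pi_div_two_mul_I]
  all_goals simp only [coords_relabel, r0, r1, r2, map_mul, Complex.conj_I]
  · rw [k0, k2, hexp, show ∀ f g : ℂ, ((-1 - f * f) / 3 - 2 / 3) * (-Complex.I * g) =
      (g + ((1 / 3 : ℝ) : ℂ) * f * (f * g)) * Complex.I by intros; push_cast; ring, hff, mul_one,
      Complex.mul_I_re, Complex.add_im, Complex.im_ofReal_mul, Complex.conj_im]
    linarith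
  · rw [k1, k2, hexp, show ∀ f g : ℂ, ((-1 + f * f) / 3 - 2 / 3) * (-Complex.I * g) =
      (g - ((1 / 3 : ℝ) : ℂ) * f * (f * g)) * Complex.I by intros; push_cast; ring, hff, mul_one,
      Complex.mul_I_re, Complex.sub_im, Complex.im_ofReal_mul, Complex.conj_im]
    linarith
  · rw [k0, k1, hexp, show ∀ f g : ℂ, ((-1 + f * f) / 3 - (-1 - f * f) / 3) * (-Complex.I * g) =
      (((-2 / 3 : ℝ) : ℂ) * f * (f * g)) * Complex.I by intros; push_cast; ring, hff, mul_one,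
      Complex.mul_I_re, Complex.im_ofReal_mul]
    linarith

/-- The three half twists of `σ₁ σ₂ σ₁` amount to half a rotation. Since each pair of points changes
places exactly once, always counterclockwise, the labelled motion can be aligned with a rotation
that stops for a while in the middle. -/
lemma braidClass_halfRotation : braidClass (halfRotation 3) = garside := by
  let a : OrderedConf 3 := orderedTwist 3 0 (by norm_num) 1
  let s : Equiv.Perm (Fin 3) := Equiv.swap 0 1
  let r : Equiv.Perm (Fin 3) := finRotate 3
  have s0 : s⁻¹ 0 = 1 := by decide
  have s1 : s⁻¹ 1 = 0 := by decide
  have s2 : s⁻¹ 2 = 2 := by decide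
  have r0 : r⁻¹ 0 = 2 := by decide
  have r1 : r⁻¹ 1 = 0 := by decide
  have r2 : r⁻¹ 2 = 1 := by decide
  have fin3 : ∀ {P : Fin 3 → Prop}, P 0 → P 1 → P 2 → ∀ i, P i := by
    intro P h0 h1 h2 i
    fin_cases i <;> assumption
  let b : OrderedConf 3 := s • orderedTwist 3 1 (by norm_num) 1
  obtain ⟨τ₁, hτ₁⟩ : ∃ τ : Path (rotated 3 0) a,
      ∀ t : I, τ t = orderedTwist 3 0 (by norm_num) t := ⟨
    { toFun := fun t => orderedTwist 3 0 (by norm_num) t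
      continuous_toFun := (orderedTwist_continuous 3 0 (by norm_num)).comp continuous_subtype_val
      source' := by
        obtain ⟨h0, h1, h2⟩ := coords_orderedTwist_zero 0
        refine coords_ext (fin3 ?_ ?_ ?_) <;>
        simp only [Icc.coe_zero, h0, h1, h2, coords_rotated, basePos_three_zero,
          basePos_three_one, basePos_three_two] <;> norm_num
      target' := by rw [Icc.coe_one] }, fun _ => rfl⟩
  obtain ⟨τ₂, hτ₂⟩ : ∃ τ : Path a b, ∀ t : I, τ t = s • orderedTwist 3 1 (by norm_num) t := ⟨
    { toFun := fun t => s • orderedTwist 3 1 (by norm_num) t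
      continuous_toFun := (continuous_relabel s).comp
        ((orderedTwist_continuous 3 1 (by norm_num)).comp continuous_subtype_val)
      source' := by
        obtain ⟨h0, h1, h2⟩ := coords_orderedTwist_one 0
        obtain ⟨k0, k1, k2⟩ := coords_orderedTwist_zero 1
        refine coords_ext (fin3 ?_ ?_ ?_) <;>
        simp only [Icc.coe_zero, coords_relabel, s0, s1, s2, h0, h1, h2, a, k0, k1, k2] <;>
        norm_num
      target' := by rw [Icc.coe_one] }, fun _ => rfl⟩
  obtain ⟨τ₃, hτ₃⟩ : ∃ τ : Path b (rotated 3 1),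
      ∀ t : I, τ t = r • orderedTwist 3 0 (by norm_num) t := ⟨
    { toFun := fun t => r • orderedTwist 3 0 (by norm_num) t
      continuous_toFun := (continuous_relabel r).comp
        ((orderedTwist_continuous 3 0 (by norm_num)).comp continuous_subtype_val)
      source' := by
        obtain ⟨h0, h1, h2⟩ := coords_orderedTwist_zero 0
        obtain ⟨k0, k1, k2⟩ := coords_orderedTwist_one 1
        refine coords_ext (fin3 ?_ ?_ ?_) <;>
        simp only [Icc.coe_zero, coords_relabel, r0, r1, r2, h0, h1, h2, b, k0, k1, k2, s0, s1,
          s2] <;> norm_num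
      target' := by
        obtain ⟨h0, h1, h2⟩ := coords_orderedTwist_zero 1
        refine coords_ext (fin3 ?_ ?_ ?_) <;>
        simp only [Icc.coe_one, coords_relabel, r0, r1, r2, h0, h1, h2, coords_rotated,
          basePos_three_zero, basePos_three_one, basePos_three_two] <;> norm_num }, fun _ => rfl⟩
  obtain ⟨ρ, hρ⟩ : ∃ ρ : ∀ x y : ℝ, Path (rotated 3 x) (rotated 3 y),
      ∀ x y, ρ x y = (Path.segment x y).map (rotated 3).continuous := ⟨_, fun _ _ => rfl⟩
  have hval : ∀ x y (t : I), ρ x y t = rotated 3 (x + t * (y - x)) := fun x y t => by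
    rw [hρ]
    change rotated 3 (AffineMap.lineMap x y (t : ℝ)) = _
    rw [AffineMap.lineMap_apply_module]
    congr 1
    simp only [smul_eq_mul]
    ring
  have hhom : (((ρ 0 (1 / 2)).trans (ρ (1 / 2) (1 / 2))).trans (ρ (1 / 2) 1)).Homotopic
      (ρ 0 1) := by
    have h : (((Path.segment (0 : ℝ) (1 / 2)).trans (Path.segment _ _)).trans
        (Path.segment (1 / 2 : ℝ) 1)).Homotopic (Path.segment (0 : ℝ) 1) :=
      SimplyConnectedSpace.paths_homotopic _ _
    have h' := h.map (rotated 3)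
    rw [Path.map_trans, Path.map_trans] at h'
    simp only [hρ]
    exact h'
  have h₁ : ∀ t, Aligned (τ₁ t) (ρ 0 (1 / 2) t) := fun t => by
    rw [hval, hτ₁]
    convert aligned_initial_sigma1 t using 2
    ring
  have h₂ : ∀ t, Aligned (τ₂ t) (ρ (1 / 2) (1 / 2) t) := fun t => by
    rw [hval, hτ₂]
    convert aligned_middle_sigma2 t using 2
    ring
  have h₃ : ∀ t, Aligned (τ₃ t) (ρ (1 / 2) 1 t) := fun t => by
    rw [hval, hτ₃]
    convert aligned_final_sigma1 t using 2
    ring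
  have hτ : ((τ₁.trans τ₂).trans τ₃).Homotopic
      (((ρ 0 (1 / 2)).trans (ρ (1 / 2) (1 / 2))).trans (ρ (1 / 2) 1)) := by
    refine homotopic_of_aligned fun t => ?_
    refine forall_aligned_trans (ω₁ := τ₁.trans τ₂) (ω₂ := τ₃)
      (ω₁' := (ρ 0 (1 / 2)).trans (ρ (1 / 2) (1 / 2))) (ω₂' := ρ (1 / 2) 1) ?_ h₃ t
    exact forall_aligned_trans (ω₁ := τ₁) (ω₂ := τ₂) (ω₁' := ρ 0 (1 / 2))
      (ω₂' := ρ (1 / 2) (1 / 2)) h₁ h₂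
  refine braidClass_eq_of_ordered (hτ.trans hhom).symm (fun t => ?_) (fun t => ?_)
    (γ' := ((twistLoop 3 0 (by norm_num)).trans (twistLoop 3 1 (by norm_num))).trans
      (twistLoop 3 0 (by norm_num)))
  · rw [hval, zero_add, sub_zero, mul_one]
    rfl
  · simp only [Path.trans_apply]
    split_ifs
    · rw [hτ₁]
      rfl
    · rw [hτ₂, mk_relabel]
      rfl
    · rw [hτ₃, mk_relabel]
      rfl

lemma realizes_garside : Realizes garside (twistHomeo 0 (5 / 6) 1) := by
  rw [← braidClass_halfRotation]
  refine realizes_twist (by norm_num) _ (fun t => rotated 3 t) (fun _ => rfl) fun t i => ?_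
  rw [coords_rotated, twist_of_le, sub_zero, zero_add]
  fin_cases i <;>
    simp only [Fin.zero_eta, Fin.mk_one, Fin.reduceFinMk, basePos_three_zero, basePos_three_one,
      basePos_three_two] <;> norm_num

lemma twistHomeo_trans (c : ℂ) (R θ θ' : ℝ) :
    (twistHomeo c R θ).trans (twistHomeo c R θ') = twistHomeo c R (θ' + θ) :=
  Homeomorph.ext fun z => twist_twist c R θ' θ z

lemma Realizes.sq_of_twist {m : ℕ} {g : BraidGroup m} {c : ℂ} {R : ℝ}
    (h : Realizes g (twistHomeo c R 1)) : Realizes (g ^ 2) (twistHomeo c R 2) := by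
  rw [sq, show (2 : ℝ) = 1 + 1 by norm_num, ← twistHomeo_trans]
  exact h.mul h

/-- A full twist is the identity inside. -/
lemma twist_two_of_le {c : ℂ} {R : ℝ} {z : ℂ} (h : ‖z - c‖ ≤ R) : twist c R 2 z = z := by
  rw [twist_of_le _ h, show (Real.pi * (2 : ℝ) * Complex.I : ℂ) = 2 * Real.pi * Complex.I by
    push_cast; ring, Complex.exp_two_pi_mul_I]
  ring

/-- Even powers of `σ₂` are realized by homeomorphisms supported near the second and third points.
In particular they fix the first point and its surroundings. -/
lemma exists_realizes_sigma2_zpow (n : ℤ) : ∃ ψ : ℂ ≃ₜ ℂ, Realizes (sigma2 ^ (2 * n)) ψ ∧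
    (∀ i, ψ (basePos 3 i) = basePos 3 i) ∧ ∀ z : ℂ, 7 / 12 ≤ ‖z - 1 / 3‖ → ψ z = z := by
  let K : Subgroup (BraidGroup 3) :=
    { carrier := {g | ∃ ψ : ℂ ≃ₜ ℂ, Realizes g ψ ∧ (∀ i, ψ (basePos 3 i) = basePos 3 i) ∧
        ∀ z : ℂ, 7 / 12 ≤ ‖z - 1 / 3‖ → ψ z = z}
      one_mem' := ⟨_, Realizes.one 3, fun _ => rfl, fun _ _ => rfl⟩
      mul_mem' := by
        rintro g g' ⟨ψ, h, hp, ho⟩ ⟨ψ', h', hp', ho'⟩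
        refine ⟨_, h.mul h', fun i => ?_, fun z hz => ?_⟩
        · rw [Homeomorph.trans_apply, hp, hp']
        · rw [Homeomorph.trans_apply, ho z hz, ho' z hz]
      inv_mem' := by
        rintro g ⟨ψ, h, hp, ho⟩
        refine ⟨_, h.inv, fun i => ?_, fun z hz => ?_⟩
        · rw [Homeomorph.symm_apply_eq, hp]
        · rw [Homeomorph.symm_apply_eq, ho z hz] }
  have h2 : sigma2 ^ 2 ∈ K := by
    refine ⟨_, realizes_sigma2.sq_of_twist, fun i => ?_, fun z hz => ?_⟩
    · change twist _ _ _ _ = _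
      fin_cases i
      · simp only [Fin.zero_eta, basePos_three_zero]
        rw [twist_of_ge _ (by norm_num)]
      · simp only [Fin.mk_one, basePos_three_one]
        rw [twist_two_of_le (by norm_num)]
      · simp only [Fin.reduceFinMk, basePos_three_two]
        rw [twist_two_of_le (by norm_num)]
    · exact twist_of_ge _ (by norm_num; exact hz)
  have h := K.zpow_mem h2 n
  rw [← zpow_natCast, ← zpow_mul] at h
  exact h

/-! ### The punctured quadrant -/

/-- The real coordinate of a point of the base configuration of degree `3`. -/
def pt (i : Fin 3) : ℝ := (2 * (i : ℕ) - 2) / 3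

lemma basePos_eq_pt (i : Fin 3) : basePos 3 i = (pt i : ℂ) := by
  unfold basePos pt
  push_cast
  ring

/-- The quadrant that parametrizes the pairs of radii in `ℝ⁴`, with the origin moved to the centre
of the disk. -/
def quadrant : Set ℂ := {w | -2 < w.re ∧ -2 < w.im}

lemma mem_quadrant_of_norm_le {w : ℂ} (h : ‖w‖ ≤ 1) : w ∈ quadrant := by
  have h1 := (abs_le.1 (Complex.abs_re_le_norm w)).1
  have h2 := (abs_le.1 (Complex.abs_im_le_norm w)).1
  constructor <;> linarith

lemma convex_quadrant : Convex ℝ quadrant := by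
  have h1 : Convex ℝ {w : ℂ | -2 < w.re} := convex_halfSpace_re_gt _
  exact h1.inter (convex_halfSpace_im_gt _)

/-- The quadrant without the three points of the base configuration: the fibre of the complement of
a torus-covering link of degree `3`. -/
abbrev Fiber : Type := {w : ℂ // w ∈ quadrant ∧ ∀ i, w ≠ basePos 3 i}

/-- The quadrant without the vertical rays that start at the points of the base configuration and
go down (for `h = 1`) or up (for `h = -1`). -/
def slitQuadrant (h : ℝ) : Set ℂ := {w | w ∈ quadrant ∧ ∀ i, w.re = pt i → 0 < h * w.im}

lemma slitQuadrant_subset {h : ℝ} {w : ℂ} (hw : w ∈ slitQuadrant h) :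
    w ∈ quadrant ∧ ∀ i, w ≠ basePos 3 i := by
  refine ⟨hw.1, ?_⟩
  rintro i rfl
  have := hw.2 i (by rw [basePos_eq_pt, Complex.ofReal_re])
  rw [basePos_eq_pt, Complex.ofReal_im, mul_zero] at this
  exact lt_irrefl _ this

/-- The slit quadrant is contracted vertically to a line, and then along that line. -/
lemma contractibleSpace_slitQuadrant {h : ℝ} (hh : h = 1 ∨ h = -1) :
    ContractibleSpace (slitQuadrant h) := by
  have hsq : h * h = 1 := by rcases hh with rfl | rfl <;> norm_num
  have hh2 : -2 < h := by rcases hh with rfl | rfl <;> norm_num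
  have hmem : ∀ x : ℝ, -2 < x → (⟨x, h⟩ : ℂ) ∈ slitQuadrant h := fun x hx =>
    ⟨⟨hx, hh2⟩, fun _ _ => by rw [hsq]; exact one_pos⟩
  have hconv : ∀ (s : I) (a b : ℝ), -2 < a → -2 < b → -2 < (1 - (s : ℝ)) * a + s * b := by
    intro s a b ha hb
    have h0 := s.2.1
    have h1 := s.2.2
    rcases h0.eq_or_lt with h0 | h0
    · rw [← h0]; linarith
    · nlinarith
  rw [contractible_iff_id_nullhomotopic]
  let π : C(slitQuadrant h, slitQuadrant h) := ⟨fun w => ⟨⟨w.1.re, h⟩, hmem _ w.2.1.1⟩, by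
    refine Continuous.subtype_mk ?_ _
    have : (fun w : slitQuadrant h => (⟨w.1.re, h⟩ : ℂ)) =
      fun w => (w.1.re : ℂ) + h * Complex.I := by
      funext w; apply Complex.ext <;> simp
    rw [this]
    fun_prop⟩
  refine ⟨⟨⟨-1, h⟩, hmem _ (by norm_num)⟩,
    ContinuousMap.Homotopic.trans (g := π) ⟨⟨⟨fun p => ⟨⟨p.2.1.re,
      (1 - (p.1 : ℝ)) * p.2.1.im + p.1 * h⟩, ?_, ?_⟩, ?_⟩, ?_, ?_⟩⟩ ⟨⟨⟨fun p =>
        ⟨⟨(1 - (p.1 : ℝ)) * p.2.1.re + p.1 * -1, h⟩, ?_⟩, ?_⟩, ?_, ?_⟩⟩⟩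
  · exact ⟨p.2.2.1.1, hconv _ _ _ p.2.2.1.2 hh2⟩
  · intro i hi
    have h1 := p.2.2.2 i hi
    have h0 := p.1.2.1
    have h2 := p.1.2.2
    have h3 : h * ((1 - (p.1 : ℝ)) * p.2.1.im + p.1 * h) =
        (1 - (p.1 : ℝ)) * (h * p.2.1.im) + p.1 := by linear_combination (p.1 : ℝ) * hsq
    change 0 < h * ((1 - (p.1 : ℝ)) * p.2.1.im + p.1 * h)
    rw [h3]
    rcases h0.eq_or_lt with h0 | h0
    · rw [← h0]; linarith
    · have := mul_nonneg (sub_nonneg.2 h2) h1.le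
      linarith
  · refine Continuous.subtype_mk ?_ _
    have : (fun p : I × slitQuadrant h =>
        (⟨p.2.1.re, (1 - (p.1 : ℝ)) * p.2.1.im + p.1 * h⟩ : ℂ)) =
        fun p => (p.2.1.re : ℂ) + ((1 - (p.1 : ℝ)) * p.2.1.im + p.1 * h : ℝ) * Complex.I := by
      funext p; apply Complex.ext <;> simp
    rw [this]
    fun_prop
  · intro w; apply Subtype.ext; apply Complex.ext <;> simp
  · intro w; apply Subtype.ext; apply Complex.ext <;> simp [π]
  · exact hmem _ (hconv _ _ _ p.2.2.1.1 (by norm_num))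
  · refine Continuous.subtype_mk ?_ _
    have : (fun p : I × slitQuadrant h =>
        (⟨(1 - (p.1 : ℝ)) * p.2.1.re + p.1 * -1, h⟩ : ℂ)) =
        fun p => ((1 - (p.1 : ℝ)) * p.2.1.re + p.1 * -1 : ℝ) + (h : ℂ) * Complex.I := by
      funext p; apply Complex.ext <;> simp
    rw [this]
    fun_prop
  · intro w; apply Subtype.ext; apply Complex.ext <;> simp [π]
  · intro w; apply Subtype.ext; apply Complex.ext <;> simp

lemma mk_eq_mk_of_slitQuadrant {h : ℝ} (hh : h = 1 ∨ h = -1) {x y : Fiber} (γ γ' : Path x y)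
    (hγ : ∀ t, (γ t : ℂ) ∈ slitQuadrant h) (hγ' : ∀ t, (γ' t : ℂ) ∈ slitQuadrant h) :
    ⟪γ⟫ = ⟪γ'⟫ := by
  have := contractibleSpace_slitQuadrant hh
  let f : C(slitQuadrant h, Fiber) :=
    ⟨fun w => ⟨w.1, slitQuadrant_subset w.2⟩, continuous_subtype_val.subtype_mk _⟩
  have hx : (x : ℂ) ∈ slitQuadrant h := by rw [← γ.source]; exact hγ 0
  have hy : (y : ℂ) ∈ slitQuadrant h := by rw [← γ.target]; exact hγ 1
  let lift : ∀ δ : Path x y, (∀ t, (δ t : ℂ) ∈ slitQuadrant h) →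
      Path (⟨x, hx⟩ : slitQuadrant h) ⟨y, hy⟩ := fun δ hδ =>
    { toFun := fun t => ⟨δ t, hδ t⟩
      continuous_toFun := (continuous_subtype_val.comp δ.continuous).subtype_mk _
      source' := Subtype.ext (by simp)
      target' := Subtype.ext (by simp) }
  rw [Path.Homotopic.Quotient.eq]
  exact (SimplyConnectedSpace.paths_homotopic (lift γ hγ) (lift γ' hγ')).map f

lemma exists_path_slitQuadrant {h : ℝ} (hh : h = 1 ∨ h = -1) {x y : Fiber}
    (hx : (x : ℂ) ∈ slitQuadrant h) (hy : (y : ℂ) ∈ slitQuadrant h) :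
    ∃ γ : Path x y, ∀ t, (γ t : ℂ) ∈ slitQuadrant h := by
  have := contractibleSpace_slitQuadrant hh
  let f : C(slitQuadrant h, Fiber) :=
    ⟨fun w => ⟨w.1, slitQuadrant_subset w.2⟩, continuous_subtype_val.subtype_mk _⟩
  exact ⟨(PathConnectedSpace.somePath (⟨x, hx⟩ : slitQuadrant h) ⟨y, hy⟩).map f.continuous,
    fun t => ((PathConnectedSpace.somePath (⟨x, hx⟩ : slitQuadrant h) ⟨y, hy⟩) t).2⟩

/-! ### Nested circles -/

/-- The radius `R` is admissible if no point of the base configuration lies in the closed annulus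
with the radii `R` and `R + 1 / 12` about the point `R - 5 / 6`, and this annulus lies in the disk.
So all admissible circles touch each other at the point `-5 / 6`, to the left of the points of the
base configuration. -/
structure Admissible (R : ℝ) : Prop where
  pos : 0 < R
  le : R ≤ 5 / 6
  annulus : ∀ i, ‖basePos 3 i - (R - 5 / 6 : ℝ)‖ < R ∨ R + 1 / 12 ≤ ‖basePos 3 i - (R - 5 / 6 : ℝ)‖

lemma circle_mem {R : ℝ} (h : Admissible R) (θ : ℝ) :
    ((R - 5 / 6 : ℝ) : ℂ) - R * Complex.exp (((2 * Real.pi * θ : ℝ) : ℂ) * Complex.I) ∈ quadrant ∧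
    ∀ i, ((R - 5 / 6 : ℝ) : ℂ) - R * Complex.exp (((2 * Real.pi * θ : ℝ) : ℂ) * Complex.I) ≠
      basePos 3 i := by
  have h0 := h.pos
  have h1 := h.le
  have he := Complex.norm_exp_ofReal_mul_I (2 * Real.pi * θ)
  set e := Complex.exp (((2 * Real.pi * θ : ℝ) : ℂ) * Complex.I)
  have hn : ‖(R : ℂ) * e‖ = R := by
    rw [norm_mul, he, mul_one, Complex.norm_real, Real.norm_eq_abs, abs_of_pos h0]
  refine ⟨mem_quadrant_of_norm_le ?_, fun i hi => ?_⟩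
  · refine (norm_sub_le _ _).trans ?_
    rw [hn, Complex.norm_real, Real.norm_eq_abs, abs_of_nonpos (by linarith)]
    linarith
  · have h2 := h.annulus i
    rw [← hi, sub_sub_cancel_left, norm_neg, hn] at h2
    rcases h2 with h2 | h2 <;> linarith

/-- The circle of radius `R` about `R - 5 / 6`, parametrized by the number of turns and starting at
its leftmost point `-5 / 6`. -/
def circleMap {R : ℝ} (h : Admissible R) : C(ℝ, Fiber) where
  toFun θ := ⟨_, circle_mem h θ⟩
  continuous_toFun := by
    refine Continuous.subtype_mk ?_ _
    fun_prop

lemma circleMap_apply {R : ℝ} (h : Admissible R) (θ : ℝ) : (circleMap h θ : ℂ) =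
    ((R - 5 / 6 : ℝ) : ℂ) - R * Complex.exp (((2 * Real.pi * θ : ℝ) : ℂ) * Complex.I) := rfl

lemma pt_values : pt 0 = -2 / 3 ∧ pt 1 = 0 ∧ pt 2 = 2 / 3 := by
  refine ⟨?_, ?_, ?_⟩ <;> norm_num [pt]

/-- The common leftmost point of the circles. -/
def leftPt : Fiber := ⟨-5 / 6, by
  refine ⟨mem_quadrant_of_norm_le (by norm_num), fun i hi => ?_⟩
  rw [basePos_eq_pt] at hi
  have h : (-5 / 6 : ℝ) = pt i := by
    apply Complex.ofReal_injective
    rw [← hi]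
    push_cast
    ring
  obtain ⟨h0, h1, h2⟩ := pt_values
  fin_cases i <;>
    simp only [Fin.zero_eta, Fin.mk_one, Fin.reduceFinMk, h0, h1, h2] at h <;> norm_num at h⟩

lemma circleMap_zero {R : ℝ} (h : Admissible R) : circleMap h 0 = leftPt :=
  Subtype.ext (by
    rw [circleMap_apply]
    simp only [mul_zero, Complex.ofReal_zero, zero_mul, Complex.exp_zero, leftPt]
    push_cast
    ring)

lemma circleMap_one {R : ℝ} (h : Admissible R) : circleMap h 1 = leftPt :=
  Subtype.ext (by
    rw [circleMap_apply]
    push_cast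
    simp only [mul_one, Complex.exp_two_pi_mul_I, leftPt]
    ring)

/-- The counterclockwise circle as a loop. -/
def circ {R : ℝ} (h : Admissible R) : Path leftPt leftPt where
  toFun t := circleMap h t
  continuous_toFun := (circleMap h).continuous.comp continuous_subtype_val
  source' := by rw [Icc.coe_zero, circleMap_zero]
  target' := by rw [Icc.coe_one, circleMap_one]

/-- The lower half of the circle, from left to right. -/
def lowerArc {R : ℝ} (h : Admissible R) : Path leftPt (circleMap h (1 / 2)) where
  toFun t := circleMap h (t / 2)
  continuous_toFun := (circleMap h).continuous.comp (continuous_subtype_val.div_const 2)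
  source' := by rw [Icc.coe_zero, zero_div, circleMap_zero]
  target' := by rw [Icc.coe_one]

/-- The upper half of the circle, from right to left. -/
def upperArc {R : ℝ} (h : Admissible R) : Path (circleMap h (1 / 2)) leftPt where
  toFun t := circleMap h ((1 + t) / 2)
  continuous_toFun := (circleMap h).continuous.comp (by fun_prop)
  source' := by rw [Icc.coe_zero, add_zero]
  target' := by rw [Icc.coe_one, ← circleMap_one h]; norm_num

lemma mk_lowerArc_trans_upperArc {R : ℝ} (h : Admissible R) :
    ⟪lowerArc h⟫ ⬝ ⟪upperArc h⟫ = ⟪circ h⟫ := by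
  have key := mk_trans_eq_of_square
    ⟨fun p : I × I => circleMap h ((1 + p.1) * p.2 / 2),
      (circleMap h).continuous.comp (by fun_prop)⟩
    (lowerArc h) (upperArc h) (Path.refl leftPt) (circ h)
    (fun s => by simp [lowerArc]) (fun s => by simp [upperArc])
    (fun s => by simp [circleMap_zero]) (fun s => by
      change circleMap h s = circleMap h _
      congr 1
      rw [Icc.coe_one]
      ring)
  rw [key]
  simp

lemma circleMap_im {R : ℝ} (h : Admissible R) (θ : ℝ) :
    (circleMap h θ : ℂ).im = -(R * Real.sin (2 * Real.pi * θ)) := by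
  rw [circleMap_apply, Complex.sub_im, Complex.ofReal_im, Complex.im_ofReal_mul,
    Complex.exp_ofReal_mul_I_im, zero_sub]

lemma mem_slitQuadrant_of_nonneg {h : ℝ} (hh : h = 1 ∨ h = -1) (w : Fiber)
    (hw : 0 ≤ h * (w : ℂ).im) : (w : ℂ) ∈ slitQuadrant h := by
  refine ⟨w.2.1, fun i hi => lt_of_le_of_ne hw fun h0 => w.2.2 i ?_⟩
  rw [basePos_eq_pt]
  apply Complex.ext
  · rw [hi, Complex.ofReal_re]
  · rw [Complex.ofReal_im]
    rcases hh with rfl | rfl <;> linarith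

lemma lowerArc_mem {R : ℝ} (h : Admissible R) (t : I) :
    (lowerArc h t : ℂ) ∈ slitQuadrant (-1) := by
  refine mem_slitQuadrant_of_nonneg (Or.inr rfl) _ ?_
  change 0 ≤ -1 * (circleMap h (t / 2) : ℂ).im
  rw [circleMap_im]
  have h0 := t.2.1
  have h1 := t.2.2
  have h2 : 0 ≤ Real.sin (2 * Real.pi * (t / 2)) :=
    Real.sin_nonneg_of_nonneg_of_le_pi (by positivity) (by nlinarith [Real.pi_pos])
  have := mul_nonneg h.pos.le h2
  linarith

lemma upperArc_mem {R : ℝ} (h : Admissible R) (t : I) :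
    (upperArc h t : ℂ) ∈ slitQuadrant 1 := by
  refine mem_slitQuadrant_of_nonneg (Or.inl rfl) _ ?_
  change 0 ≤ 1 * (circleMap h ((1 + t) / 2) : ℂ).im
  rw [circleMap_im]
  have h0 := t.2.1
  have h1 := t.2.2
  have h2 : 0 ≤ Real.sin (Real.pi * t) :=
    Real.sin_nonneg_of_nonneg_of_le_pi (by positivity) (by nlinarith [Real.pi_pos])
  have h3 : Real.sin (2 * Real.pi * ((1 + t) / 2)) = -Real.sin (Real.pi * t) := by
    rw [← Real.sin_add_pi]; congr 1; ring
  rw [h3]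
  have := mul_nonneg h.pos.le h2
  linarith

/-- Two points of a vertical strip between consecutive punctures are joined by a segment in it. -/
lemma exists_path_of_strip {x y : Fiber} (h : ∀ i, ((x : ℂ).re < pt i ∧ (y : ℂ).re < pt i) ∨
    (pt i < (x : ℂ).re ∧ pt i < (y : ℂ).re)) :
    ∃ γ : Path x y, ∀ t h, (γ t : ℂ) ∈ slitQuadrant h := by
  have hre : ∀ (t : I) i, (AffineMap.lineMap (x : ℂ) (y : ℂ) (t : ℝ)).re ≠ pt i := by
    intro t i
    rcases h i with ⟨hx, hy⟩ | ⟨hx, hy⟩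
    · exact (show (AffineMap.lineMap (x : ℂ) (y : ℂ) (t : ℝ)).re < pt i from
        (convex_halfSpace_re_lt (pt i)).lineMap_mem hx hy t.2).ne
    · exact (show pt i < (AffineMap.lineMap (x : ℂ) (y : ℂ) (t : ℝ)).re from
        (convex_halfSpace_re_gt (pt i)).lineMap_mem hx hy t.2).ne'
  have hq : ∀ t : I, AffineMap.lineMap (x : ℂ) (y : ℂ) (t : ℝ) ∈ quadrant := fun t =>
    convex_quadrant.lineMap_mem x.2.1 y.2.1 t.2
  refine ⟨⟨⟨fun t => ⟨AffineMap.lineMap (x : ℂ) (y : ℂ) (t : ℝ), hq t, fun i hi => hre t i ?_⟩, ?_⟩,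
    ?_, ?_⟩, fun t h => ⟨hq t, fun i hi => absurd hi (hre t i)⟩⟩
  · rw [hi, basePos_eq_pt, Complex.ofReal_re]
  · refine Continuous.subtype_mk ?_ _
    simp only [AffineMap.lineMap_apply_module]
    fun_prop
  · simp
  · simp

/-- The radii of three nested circles around the first one, two and three punctures. -/
def radius : Fin 3 → ℝ := ![1 / 6, 1 / 2, 5 / 6]

lemma admissible_radius (j : Fin 3) : Admissible (radius j) := by
  obtain ⟨h0, h1, h2⟩ := pt_values
  have hann : ∀ (r : ℝ), (∀ i, |pt i - (r - 5 / 6)| < r ∨ r + 1 / 12 ≤ |pt i - (r - 5 / 6)|) →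
      ∀ i, ‖basePos 3 i - (r - 5 / 6 : ℝ)‖ < r ∨ r + 1 / 12 ≤ ‖basePos 3 i - (r - 5 / 6 : ℝ)‖ := by
    intro r h i
    rw [basePos_eq_pt, ← Complex.ofReal_sub, Complex.norm_real, Real.norm_eq_abs]
    exact h i
  have habs : ∀ i j, |pt i - (radius j - 5 / 6)| < radius j ∨
      radius j + 1 / 12 ≤ |pt i - (radius j - 5 / 6)| := by
    intro i j
    fin_cases i <;> fin_cases j <;>
      simp only [radius, Fin.zero_eta, Fin.mk_one, Fin.reduceFinMk, h0, h1, h2, Matrix.cons_val] <;>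
      norm_num [abs_of_nonneg, abs_of_nonpos, abs_lt, le_abs]
  refine ⟨?_, ?_, hann _ fun i => habs i j⟩ <;> fin_cases j <;> norm_num [radius]

/-- The three circles generate the fundamental group of the punctured quadrant. The two slit
quadrants cover it, are contractible, and meet in four strips. -/
theorem fiber_eq_top (H : Subgroup (FundamentalGroup Fiber leftPt))
    (hH : ∀ j, FundamentalGroup.fromPath ⟪circ (admissible_radius j)⟫ ∈ H) : H = ⊤ := by
  obtain ⟨p0, p1, p2⟩ := pt_values
  let U : ({1, -1} : Set ℝ) → Set Fiber := fun h => {w | (w : ℂ) ∈ slitQuadrant h}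
  have hleft : ∀ h, (leftPt : ℂ) ∈ slitQuadrant h := by
    intro h
    refine ⟨leftPt.2.1, fun i hi => ?_⟩
    have h1 : (leftPt : ℂ).re = -5 / 6 := by norm_num [leftPt]
    rw [h1] at hi
    fin_cases i <;>
      simp only [Fin.zero_eta, Fin.mk_one, Fin.reduceFinMk, p0, p1, p2] at hi <;> norm_num at hi
  -- For a point in both slit quadrants, there is a path below and a path above to it.
  have hboth : ∀ y : Fiber, (y : ℂ) ∈ slitQuadrant 1 → (y : ℂ) ∈ slitQuadrant (-1) →
      ∃ δ δ' : Path leftPt y, (∀ t, (δ t : ℂ) ∈ slitQuadrant (-1)) ∧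
        (∀ t, (δ' t : ℂ) ∈ slitQuadrant 1) ∧
        FundamentalGroup.fromPath (⟪δ⟫ ⬝ (⟪δ'⟫).symm) ∈ H := by
    intro y hy hy'
    have hne : ∀ i, (y : ℂ).re ≠ pt i := fun i hi => by
      have h1 := hy.2 i hi
      have h2 := hy'.2 i hi
      linarith
    have hcirc : ∀ j : Fin 3, (∀ i, (2 * radius j - 5 / 6 < pt i ∧ (y : ℂ).re < pt i) ∨
        (pt i < 2 * radius j - 5 / 6 ∧ pt i < (y : ℂ).re)) →
        ∃ δ δ' : Path leftPt y, (∀ t, (δ t : ℂ) ∈ slitQuadrant (-1)) ∧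
        (∀ t, (δ' t : ℂ) ∈ slitQuadrant 1) ∧
        FundamentalGroup.fromPath (⟪δ⟫ ⬝ (⟪δ'⟫).symm) ∈ H := by
      intro j hj
      have hre : (circleMap (admissible_radius j) (1 / 2) : ℂ).re = 2 * radius j - 5 / 6 := by
        rw [circleMap_apply, Complex.sub_re, Complex.ofReal_re, Complex.re_ofReal_mul,
          Complex.exp_ofReal_mul_I_re, show 2 * Real.pi * (1 / 2) = Real.pi by ring, Real.cos_pi]
        ring
      obtain ⟨γ, hγ⟩ := exists_path_of_strip
        (x := circleMap (admissible_radius j) (1 / 2)) (y := y) (by rw [hre]; exact hj)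
      refine ⟨(lowerArc _).trans γ, (upperArc (admissible_radius j)).symm.trans γ,
        fun t => ?_, fun t => ?_, ?_⟩
      · rw [Path.trans_apply]
        split_ifs
        · exact lowerArc_mem (admissible_radius j) _
        · exact hγ _ _
      · rw [Path.trans_apply]
        split_ifs
        · exact upperArc_mem (admissible_radius j) _
        · exact hγ _ _
      · have h := hH j
        rw [← mk_lowerArc_trans_upperArc] at h
        convert h using 2
        simp [Path.Homotopic.Quotient.trans_assoc]
    have r0 : radius 0 = 1 / 6 := rfl
    have r1 : radius 1 = 1 / 2 := rfl
    have r2 : radius 2 = 5 / 6 := rfl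
    -- In the strip to the left of the points, the ways below and above are homotopic; in each other
    -- strip they differ by the circle that ends there.
    rcases lt_or_gt_of_ne (hne 0) with h0 | h0
    · obtain ⟨γ, hγ⟩ := exists_path_of_strip (x := leftPt) (y := y) (by
        intro i
        left
        have h1 : (leftPt : ℂ).re = -5 / 6 := by norm_num [leftPt]
        rw [h1]
        fin_cases i <;>
          simp only [Fin.zero_eta, Fin.mk_one, Fin.reduceFinMk, p0, p1, p2] at h0 ⊢ <;>
          constructor <;> linarith)
      refine ⟨γ, γ, fun t => hγ t _, fun t => hγ t _, ?_⟩
      rw [Path.Homotopic.Quotient.trans_symm]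
      exact H.one_mem
    rcases lt_or_gt_of_ne (hne 1) with h1 | h1
    · refine hcirc 0 fun i => ?_
      fin_cases i <;> simp only [Fin.zero_eta, Fin.mk_one, Fin.reduceFinMk, p0, p1, p2, r0] at *
      · right; constructor <;> linarith
      · left; constructor <;> linarith
      · left; constructor <;> linarith
    rcases lt_or_gt_of_ne (hne 2) with h2 | h2
    · refine hcirc 1 fun i => ?_
      fin_cases i <;> simp only [Fin.zero_eta, Fin.mk_one, Fin.reduceFinMk, p0, p1, p2, r1] at *
      · right; constructor <;> linarith
      · right; constructor <;> linarith
      · left; constructor <;> linarith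
    · refine hcirc 2 fun i => ?_
      fin_cases i <;> simp only [Fin.zero_eta, Fin.mk_one, Fin.reduceFinMk, p0, p1, p2, r2] at *
      · right; constructor <;> linarith
      · right; constructor <;> linarith
      · right; constructor <;> linarith
  refine eq_top_of_open_cover U (fun h => ?_) (fun w => ?_) leftPt H ?_ ?_
  · have : U h = ⋂ i, ({w : Fiber | (w : ℂ).re ≠ pt i} ∪
        {w : Fiber | 0 < (h : ℝ) * (w : ℂ).im}) := by
      ext w
      simp only [U, slitQuadrant, mem_ofPred_eq, mem_iInter, mem_union]
      constructor
      · exact fun hw i => or_iff_not_imp_left.2 fun hi => hw.2 i (not_not.1 hi)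
      · exact fun hw => ⟨w.2.1, fun i hi => (hw i).resolve_left (not_not.2 hi)⟩
    rw [this]
    refine isOpen_iInter_of_finite fun i => IsOpen.union ?_ ?_
    · exact isOpen_ne_fun (by fun_prop) continuous_const
    · exact isOpen_lt continuous_const (by fun_prop)
  · rcases le_total 0 (w : ℂ).im with h | h
    · exact ⟨⟨1, by simp⟩, mem_slitQuadrant_of_nonneg (Or.inl rfl) w (by simpa using h)⟩
    · exact ⟨⟨-1, by simp⟩, mem_slitQuadrant_of_nonneg (Or.inr rfl) w (by simpa using h)⟩
  · rintro ⟨h, hh⟩ γ hγ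
    have : ⟪γ⟫ = ⟪Path.refl leftPt⟫ := mk_eq_mk_of_slitQuadrant hh _ _ hγ fun _ => hleft h
    rw [this]
    exact H.one_mem
  · have hdiag : ∀ h, (h = 1 ∨ h = -1) → ∀ y : Fiber, (y : ℂ) ∈ slitQuadrant h →
        ∃ δ δ' : Path leftPt y, (∀ t, (δ t : ℂ) ∈ slitQuadrant h) ∧
        (∀ t, (δ' t : ℂ) ∈ slitQuadrant h) ∧
        FundamentalGroup.fromPath (⟪δ⟫ ⬝ (⟪δ'⟫).symm) ∈ H := by
      intro h hh y hy
      obtain ⟨γ, hγ⟩ := exists_path_slitQuadrant hh (hleft h) hy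
      refine ⟨γ, γ, hγ, hγ, ?_⟩
      rw [Path.Homotopic.Quotient.trans_symm]
      exact H.one_mem
    rintro ⟨h, rfl | rfl⟩ ⟨h', rfl | rfl⟩ y hy hy'
    · exact hdiag 1 (Or.inl rfl) y hy
    · obtain ⟨δ, δ', h1, h2, h3⟩ := hboth y hy hy'
      refine ⟨δ', δ, h2, h1, ?_⟩
      have := symm_mem h3
      convert this using 2
      simp
    · exact hboth y hy' hy
    · exact hdiag (-1) (Or.inr rfl) y hy

/-! ### Twisted loops of the punctured quadrant -/

lemma ne_basePos_of_re_lt {w : ℂ} (h : w.re < -2 / 3) (i : Fin 3) : w ≠ basePos 3 i := by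
  rintro rfl
  obtain ⟨h0, h1, h2⟩ := pt_values
  rw [basePos_eq_pt, Complex.ofReal_re] at h
  fin_cases i <;> simp only [Fin.zero_eta, Fin.mk_one, Fin.reduceFinMk, h0, h1, h2] at h <;>
    norm_num at h

/-- The base point of the punctured quadrant, in the corner of the quadrant. -/
def basePt : Fiber := ⟨⟨-3 / 2, -3 / 2⟩, ⟨by norm_num, by norm_num⟩,
  ne_basePos_of_re_lt (by norm_num)⟩

lemma tail_mem (s : I) : AffineMap.lineMap (basePt : ℂ) (leftPt : ℂ) (s : ℝ) ∈ quadrant ∩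
    {w | w.re ≤ -5 / 6} :=
  (convex_quadrant.inter (convex_halfSpace_re_le _)).lineMap_mem
    ⟨basePt.2.1, by norm_num [basePt]⟩ ⟨leftPt.2.1, by norm_num [leftPt]⟩ s.2

/-- The segment from the base point to the common point of the circles. -/
def tail : Path basePt leftPt where
  toFun s := ⟨AffineMap.lineMap (basePt : ℂ) (leftPt : ℂ) (s : ℝ), (tail_mem s).1,
    ne_basePos_of_re_lt ((tail_mem s).2.trans_lt (by norm_num))⟩
  continuous_toFun := by
    refine Continuous.subtype_mk ?_ _
    simp only [AffineMap.lineMap_apply_module]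
    fun_prop
  source' := by simp
  target' := by simp

lemma tail_re (s : I) : (tail s : ℂ).re ≤ -5 / 6 := (tail_mem s).2

/-- A loop at the common point of the circles, as a loop at the base point. -/
def withTail (γ : Path leftPt leftPt) : Path basePt basePt := tail.trans (γ.trans tail.symm)

lemma le_norm_tail_sub (R : ℝ) (s : I) : R ≤ ‖(tail s : ℂ) - (R - 5 / 6 : ℝ)‖ := by
  have h := tail_re s
  have h1 := (abs_le.1 (Complex.abs_re_le_norm ((tail s : ℂ) - (R - 5 / 6 : ℝ)))).1
  rw [Complex.sub_re, Complex.ofReal_re] at h1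
  linarith

lemma twist_tail_mem {R : ℝ} (h : Admissible R) (θ : ℝ) (s : I) :
    twist (R - 5 / 6 : ℝ) R θ (tail s) ∈ quadrant ∧
      ∀ i, twist (R - 5 / 6 : ℝ) R θ (tail s) ≠ basePos 3 i := by
  have hR := le_norm_tail_sub R s
  have h1 := h.le
  have h0 := h.pos
  rcases le_or_gt (R + 1 / 12) ‖(tail s : ℂ) - (R - 5 / 6 : ℝ)‖ with hge | hlt
  · rw [twist_of_ge θ hge]
    exact (tail s).2
  · have hn := norm_twist_sub (R - 5 / 6 : ℝ) R θ (tail s)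
    refine ⟨mem_quadrant_of_norm_le ?_, fun i hi => ?_⟩
    · have h2 := norm_le_norm_add_norm_sub' (twist (R - 5 / 6 : ℝ) R θ (tail s)) (R - 5 / 6 : ℝ)
      rw [hn, Complex.norm_real, Real.norm_eq_abs, abs_of_nonpos (by linarith)] at h2
      linarith
    · have h2 := h.annulus i
      rw [← hi, hn] at h2
      rcases h2 with h2 | h2 <;> linarith

/-- The segment `tail` after a negative full twist along an admissible circle. -/
def untwistedTail {R : ℝ} (h : Admissible R) : Path basePt leftPt where
  toFun s := ⟨_, twist_tail_mem h (-2) s⟩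
  continuous_toFun := by
    refine Continuous.subtype_mk ?_ _
    exact (continuous_twist _ R).comp
      (by fun_prop : Continuous fun s : I => ((-2 : ℝ), (tail s : ℂ)))
  source' := by
    refine Subtype.ext ?_
    change twist _ R (-2) (tail 0 : ℂ) = _
    rw [tail.source]
    refine twist_of_ge _ ?_
    have h1 := (abs_le.1 (Complex.abs_re_le_norm ((basePt : ℂ) - (R - 5 / 6 : ℝ)))).1
    have h2 : (basePt : ℂ).re = -3 / 2 := rfl
    rw [Complex.sub_re, Complex.ofReal_re, h2] at h1
    linarith
  target' := by
    refine Subtype.ext ?_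
    change twist _ R (-2) (tail 1 : ℂ) = _
    rw [tail.target]
    have hl : ‖(leftPt : ℂ) - (R - 5 / 6 : ℝ)‖ ≤ R := by
      have : (leftPt : ℂ) - (R - 5 / 6 : ℝ) = ((-R : ℝ) : ℂ) := by
        simp only [leftPt]; push_cast; ring
      rw [this, Complex.norm_real, Real.norm_eq_abs, abs_neg, abs_of_pos h.pos]
    conv_lhs => rw [← twist_two_of_le hl, twist_twist]
    simp

/-- A negative full twist winds the segment `tail` once around the circle, backwards. -/
lemma mk_untwistedTail {R : ℝ} (h : Admissible R) :
    ⟪untwistedTail h⟫ = ⟪tail⟫ ⬝ (⟪circ h⟫).symm := by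
  have key := mk_trans_eq_of_square
    ⟨fun p : I × I => (⟨_, twist_tail_mem h (-2 * p.1) p.2⟩ : Fiber), by
      refine Continuous.subtype_mk ?_ _
      exact (continuous_twist _ R).comp
        (by fun_prop : Continuous fun p : I × I => ((-2 * p.1 : ℝ), (tail p.2 : ℂ)))⟩
    tail (circ h).symm (Path.refl basePt) (untwistedTail h)
    (fun s => Subtype.ext (by simp))
    (fun s => Subtype.ext (by
      have hl : (leftPt : ℂ) - (R - 5 / 6 : ℝ) = ((-R : ℝ) : ℂ) := by
        simp only [leftPt]; push_cast; ring
      change (circleMap h (1 - s) : ℂ) = twist _ R _ (tail 1)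
      rw [tail.target, circleMap_apply, twist_of_le, hl]
      · have : (((2 * Real.pi * (1 - s) : ℝ) : ℂ) * Complex.I) =
          2 * Real.pi * Complex.I + (Real.pi * (-2 * s : ℝ) * Complex.I) := by push_cast; ring
        rw [this, Complex.exp_add, Complex.exp_two_pi_mul_I]
        push_cast
        ring
      · rw [hl, Complex.norm_real, Real.norm_eq_abs, abs_neg, abs_of_pos h.pos]))
    (fun s => Subtype.ext (by
      change (basePt : ℂ) = twist _ R _ (tail 0)
      rw [tail.source, twist_of_ge]
      have h1 := (abs_le.1 (Complex.abs_re_le_norm ((basePt : ℂ) - (R - 5 / 6 : ℝ)))).1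
      have h2 : (basePt : ℂ).re = -3 / 2 := rfl
      rw [Complex.sub_re, Complex.ofReal_re, h2] at h1
      linarith))
    (fun s => Subtype.ext (by simp [untwistedTail]))
  rw [← Path.Homotopic.Quotient.mk_symm, key]
  simp

/-- A loop inside an admissible circle, with the tail attached, is the image under the full twist of
its conjugate with that circle: the twist fixes the inside, and drags the tail once around. -/
lemma exists_untwisted {R : ℝ} (h : Admissible R) (γ : Path leftPt leftPt)
    (hγ : ∀ t, ‖(γ t : ℂ) - (R - 5 / 6 : ℝ)‖ ≤ R) :
    ∃ y : Path basePt basePt,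
      (∀ t, (withTail γ t : ℂ) = twist (R - 5 / 6 : ℝ) R 2 (y t)) ∧
      ⟪y⟫ = (⟪withTail (circ h)⟫).symm ⬝ ⟪withTail γ⟫ ⬝ ⟪withTail (circ h)⟫ := by
  refine ⟨(untwistedTail h).trans (γ.trans (untwistedTail h).symm), fun t => ?_, ?_⟩
  · have ht : ∀ s, (tail s : ℂ) = twist (R - 5 / 6 : ℝ) R 2 (untwistedTail h s) := by
      intro s
      change _ = twist _ R 2 (twist _ R (-2) _)
      rw [twist_twist]
      simp
    simp only [withTail, Path.trans_apply, Path.symm_apply, Function.comp_apply]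
    split_ifs
    · exact ht _
    · exact (twist_two_of_le (hγ _)).symm
    · exact ht _
  · simp [withTail, mk_untwistedTail, Path.Homotopic.Quotient.trans_assoc]

lemma circ_nested {j k : Fin 3} (hjk : j ≤ k) (t : I) :
    ‖(circ (admissible_radius j) t : ℂ) - (radius k - 5 / 6 : ℝ)‖ ≤ radius k := by
  have hr : radius j ≤ radius k := by
    fin_cases j <;> fin_cases k <;> first | exact absurd hjk (by decide) | norm_num [radius]
  change ‖(circleMap (admissible_radius j) t : ℂ) - (radius k - 5 / 6 : ℝ)‖ ≤ radius k
  rw [circleMap_apply, show ∀ e : ℂ, ((radius j - 5 / 6 : ℝ) : ℂ) - radius j * e -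
    (radius k - 5 / 6 : ℝ) = ((radius j - radius k : ℝ) : ℂ) - radius j * e by
      intro e; push_cast; ring]
  refine (norm_sub_le _ _).trans ?_
  rw [norm_mul, Complex.norm_exp_ofReal_mul_I, Complex.norm_real, Complex.norm_real,
    Real.norm_eq_abs, Real.norm_eq_abs, abs_of_nonpos (by linarith),
    abs_of_pos (admissible_radius j).pos]
  linarith

/-- The innermost loop stays away from the disk about the second and third points. -/
lemma le_norm_withTail_sub (t : I) :
    7 / 12 ≤ ‖(withTail (circ (admissible_radius 0)) t : ℂ) - 1 / 3‖ := by
  have hre : ∀ w : ℂ, w.re ≤ -1 / 2 → 7 / 12 ≤ ‖w - 1 / 3‖ := by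
    intro w hw
    have h1 := (abs_le.1 (Complex.abs_re_le_norm (w - 1 / 3))).1
    rw [Complex.sub_re, show (1 / 3 : ℂ).re = 1 / 3 by norm_num] at h1
    linarith
  refine hre _ ?_
  simp only [withTail, Path.trans_apply, Path.symm_apply, Function.comp_apply]
  split_ifs
  · exact (tail_re _).trans (by norm_num)
  · have h : ∀ θ, (circleMap (admissible_radius 0) θ : ℂ).re ≤ -1 / 2 := by
      intro θ
      rw [circleMap_apply, Complex.sub_re, Complex.ofReal_re, Complex.re_ofReal_mul,
        Complex.exp_ofReal_mul_I_re]
      have := Real.neg_one_le_cos (2 * Real.pi * θ)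
      have hr : radius 0 = 1 / 6 := rfl
      rw [hr]
      linarith
    exact h _
  · exact (tail_re _).trans (by norm_num)

/-! ### The complement of a torus-covering link -/

/-- Isotopy extension, stated for each parameter separately. -/
lemma exists_push_fiberwise {m : ℕ} {Y : Type*} [TopologicalSpace Y] [CompactSpace Y]
    (c : C(I × Y, OrderedConf m)) :
    ∃ Φ Φ' : C(Y × ℂ, ℂ), (∀ y z, Φ' (y, Φ (y, z)) = z) ∧ (∀ y z, Φ (y, Φ' (y, z)) = z) ∧
      (∀ y i, Φ (y, coords (c (0, y)) i) = coords (c (1, y)) i) ∧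
      (∀ y z, 1 ≤ ‖z‖ → Φ (y, z) = z) ∧
      (∀ y, (∀ s, c (s, y) = c (0, y)) → ∀ z, Φ (y, z) = z) := by
  obtain ⟨Φ, h1, h2, h3, h4⟩ := exists_push c
  have h1' : ∀ x, (Φ.symm x).1 = x.1 := fun x => by
    rw [← h1 (Φ.symm x), Φ.apply_symm_apply]
  refine ⟨⟨fun p => (Φ p).2, by fun_prop⟩, ⟨fun p => (Φ.symm p).2, by fun_prop⟩, fun y z => ?_,
    fun y z => ?_, h2, h3, h4⟩
  · have : ((y, (Φ (y, z)).2) : Y × ℂ) = Φ (y, z) := Prod.ext (h1 (y, z)).symm rfl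
    simp [this]
  · have : ((y, (Φ.symm (y, z)).2) : Y × ℂ) = Φ.symm (y, z) := Prod.ext (h1' (y, z)).symm rfl
    simp [this]

/-- The point of the unit circle reached after `u` turns. -/
def turn (u : ℝ) : ℂ := Complex.exp (((2 * Real.pi * u : ℝ) : ℂ) * Complex.I)

@[fun_prop]
lemma continuous_turn : Continuous turn := by
  unfold turn
  fun_prop

@[simp] lemma norm_turn (u : ℝ) : ‖turn u‖ = 1 := Complex.norm_exp_ofReal_mul_I _

@[simp] lemma turn_zero : turn 0 = 1 := by simp [turn]

lemma turn_eq_one_iff {u : ℝ} : turn u = 1 ↔ ∃ k : ℤ, u = k := by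
  rw [turn, Complex.exp_eq_one_iff]
  refine exists_congr fun k => ?_
  have hpi : (2 * Real.pi * Complex.I : ℂ) ≠ 0 := Complex.two_pi_I_ne_zero
  rw [show ((2 * Real.pi * u : ℝ) : ℂ) * Complex.I = (u : ℂ) * (2 * Real.pi * Complex.I) by
    push_cast; ring, mul_left_inj' hpi]
  exact_mod_cast Iff.rfl

lemma turn_add (u v : ℝ) : turn (u + v) = turn u * turn v := by
  rw [turn, turn, turn, ← Complex.exp_add]
  congr 1
  push_cast
  ring

/-- The point of `ℂ × ℂ` whose polar coordinates are given by the angles `u`, `v`, in turns, and the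
radii `2 + re w`, `2 + im w`. -/
def polar (w : ℂ) (k : ℝ × ℝ) : ℂ × ℂ :=
  ((2 + w.re : ℝ) * turn k.1, (2 + w.im : ℝ) * turn k.2)

@[fun_prop]
lemma continuous_polar : Continuous fun p : ℂ × ℝ × ℝ => polar p.1 p.2 := by
  unfold polar
  fun_prop

lemma norm_polar {w : ℂ} (hw : w ∈ quadrant) (k : ℝ × ℝ) :
    ‖(polar w k).1‖ = 2 + w.re ∧ ‖(polar w k).2‖ = 2 + w.im := by
  have h1 := hw.1
  have h2 := hw.2
  simp only [polar, norm_mul, norm_turn, mul_one, Complex.norm_real, Real.norm_eq_abs]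
  exact ⟨abs_of_pos (by linarith), abs_of_pos (by linarith)⟩

/-- The subset `K` of `ℂ × ℂ` is, in polar coordinates, traced out by the ordered configurations
`ζ`, and it stays away from the coordinate axes. -/
structure IsTraced (K : Set (ℂ × ℂ)) (ζ : C(ℝ × ℝ, OrderedConf 3)) : Prop where
  zero : ζ 0 = orderedBase 3
  mem_iff : ∀ w ∈ quadrant, ∀ k, polar w k ∈ K ↔ ∃ i, w = coords (ζ k) i
  one_lt : ∀ p ∈ K, 1 < ‖p.1‖ ∧ 1 < ‖p.2‖

/-- The complement of `K`. -/
abbrev LinkCompl (K : Set (ℂ × ℂ)) : Type := {p : ℂ × ℂ // p ∉ K}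

section Traced

variable {K : Set (ℂ × ℂ)} {ζ : C(ℝ × ℝ, OrderedConf 3)}

lemma IsTraced.notMem (hK : IsTraced K ζ) {w : ℂ} (hw : w ∈ quadrant) {k : ℝ × ℝ}
    (h : ∀ i, w ≠ coords (ζ k) i) : polar w k ∉ K := fun hp => by
  obtain ⟨i, hi⟩ := (hK.mem_iff w hw k).1 hp
  exact h i hi

lemma IsTraced.coords_zero (hK : IsTraced K ζ) (i : Fin 3) : coords (ζ 0) i = basePos 3 i := by
  rw [hK.zero]
  rfl

/-- The inclusion of the punctured quadrant as the fibre of the complement over the point with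
angles `0`. -/
def IsTraced.incl (hK : IsTraced K ζ) : C(Fiber, LinkCompl K) where
  toFun w := ⟨polar w 0, hK.notMem w.2.1 fun i => by rw [hK.coords_zero]; exact w.2.2 i⟩
  continuous_toFun := Continuous.subtype_mk
    (continuous_polar.comp (by fun_prop : Continuous fun w : Fiber => ((w : ℂ), (0 : ℝ × ℝ)))) _

lemma IsTraced.incl_apply (hK : IsTraced K ζ) (w : Fiber) : (hK.incl w : ℂ × ℂ) = polar w 0 := rfl

/-- The torus of points with the radii `1 / 2` lies in the complement. -/
lemma IsTraced.polar_basePt_notMem (hK : IsTraced K ζ) (k : ℝ × ℝ) :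
    polar basePt k ∉ K := fun h => by
  have := (hK.one_lt _ h).1
  rw [(norm_polar basePt.2.1 k).1] at this
  norm_num [basePt] at this

lemma convex_norm_fst_lt : Convex ℝ {p : ℂ × ℂ | ‖p.1‖ < 1} := by
  have h : {p : ℂ × ℂ | ‖p.1‖ < 1} = (LinearMap.fst ℝ ℂ ℂ) ⁻¹' Metric.ball 0 1 := by
    ext p; simp
  rw [h]
  exact (convex_ball _ _).linear_preimage _

lemma convex_norm_snd_lt : Convex ℝ {p : ℂ × ℂ | ‖p.2‖ < 1} := by
  have h : {p : ℂ × ℂ | ‖p.2‖ < 1} = (LinearMap.snd ℝ ℂ ℂ) ⁻¹' Metric.ball 0 1 := by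
    ext p; simp
  rw [h]
  exact (convex_ball _ _).linear_preimage _

lemma norm_polar_basePt (k : ℝ × ℝ) : ‖(polar basePt k).1‖ < 1 ∧ ‖(polar basePt k).2‖ < 1 := by
  rw [(norm_polar basePt.2.1 k).1, (norm_polar basePt.2.1 k).2]
  norm_num [basePt]

/-- A path in the torus of points with the radii `1 / 2` is null-homotopic in the complement: it
bounds a disk near the axes. -/
lemma IsTraced.mk_eq_refl (hK : IsTraced K ζ) (c : C(I, ℝ × ℝ))
    (γ : Path (hK.incl basePt) (hK.incl basePt))
    (h : ∀ t, (γ t : ℂ × ℂ) = polar basePt (c t)) :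
    ⟪γ⟫ = Path.Homotopic.Quotient.refl _ :=
  mk_eq_mk_of_convex convex_norm_fst_lt (fun p hp h => (hK.one_lt p h).1.not_gt hp) γ (Path.refl _)
    (fun t => by rw [h]; exact (norm_polar_basePt _).1) (fun t => (norm_polar_basePt 0).1)

/-- Along a loop `c` of the torus of angles, let the configurations trace out a braid that is realized
by `ψ`. Then each loop of the fibre is homotopic, in the complement, to its image under `ψ`: an
isotopy carries it along `c`, and the base point moves along a null-homotopic loop. -/
theorem IsTraced.mk_map_eq (hK : IsTraced K ζ) {g : BraidGroup 3} {ψ : ℂ ≃ₜ ℂ} (hg : Realizes g ψ)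
    (c : C(I, ℝ × ℝ)) (hc0 : c 0 = 0)
    (hc1 : ∀ w, polar w (c 1) = polar w 0) (α : Path (baseConf 3) (baseConf 3))
    (hα : braidClass α = g) (hαζ : ∀ t, α t = Quotient.mk _ (ζ (c t)))
    (y y' : Path basePt basePt) (hy : ∀ t, (y' t : ℂ) = ψ (y t)) :
    ⟪y.map hK.incl.continuous⟫ = ⟪y'.map hK.incl.continuous⟫ := by
  obtain ⟨Ψ, hinj, h0, h1, hout, γ, ω, hγg, hγ, hω⟩ := hg.exists_ordered
  have hω0 : ω 0 = ζ (c 0) := coords_ext fun i => by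
    rw [hω, h0, hc0, hK.coords_zero]
  have hhom : γ.Homotopic α := by
    rw [← Path.Homotopic.Quotient.eq]
    exact MulOpposite.op_injective (hγg.trans hα.symm)
  obtain ⟨G, G0, G1, G2, G3⟩ := homotopic_of_homotopic_mk hhom (ω := ω) (ω' := ζ.comp c) hω0 hγ hαζ
  -- The isotopy `Ψ` follows a braid that is only homotopic to the given one; the homotopy `G` is used
  -- to correct it to the isotopy `Θ (t, Ψ (t, z))`, which follows the given configurations.
  obtain ⟨Θ, Θ', hΘ1, -, hΘ3, hΘ4, hΘ5⟩ := exists_push_fiberwise G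
  have hΘ0 : ∀ z, Θ (0, z) = z := hΘ5 0 fun s => by rw [G2, G0]
  have hΘe : ∀ z, Θ (1, z) = z := hΘ5 1 fun s => by rw [G3, G0]
  have hΛout : ∀ t z, 1 ≤ ‖z‖ → Θ (t, Ψ (t, z)) = z := fun t z hz => by
    rw [hout t z hz, hΘ4 t z hz]
  have hΛinj : ∀ t, Function.Injective fun z => Θ (t, Ψ (t, z)) := fun t z z' h => by
    apply hinj t
    change Ψ (t, z) = Ψ (t, z')
    rw [← hΘ1 t (Ψ (t, z)), show Θ (t, Ψ (t, z)) = Θ (t, Ψ (t, z')) from h, hΘ1]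
  have hΛp : ∀ t i, Θ (t, Ψ (t, basePos 3 i)) = coords (ζ (c t)) i := fun t i => by
    have := hΘ3 t i
    rw [G0, G1, hω] at this
    exact this
  have hΛmem : ∀ t (w : Fiber), polar (Θ (t, Ψ (t, w))) (c t) ∉ K := by
    intro t w
    refine hK.notMem ?_ fun i hi => w.2.2 i (hΛinj t (hi.trans (hΛp t i).symm))
    rcases le_or_gt 1 ‖(w : ℂ)‖ with hw | hw
    · rw [hΛout t w hw]
      exact w.2.1
    · refine mem_quadrant_of_norm_le (not_lt.1 fun hgt => ?_)
      have h2 : Θ (t, Ψ (t, (w : ℂ))) = w := hΛinj t (hΛout t _ hgt.le)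
      rw [h2] at hgt
      exact lt_asymm hw hgt
  have hb : 1 ≤ ‖(basePt : ℂ)‖ := by
    have := Complex.abs_re_le_norm (basePt : ℂ)
    norm_num [basePt] at this ⊢
    linarith
  let side : Path (hK.incl basePt) (hK.incl basePt) :=
    { toFun := fun t => ⟨polar basePt (c t), hK.polar_basePt_notMem _⟩
      continuous_toFun := by
        refine Continuous.subtype_mk ?_ _
        exact continuous_polar.comp (by fun_prop : Continuous fun t => ((basePt : ℂ), c t))
      source' := Subtype.ext (by simp only [hc0]; rfl)
      target' := Subtype.ext (hc1 _) }
  have hside : ⟪side⟫ = Path.Homotopic.Quotient.refl _ := hK.mk_eq_refl c side fun _ => rfl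
  have key := mk_trans_eq_of_square
    ⟨fun p : I × I => (⟨_, hΛmem p.1 (y p.2)⟩ : LinkCompl K), by
      refine Continuous.subtype_mk ?_ _
      exact continuous_polar.comp (by fun_prop :
        Continuous fun p : I × I => (Θ (p.1, Ψ (p.1, y p.2)), c p.1))⟩
    (y.map hK.incl.continuous) side side (y'.map hK.incl.continuous)
    (fun s => Subtype.ext (by
      change polar (y s) 0 = polar (Θ (0, Ψ (0, y s))) (c 0)
      rw [h0, hΘ0, hc0]))
    (fun s => Subtype.ext (by
      change polar basePt (c s) = polar (Θ (s, Ψ (s, y 1))) (c s)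
      rw [y.target, hΛout _ _ hb]))
    (fun s => Subtype.ext (by
      change polar basePt (c s) = polar (Θ (s, Ψ (s, y 0))) (c s)
      rw [y.source, hΛout _ _ hb]))
    (fun s => Subtype.ext (by
      change polar (y' s) 0 = polar (Θ (1, Ψ (1, y s))) (c 1)
      rw [hΘe, h1, hc1, hy]))
  rw [hside] at key
  simpa using key

end Traced

/-! ### Loops of the fibre generate -/

/-- A continuous choice of the angle, in turns, along a path in the punctured plane. -/
lemma exists_angle (f : C(I, ℂ)) (hf : ∀ t, f t ≠ 0) (h0 : f 0 = (‖f 0‖ : ℝ)) :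
    ∃ u : C(I, ℝ), u 0 = 0 ∧ ∀ t, f t = (‖f t‖ : ℝ) * turn (u t) := by
  have hn : 0 < ‖f 0‖ := norm_pos_iff.2 (hf 0)
  obtain ⟨g, hg, hg0⟩ := Complex.isCoveringMap_exp.exists_path_lifts
    ⟨fun t => ⟨f t, hf t⟩, f.continuous.subtype_mk _⟩ (Real.log ‖f 0‖ : ℂ) (Subtype.ext (by
      change f 0 = Complex.exp (Real.log ‖f 0‖ : ℂ)
      rw [← Complex.ofReal_exp, Real.exp_log hn]
      exact h0))
  have hexp : ∀ t, Complex.exp (g t) = f t := fun t => congrArg Subtype.val (congrFun hg t)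
  refine ⟨⟨fun t => (g t).im / (2 * Real.pi), by fun_prop⟩, ?_, fun t => ?_⟩
  · simp [hg0]
  · rw [← hexp, Complex.norm_exp, Complex.ofReal_exp, turn, ← Complex.exp_add]
    congr 1
    simp only [ContinuousMap.coe_mk]
    rw [mul_div_cancel₀ _ (by positivity : (2 * Real.pi : ℝ) ≠ 0), Complex.re_add_im]

/-- Polar coordinates of a point outside the axes. -/
lemma exists_polar {p : ℂ × ℂ} (h1 : p.1 ≠ 0) (h2 : p.2 ≠ 0) :
    ∃ w ∈ quadrant, ∃ k, p = polar w k := by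
  have key : ∀ z : ℂ, ∃ u, z = (‖z‖ : ℝ) * turn u := fun z => by
    refine ⟨z.arg / (2 * Real.pi), ?_⟩
    rw [turn, mul_div_cancel₀ _ (by positivity : (2 * Real.pi : ℝ) ≠ 0)]
    exact (Complex.norm_mul_exp_arg_mul_I z).symm
  obtain ⟨u, hu⟩ := key p.1
  obtain ⟨v, hv⟩ := key p.2
  refine ⟨⟨‖p.1‖ - 2, ‖p.2‖ - 2⟩, ⟨?_, ?_⟩, (u, v), Prod.ext ?_ ?_⟩
  · simpa using h1
  · simpa using h2
  · change p.1 = ((2 + (‖p.1‖ - 2) : ℝ) : ℂ) * turn u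
    rw [add_sub_cancel, ← hu]
  · change p.2 = ((2 + (‖p.2‖ - 2) : ℝ) : ℂ) * turn v
    rw [add_sub_cancel, ← hv]

lemma exists_path_fiber (w : Fiber) : Nonempty (Path basePt w) := by
  rcases le_total 0 (w : ℂ).im with h | h
  · obtain ⟨γ, -⟩ := exists_path_slitQuadrant (Or.inl rfl)
      (mem_slitQuadrant_of_nonneg (h := 1) (Or.inl rfl) leftPt (by norm_num [leftPt]))
      (mem_slitQuadrant_of_nonneg (h := 1) (Or.inl rfl) w (by simpa using h))
    exact ⟨tail.trans γ⟩
  · obtain ⟨γ, -⟩ := exists_path_slitQuadrant (Or.inr rfl)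
      (mem_slitQuadrant_of_nonneg (h := -1) (Or.inr rfl) leftPt (by norm_num [leftPt]))
      (mem_slitQuadrant_of_nonneg (h := -1) (Or.inr rfl) w (by simpa using h))
    exact ⟨tail.trans γ⟩

lemma one_le_norm_basePt : 1 ≤ ‖(basePt : ℂ)‖ := by
  have := Complex.abs_re_le_norm (basePt : ℂ)
  norm_num [basePt] at this ⊢
  linarith

section Traced

variable {K : Set (ℂ × ℂ)} {ζ : C(ℝ × ℝ, OrderedConf 3)}

/-- The complement of the axes: a bundle over the torus of angles. -/
def offAxes (K : Set (ℂ × ℂ)) : Set (LinkCompl K) := {p | p.1.1 ≠ 0 ∧ p.1.2 ≠ 0}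

/-- A push of the plane that fixes the outside of the disk preserves the quadrant. -/
lemma mem_quadrant_of_leftInverse {f g : ℂ → ℂ} (hfg : ∀ z, g (f z) = z)
    (hf : ∀ z, 1 ≤ ‖z‖ → f z = z) {w : ℂ} (hw : w ∈ quadrant) : f w ∈ quadrant := by
  rcases le_or_gt 1 ‖w‖ with h | h
  · rwa [hf w h]
  · refine mem_quadrant_of_norm_le (not_lt.1 fun hgt => ?_)
    have h2 : f w = w := by rw [← hfg (f w), hf _ hgt.le, hfg]
    rw [h2] at hgt
    exact lt_asymm h hgt

/-- Every loop outside the axes is homotopic to a loop in the fibre: the isotopies along straight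
paths from the base point of the torus of angles carry it there, and in the process the base point
moves along a null-homotopic loop near the axes. -/
theorem IsTraced.exists_loop_fiber (hK : IsTraced K ζ)
    (γ : Path (hK.incl basePt) (hK.incl basePt)) (hγ : ∀ t, γ t ∈ offAxes K) :
    ∃ y : Path basePt basePt, ⟪γ⟫ = ⟪y.map hK.incl.continuous⟫ := by
  have hx : ∀ t, t = 0 ∨ t = 1 →
      ((γ t : ℂ × ℂ).1 = (1 / 2 : ℝ) ∧ (γ t : ℂ × ℂ).2 = (1 / 2 : ℝ)) := by
    rintro t (rfl | rfl) <;>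
    · first | rw [γ.source] | rw [γ.target]
      rw [hK.incl_apply]
      norm_num [polar, basePt]
  have hn : ‖((1 / 2 : ℝ) : ℂ)‖ = 1 / 2 := by
    rw [Complex.norm_real]; norm_num
  obtain ⟨u, hu0, hu⟩ := exists_angle ⟨fun t => (γ t : ℂ × ℂ).1, by fun_prop⟩
    (fun t => (hγ t).1) (by
    simp only [ContinuousMap.coe_mk, (hx 0 (Or.inl rfl)).1, hn])
  obtain ⟨v, hv0, hv⟩ := exists_angle ⟨fun t => (γ t : ℂ × ℂ).2, by fun_prop⟩
    (fun t => (hγ t).2) (by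
    simp only [ContinuousMap.coe_mk, (hx 0 (Or.inl rfl)).2, hn])
  simp only [ContinuousMap.coe_mk] at hu hv
  let w : C(I, ℂ) := ⟨fun t => ((‖(γ t : ℂ × ℂ).1‖ - 2 : ℝ) : ℂ) +
    ((‖(γ t : ℂ × ℂ).2‖ - 2 : ℝ) : ℂ) * Complex.I, by fun_prop⟩
  have hwre : ∀ t, (w t).re = ‖(γ t : ℂ × ℂ).1‖ - 2 := fun t => by simp [w]
  have hwim : ∀ t, (w t).im = ‖(γ t : ℂ × ℂ).2‖ - 2 := fun t => by simp [w]
  have hwq : ∀ t, w t ∈ quadrant := fun t => by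
    have h1 := norm_pos_iff.2 (hγ t).1
    have h2 := norm_pos_iff.2 (hγ t).2
    constructor
    · rw [hwre]; linarith
    · rw [hwim]; linarith
  have hwb : ∀ t, t = 0 ∨ t = 1 → w t = basePt := fun t ht => by
    apply Complex.ext
    · rw [hwre, (hx t ht).1, hn]; norm_num [basePt]
    · rw [hwim, (hx t ht).2, hn]; norm_num [basePt]
  have hpolar : ∀ t, polar (w t) (u t, v t) = γ t := fun t => by
    refine Prod.ext ?_ ?_
    · change ((2 + (w t).re : ℝ) : ℂ) * turn (u t) = _
      rw [hwre, add_sub_cancel, ← hu]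
    · change ((2 + (w t).im : ℝ) : ℂ) * turn (v t) = _
      rw [hwim, add_sub_cancel, ← hv]
  let k : C(I × I, ℝ × ℝ) := ⟨fun p => ((p.1 : ℝ) * u p.2, (p.1 : ℝ) * v p.2), by fun_prop⟩
  -- `Φ ((s, t), ·)` carries the base configuration to the configuration at the angles `k (s, t)`.
  obtain ⟨Φ, Φ', h1, h2, h3, h4, h5⟩ := exists_push_fiberwise (Y := I × I)
    (ζ.comp ⟨fun q : I × I × I => ((q.1 : ℝ) * (k q.2).1, (q.1 : ℝ) * (k q.2).2), by fun_prop⟩)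
  have h3' : ∀ y i, Φ (y, basePos 3 i) = coords (ζ (k y)) i := fun y i => by
    have := h3 y i
    simpa [hK.coords_zero, show ((0 : ℝ), (0 : ℝ)) = 0 from rfl] using this
  have h5' : ∀ y, k y = 0 → ∀ z, Φ (y, z) = z := fun y hy => h5 y fun s => by
    simp [hy]
  have h4' : ∀ y z, 1 ≤ ‖z‖ → Φ' (y, z) = z := fun y z hz => by
    conv_lhs => rw [← h4 y z hz]
    exact h1 y z
  have hq' : ∀ t, Φ' ((1, t), w t) ∈ quadrant := fun t =>
    mem_quadrant_of_leftInverse (f := fun z => Φ' ((1, t), z)) (g := fun z => Φ ((1, t), z))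
      (h2 (1, t)) (h4' (1, t)) (hwq t)
  have hne : ∀ t i, Φ' ((1, t), w t) ≠ basePos 3 i := fun t i hi => by
    have h := h3' (1, t) i
    rw [← hi, h2] at h
    refine (γ t).2 ?_
    rw [← hpolar, hK.mem_iff _ (hwq t)]
    exact ⟨i, h.trans (by simp [k])⟩
  have hmem : ∀ p : I × I, polar (Φ (p, Φ' ((1, p.2), w p.2))) (k p) ∉ K := fun p =>
    hK.notMem (mem_quadrant_of_leftInverse (f := fun z => Φ (p, z)) (g := fun z => Φ' (p, z))
      (h1 p) (h4 p) (hq' p.2)) fun i hi => by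
      rw [← h3' p i] at hi
      refine hne p.2 i ?_
      rw [← h1 p (Φ' _), hi, h1]
  have hb : ∀ s t, t = 0 ∨ t = 1 → Φ ((s, t), Φ' ((1, t), w t)) = basePt := fun s t ht => by
    rw [hwb t ht, h4' _ _ one_le_norm_basePt, h4 _ _ one_le_norm_basePt]
  have hΦ' : ∀ t, t = 0 ∨ t = 1 → Φ' ((1, t), w t) = basePt := fun t ht => by
    rw [hwb t ht, h4' _ _ one_le_norm_basePt]
  let y : Path basePt basePt :=
    { toFun := fun t => ⟨Φ' ((1, t), w t), hq' t, hne t⟩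
      continuous_toFun := by
        refine Continuous.subtype_mk ?_ _
        fun_prop
      source' := Subtype.ext (hΦ' 0 (Or.inl rfl))
      target' := Subtype.ext (hΦ' 1 (Or.inr rfl)) }
  have hk1 : polar basePt (k (1, 1)) = polar basePt 0 := by
    have h := hpolar 1
    rw [hwb 1 (Or.inr rfl), γ.target, hK.incl_apply] at h
    simpa [k] using h
  let side : Path (hK.incl basePt) (hK.incl basePt) :=
    { toFun := fun s => ⟨polar basePt (k (s, 1)), hK.polar_basePt_notMem _⟩
      continuous_toFun := by
        refine Continuous.subtype_mk ?_ _
        exact continuous_polar.comp (by fun_prop : Continuous fun s => ((basePt : ℂ), k (s, 1)))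
      source' := Subtype.ext (by simp [k, hK.incl_apply, show ((0 : ℝ), (0 : ℝ)) = 0 from rfl])
      target' := Subtype.ext hk1 }
  have hside : ⟪side⟫ = Path.Homotopic.Quotient.refl _ :=
    hK.mk_eq_refl ⟨fun s => k (s, 1), by fun_prop⟩ side fun _ => rfl
  have key := mk_trans_eq_of_square
    ⟨fun p : I × I => (⟨_, hmem p⟩ : LinkCompl K), by
      refine Continuous.subtype_mk ?_ _
      exact continuous_polar.comp (by fun_prop :
        Continuous fun p : I × I => (Φ (p, Φ' ((1, p.2), w p.2)), k p))⟩
    (y.map hK.incl.continuous) side (Path.refl _) γ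
    (fun s => Subtype.ext (by
      change polar (Φ' ((1, s), w s)) 0 = polar (Φ ((0, s), Φ' ((1, s), w s))) (k (0, s))
      have hk0 : k (0, s) = 0 := by simp [k]
      rw [h5' _ hk0, hk0]))
    (fun s => Subtype.ext (by
      change polar basePt (k (s, 1)) = polar (Φ ((s, 1), Φ' ((1, 1), w 1))) (k (s, 1))
      rw [hb _ _ (Or.inr rfl)]))
    (fun s => Subtype.ext (by
      change polar basePt 0 = polar (Φ ((s, 0), Φ' ((1, 0), w 0))) (k (s, 0))
      have hk0 : k (s, 0) = 0 := by simp [k, hu0, hv0]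
      rw [hb _ _ (Or.inl rfl), hk0]))
    (fun s => Subtype.ext (by
      change (γ s : ℂ × ℂ) = polar (Φ ((1, s), Φ' ((1, s), w s))) (k (1, s))
      rw [h2, ← hpolar]
      simp [k]))
  refine ⟨y, ?_⟩
  rw [hside] at key
  simpa using key.symm

/-- The part of the complement outside the axes is path connected. -/
lemma IsTraced.exists_path_offAxes (hK : IsTraced K ζ) {p : LinkCompl K} (hp : p ∈ offAxes K) :
    ∃ δ : Path (hK.incl basePt) p, ∀ t, δ t ∈ offAxes K := by
  obtain ⟨w, hw, k, hpk⟩ := exists_polar hp.1 hp.2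
  obtain ⟨Φ, Φ', h1, h2, h3, h4, h5⟩ := exists_push_fiberwise (Y := I)
    (ζ.comp ⟨fun q : I × I => ((q.1 : ℝ) * (q.2 * k.1), (q.1 : ℝ) * (q.2 * k.2)), by fun_prop⟩)
  have h3' : ∀ (s : I) i, Φ (s, basePos 3 i) = coords (ζ (s * k.1, s * k.2)) i := fun s i => by
    have := h3 s i
    simpa [hK.coords_zero, show ((0 : ℝ), (0 : ℝ)) = 0 from rfl] using this
  have h5' : ∀ z, Φ (0, z) = z := h5 0 fun s => by simp
  have h4' : ∀ s z, 1 ≤ ‖z‖ → Φ' (s, z) = z := fun s z hz => by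
    conv_lhs => rw [← h4 s z hz]
    exact h1 s z
  have hq' : Φ' (1, w) ∈ quadrant :=
    mem_quadrant_of_leftInverse (f := fun z => Φ' (1, z)) (g := fun z => Φ (1, z))
      (h2 1) (h4' 1) hw
  have hne : ∀ i, Φ' (1, w) ≠ basePos 3 i := fun i hi => by
    have h := h3' 1 i
    rw [← hi, h2] at h
    refine p.2 ?_
    rw [hpk, hK.mem_iff _ hw]
    exact ⟨i, h.trans (by simp)⟩
  have hq : ∀ s, Φ (s, Φ' (1, w)) ∈ quadrant := fun s =>
    mem_quadrant_of_leftInverse (f := fun z => Φ (s, z)) (g := fun z => Φ' (s, z))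
      (h1 s) (h4 s) hq'
  have hmem : ∀ s : I, polar (Φ (s, Φ' (1, w))) (s * k.1, s * k.2) ∉ K := fun s =>
    hK.notMem (hq s) fun i hi => by
      rw [← h3' s i] at hi
      refine hne i ?_
      rw [← h1 s (Φ' _), hi, h1]
  obtain ⟨η⟩ := exists_path_fiber ⟨Φ' (1, w), hq', hne⟩
  let δ : Path (hK.incl ⟨Φ' (1, w), hq', hne⟩) p :=
    { toFun := fun s => ⟨_, hmem s⟩
      continuous_toFun := by
        refine Continuous.subtype_mk ?_ _
        exact continuous_polar.comp (by fun_prop :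
          Continuous fun s : I => (Φ (s, Φ' (1, w)), ((s : ℝ) * k.1, (s : ℝ) * k.2)))
      source' := Subtype.ext (by
        simp [h5', hK.incl_apply, show ((0 : ℝ), (0 : ℝ)) = 0 from rfl])
      target' := Subtype.ext (by simp [h2, hpk]) }
  have hoff : ∀ (x : LinkCompl K) w' (_ : w' ∈ quadrant) k', (x : ℂ × ℂ) = polar w' k' →
      x ∈ offAxes K := fun x w' hw' k' hx => by
    have h1 := (norm_polar hw' k').1
    have h2 := (norm_polar hw' k').2
    have h3 := hw'.1
    have h4 := hw'.2
    constructor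
    · rw [hx, ← norm_pos_iff, h1]; linarith
    · rw [hx, ← norm_pos_iff, h2]; linarith
  refine ⟨(η.map hK.incl.continuous).trans δ, fun t => ?_⟩
  rw [Path.trans_apply]
  split_ifs
  · exact hoff _ _ (η _).2.1 _ rfl
  · exact hoff _ _ (hq _) _ rfl

/-- Let a convex set `Q` of pairs of radii describe a part `U` of the complement that the link does not
meet. Then the points of `U` outside the axes are joined to the base point in `U` and outside the
axes. -/
lemma IsTraced.exists_path_near_axis (hK : IsTraced K ζ) {p : LinkCompl K} (hp : p ∈ offAxes K)
    {Q : Set ℂ} (hQ : Convex ℝ Q) (hb : (basePt : ℂ) ∈ Q) {U : Set (LinkCompl K)}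
    (hU : ∀ (x : LinkCompl K) w k, w ∈ quadrant → (x : ℂ × ℂ) = polar w k → (x ∈ U ↔ w ∈ Q))
    (hQK : ∀ w k, w ∈ quadrant → w ∈ Q → polar w k ∉ K) (hpU : p ∈ U) :
    ∃ δ : Path (hK.incl basePt) p, ∀ t, δ t ∈ offAxes K ∧ δ t ∈ U := by
  obtain ⟨w, hw, k, hpk⟩ := exists_polar hp.1 hp.2
  have hwQ := (hU p w k hw hpk).1 hpU
  have hline : ∀ s : I, AffineMap.lineMap (basePt : ℂ) w (s : ℝ) ∈ quadrant ∩ Q := fun s =>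
    (convex_quadrant.inter hQ).lineMap_mem ⟨basePt.2.1, hb⟩ ⟨hw, hwQ⟩ s.2
  refine ⟨{ toFun := fun s => ⟨polar (AffineMap.lineMap (basePt : ℂ) w (s : ℝ)) (s * k.1, s * k.2),
              hQK _ _ (hline s).1 (hline s).2⟩
            continuous_toFun := ?_
            source' := Subtype.ext (by
              simp [hK.incl_apply, show ((0 : ℝ), (0 : ℝ)) = 0 from rfl])
            target' := Subtype.ext (by simp [hpk]) }, fun t => ⟨⟨?_, ?_⟩, ?_⟩⟩
  · refine Continuous.subtype_mk ?_ _
    refine continuous_polar.comp (?_ : Continuous fun s : I =>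
      (AffineMap.lineMap (basePt : ℂ) w (s : ℝ), ((s : ℝ) * k.1, (s : ℝ) * k.2)))
    simp only [AffineMap.lineMap_apply_module]
    fun_prop
  · have h1 := (norm_polar (hline t).1 (t * k.1, t * k.2)).1
    have h3 := (hline t).1.1
    refine norm_pos_iff.1 (?_ : 0 < ‖(polar _ (t * k.1, t * k.2)).1‖)
    rw [h1]; linarith
  · have h1 := (norm_polar (hline t).1 (t * k.1, t * k.2)).2
    have h3 := (hline t).1.2
    refine norm_pos_iff.1 (?_ : 0 < ‖(polar _ (t * k.1, t * k.2)).2‖)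
    rw [h1]; linarith
  · exact (hU _ _ _ (hline t).1 rfl).2 (hline t).2

/-- The cover of the complement by the part outside the axes and the neighbourhoods of the axes. -/
def axisCover (K : Set (ℂ × ℂ)) : Fin 3 → Set (LinkCompl K) :=
  ![offAxes K, {p | ‖p.1.1‖ < 1}, {p | ‖p.1.2‖ < 1}]

lemma isOpen_axisCover (i : Fin 3) : IsOpen (axisCover K i) := by
  fin_cases i
  · exact (isOpen_ne_fun (by fun_prop) continuous_const).inter
      (isOpen_ne_fun (by fun_prop) continuous_const)
  · exact isOpen_lt (f := fun p : LinkCompl K => ‖p.1.1‖) (by fun_prop) continuous_const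
  · exact isOpen_lt (f := fun p : LinkCompl K => ‖p.1.2‖) (by fun_prop) continuous_const

lemma exists_mem_axisCover (p : LinkCompl K) : ∃ i, p ∈ axisCover K i := by
  by_cases h1 : p.1.1 = 0
  · exact ⟨1, by simp [axisCover, h1]⟩
  · by_cases h2 : p.1.2 = 0
    · exact ⟨2, by simp [axisCover, h2]⟩
    · exact ⟨0, h1, h2⟩

lemma IsTraced.exists_path_of_convex (hK : IsTraced K ζ) {C : Set (ℂ × ℂ)} (hC : Convex ℝ C)
    (hCK : ∀ p ∈ C, p ∉ K) (hb : polar basePt 0 ∈ C) {p : LinkCompl K} (hp : (p : ℂ × ℂ) ∈ C) :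
    ∃ δ : Path (hK.incl basePt) p, ∀ t, (δ t : ℂ × ℂ) ∈ C := by
  have hline : ∀ s : I, AffineMap.lineMap (polar basePt 0) (p : ℂ × ℂ) (s : ℝ) ∈ C := fun s =>
    hC.lineMap_mem hb hp s.2
  refine ⟨{ toFun := fun s => ⟨AffineMap.lineMap (polar basePt 0) (p : ℂ × ℂ) (s : ℝ),
              hCK _ (hline s)⟩
            continuous_toFun := ?_
            source' := Subtype.ext (by simp [hK.incl_apply])
            target' := Subtype.ext (by simp) }, hline⟩
  refine Continuous.subtype_mk ?_ _
  simp only [AffineMap.lineMap_apply_module]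
  fun_prop

/-- The intersections of two members of the cover are path connected. -/
lemma IsTraced.exists_path_axisCover (hK : IsTraced K ζ) (i j : Fin 3) {p : LinkCompl K}
    (hi : p ∈ axisCover K i) (hj : p ∈ axisCover K j) :
    ∃ δ : Path (hK.incl basePt) p, (∀ t, δ t ∈ axisCover K i) ∧ ∀ t, δ t ∈ axisCover K j := by
  wlog hij : i ≤ j generalizing i j
  · obtain ⟨δ, h1, h2⟩ := this j i hj hi (le_of_not_ge hij)
    exact ⟨δ, h2, h1⟩
  have hb := norm_polar_basePt 0
  have n1 : ∀ q : ℂ × ℂ, ‖q.1‖ < 1 → q ∉ K := fun q hq h => (hK.one_lt q h).1.not_gt hq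
  have n2 : ∀ q : ℂ × ℂ, ‖q.2‖ < 1 → q ∉ K := fun q hq h => (hK.one_lt q h).2.not_gt hq
  fin_cases i <;> fin_cases j
  · obtain ⟨δ, h⟩ := hK.exists_path_offAxes hi
    exact ⟨δ, h, h⟩
  · obtain ⟨δ, h⟩ := hK.exists_path_near_axis hi (convex_halfSpace_re_lt (-1))
      (by norm_num [basePt]) (U := axisCover K 1) (fun x w k hw hx => by
        change ‖(x : ℂ × ℂ).1‖ < 1 ↔ w.re < -1
        rw [hx, (norm_polar hw k).1]
        constructor <;> intro h <;> linarith)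
      (fun w k hw hwQ => n1 _ (by
        have h : w.re < -1 := hwQ
        rw [(norm_polar hw k).1]; linarith)) hj
    exact ⟨δ, fun t => (h t).1, fun t => (h t).2⟩
  · obtain ⟨δ, h⟩ := hK.exists_path_near_axis hi (convex_halfSpace_im_lt (-1))
      (by norm_num [basePt]) (U := axisCover K 2) (fun x w k hw hx => by
        change ‖(x : ℂ × ℂ).2‖ < 1 ↔ w.im < -1
        rw [hx, (norm_polar hw k).2]
        constructor <;> intro h <;> linarith)
      (fun w k hw hwQ => n2 _ (by
        have h : w.im < -1 := hwQ
        rw [(norm_polar hw k).2]; linarith)) hj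
    exact ⟨δ, fun t => (h t).1, fun t => (h t).2⟩
  · exact absurd hij (by decide)
  · obtain ⟨δ, h⟩ := hK.exists_path_of_convex convex_norm_fst_lt n1 hb.1 (p := p) hi
    exact ⟨δ, h, h⟩
  · obtain ⟨δ, h⟩ := hK.exists_path_of_convex (convex_norm_fst_lt.inter convex_norm_snd_lt)
      (fun q hq => n1 q hq.1) hb (p := p) ⟨hi, hj⟩
    exact ⟨δ, fun t => (h t).1, fun t => (h t).2⟩
  · exact absurd hij (by decide)
  · exact absurd hij (by decide)
  · obtain ⟨δ, h⟩ := hK.exists_path_of_convex convex_norm_snd_lt n2 hb.2 (p := p) hi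
    exact ⟨δ, h, h⟩

lemma IsTraced.pathConnectedSpace (hK : IsTraced K ζ) : PathConnectedSpace (LinkCompl K) := by
  have h : ∀ p, Joined (hK.incl basePt) p := fun p => by
    obtain ⟨i, hi⟩ := exists_mem_axisCover p
    obtain ⟨δ, -⟩ := hK.exists_path_axisCover i i hi hi
    exact ⟨δ⟩
  exact ⟨⟨hK.incl basePt⟩, fun p q => (h p).symm.trans (h q)⟩

/-- The loop of the complement given by the circle number `j` of the fibre. -/
def IsTraced.gen (hK : IsTraced K ζ) (j : Fin 3) :
    FundamentalGroup (LinkCompl K) (hK.incl basePt) :=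
  FundamentalGroup.fromPath
    ⟪(withTail (circ (admissible_radius j))).map hK.incl.continuous⟫

/-- The three circles of the fibre generate the group of the complement. -/
theorem IsTraced.eq_top (hK : IsTraced K ζ)
    (H : Subgroup (FundamentalGroup (LinkCompl K) (hK.incl basePt))) (hH : ∀ j, hK.gen j ∈ H) :
    H = ⊤ := by
  have hfib : ∀ y : Path basePt basePt,
      FundamentalGroup.fromPath ⟪y.map hK.incl.continuous⟫ ∈ H := by
    let f : FundamentalGroup Fiber leftPt →* FundamentalGroup (LinkCompl K) (hK.incl basePt) :=
      (FundamentalGroup.map hK.incl basePt).comp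
        (FundamentalGroup.fundamentalGroupMulEquivOfPath tail.symm).toMonoidHom
    have hf : ∀ q : Path leftPt leftPt, f (FundamentalGroup.fromPath ⟪q⟫) =
        FundamentalGroup.fromPath ⟪(withTail q).map hK.incl.continuous⟫ := fun q => by
      change FundamentalGroup.map hK.incl basePt
        (FundamentalGroup.fundamentalGroupMulEquivOfPath tail.symm
          (FundamentalGroup.fromPath ⟪q⟫)) = FundamentalGroup.map hK.incl basePt
        (FundamentalGroup.fromPath ⟪withTail q⟫)
      rw [mulEquivOfPath_fromPath]
      simp [withTail]
    have htop : H.comap f = ⊤ := fiber_eq_top _ fun j => by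
      rw [Subgroup.mem_comap, hf]
      exact hH j
    intro y
    let q : Path leftPt leftPt := tail.symm.trans (y.trans tail)
    have hq : FundamentalGroup.fromPath ⟪q⟫ ∈ H.comap f := htop ▸ Subgroup.mem_top _
    rw [Subgroup.mem_comap, hf] at hq
    have hqy : ⟪withTail q⟫ = ⟪y⟫ := by
      simp [withTail, q, Path.Homotopic.Quotient.trans_assoc]
    change FundamentalGroup.fromPath (Path.Homotopic.Quotient.map ⟪withTail q⟫ hK.incl) ∈ H at hq
    rwa [hqy] at hq
  refine eq_top_of_open_cover (axisCover K) isOpen_axisCover exists_mem_axisCover _ H ?_ ?_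
  · have n1 : ∀ q : ℂ × ℂ, ‖q.1‖ < 1 → q ∉ K := fun q hq h => (hK.one_lt q h).1.not_gt hq
    have n2 : ∀ q : ℂ × ℂ, ‖q.2‖ < 1 → q ∉ K := fun q hq h => (hK.one_lt q h).2.not_gt hq
    have hb := norm_polar_basePt 0
    intro i γ hγ
    fin_cases i
    · obtain ⟨y, hy⟩ := hK.exists_loop_fiber γ hγ
      rw [hy]
      exact hfib y
    · rw [mk_eq_mk_of_convex convex_norm_fst_lt n1 γ (Path.refl _) hγ fun _ => hb.1]
      exact H.one_mem
    · rw [mk_eq_mk_of_convex convex_norm_snd_lt n2 γ (Path.refl _) hγ fun _ => hb.2]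
      exact H.one_mem
  · intro i j p hi hj
    obtain ⟨δ, h1, h2⟩ := hK.exists_path_axisCover i j hi hj
    refine ⟨δ, δ, h1, h2, ?_⟩
    rw [Path.Homotopic.Quotient.trans_symm]
    exact H.one_mem

end Traced

/-! ### The relations -/

section Traced

variable {K : Set (ℂ × ℂ)} {ζ : C(ℝ × ℝ, OrderedConf 3)}

lemma IsTraced.map_fromPath (hK : IsTraced K ζ) (y : Path basePt basePt) :
    FundamentalGroup.map hK.incl basePt (FundamentalGroup.fromPath ⟪y⟫) =
      FundamentalGroup.fromPath ⟪y.map hK.incl.continuous⟫ := rfl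

/-- If a loop in the fibre and its full twist along the circle number `k` have homotopic images in
the complement, then the corresponding elements commute. -/
lemma IsTraced.commute_gen (hK : IsTraced K ζ) {j k : Fin 3} (hjk : j ≤ k)
    (h : ∀ y : Path basePt basePt, (∀ t, (withTail (circ (admissible_radius j)) t : ℂ) =
      twist (radius k - 5 / 6 : ℝ) (radius k) 2 (y t)) → ⟪y.map hK.incl.continuous⟫ =
        ⟪(withTail (circ (admissible_radius j))).map hK.incl.continuous⟫) :
    Commute (hK.gen k) (hK.gen j) := by
  obtain ⟨y, hy, hy'⟩ := exists_untwisted (admissible_radius k) (circ (admissible_radius j))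
    (circ_nested hjk)
  have h1 : FundamentalGroup.fromPath ⟪y⟫ =
      FundamentalGroup.fromPath ⟪withTail (circ (admissible_radius k))⟫ *
        (FundamentalGroup.fromPath ⟪withTail (circ (admissible_radius j))⟫ *
        (FundamentalGroup.fromPath ⟪withTail (circ (admissible_radius k))⟫)⁻¹) := hy'
  have h2 := congrArg (FundamentalGroup.map hK.incl basePt) h1
  rw [map_mul, map_mul, map_inv, hK.map_fromPath, hK.map_fromPath, hK.map_fromPath, h y hy] at h2
  change hK.gen j = hK.gen k * (hK.gen j * (hK.gen k)⁻¹) at h2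
  rw [← mul_assoc, eq_mul_inv_iff_mul_eq] at h2
  exact h2.symm

lemma polar_eq_of_int (w : ℂ) (p q : ℤ) : polar w (p, q) = polar w 0 := by
  simp [polar, turn_eq_one_iff.2 ⟨p, rfl⟩, turn_eq_one_iff.2 ⟨q, rfl⟩]

/-- The braid `Δ²` is realized by a full twist along the outermost circle. -/
theorem IsTraced.commute_gen_two (hK : IsTraced K ζ) (β : Path (baseConf 3) (baseConf 3))
    (hβ : braidClass β = garside ^ 2) (hβζ : ∀ t : I, β t = Quotient.mk _ (ζ (0, t)))
    (j : Fin 3) : Commute (hK.gen 2) (hK.gen j) := by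
  refine hK.commute_gen (Fin.le_last j) fun y hy => ?_
  refine hK.mk_map_eq realizes_garside.sq_of_twist ⟨fun t : I => ((0 : ℝ), (t : ℝ)), by fun_prop⟩
    (by simp) (fun w => ?_) β hβ hβζ y _ fun t => ?_
  · simpa using polar_eq_of_int w 0 1
  · rw [hy t, show radius 2 = 5 / 6 from rfl]
    change _ = twist 0 (5 / 6) 2 (y t)
    norm_num

/-- The braid `σ₁² σ₂²ⁿ` is realized by a full twist along the middle circle, followed by a
homeomorphism supported near the second and third points, and this does not move the innermost
circle. -/
theorem IsTraced.commute_gen_one (hK : IsTraced K ζ) (n : ℤ) (α : Path (baseConf 3) (baseConf 3))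
    (hα : braidClass α = sigma1 ^ 2 * sigma2 ^ (2 * n))
    (hαζ : ∀ t : I, α t = Quotient.mk _ (ζ (t, 0))) : Commute (hK.gen 1) (hK.gen 0) := by
  obtain ⟨ψ, hψ, -, hψ'⟩ := exists_realizes_sigma2_zpow n
  refine hK.commute_gen (by decide) fun y hy => ?_
  refine hK.mk_map_eq (realizes_sigma1.sq_of_twist.mul hψ)
    ⟨fun t : I => ((t : ℝ), (0 : ℝ)), by fun_prop⟩
    (by simp) (fun w => ?_) α hα hαζ y _ fun t => ?_
  · simpa using polar_eq_of_int w 1 0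
  · have h1 : (((radius 1 - 5 / 6 : ℝ)) : ℂ) = -1 / 3 := by
      rw [show radius 1 = 1 / 2 from rfl]; push_cast; norm_num
    have h2 := hy t
    rw [h1, show radius 1 = 1 / 2 from rfl] at h2
    rw [Homeomorph.trans_apply]
    change _ = ψ (twist (-1 / 3) (1 / 2) 2 (y t))
    rw [← h2, hψ' _ (le_norm_withTail_sub t)]

end Traced

/-! ### Winding numbers -/

/-- The winding number, multiplied by `2 * π * I`, of a nowhere zero function along loops. -/
lemma exists_winding {X : Type*} [TopologicalSpace X] (x : X) (F : C(X, ℂ)) (hF : ∀ y, F y ≠ 0) :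
    ∃ φ : FundamentalGroup X x →* Multiplicative ℂ, ∀ (γ : Path x x) (L : C(I, ℂ)),
      (∀ t, Complex.exp (L t) = F (γ t)) →
        φ (FundamentalGroup.fromPath ⟪γ⟫) = Multiplicative.ofAdd (L 1 - L 0) := by
  let F' : C(X, {z : ℂ // z ≠ 0}) := ⟨fun y => ⟨F y, hF y⟩, F.continuous.subtype_mk _⟩
  have hp := Complex.isAddQuotientCoveringMap_exp
  let G := AddSubgroup.zmultiples (2 * (Real.pi : ℂ) * Complex.I)
  let e : (fun z : ℂ => (⟨Complex.exp z, Complex.exp_ne_zero z⟩ : {z : ℂ // z ≠ 0})) ⁻¹' {F' x} :=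
    ⟨Complex.log (F x), Subtype.ext (Complex.exp_log (hF x))⟩
  let φ : FundamentalGroup X x →* Multiplicative ℂ :=
    (AddMonoidHom.toMultiplicative G.subtype).comp
      ((MulOpposite.opMulEquiv (M := Multiplicative G)).symm.toMonoidHom.comp
        ((hp.fundamentalGroupToMulOpposite e).comp (FundamentalGroup.map F' x)))
  refine ⟨φ, fun γ L hL => ?_⟩
  have hc : Complex.exp (Complex.log (F x) - L 0) = 1 := by
    rw [Complex.exp_sub, hL, γ.source, Complex.exp_log (hF x), div_self (hF x)]
  let Γ : Path (Complex.log (F x)) (L 1 + (Complex.log (F x) - L 0)) :=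
    { toFun := fun t => L t + (Complex.log (F x) - L 0)
      continuous_toFun := by fun_prop
      source' := by ring
      target' := rfl }
  have hΓ : ∀ t, Complex.exp (Γ t) = F (γ t) := fun t => by
    change Complex.exp (L t + _) = _
    rw [Complex.exp_add, hc, mul_one, hL]
  let e' : (fun z : ℂ => (⟨Complex.exp z, Complex.exp_ne_zero z⟩ : {z : ℂ // z ≠ 0})) ⁻¹' {F' x} :=
    ⟨L 1 + (Complex.log (F x) - L 0), Subtype.ext (by
      have := hΓ 1
      rwa [γ.target, Γ.target] at this)⟩
  have hmon : hp.isCoveringMap.monodromy (FundamentalGroup.map F' x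
      (FundamentalGroup.fromPath ⟪γ⟫)) e = e' := by
    refine hp.isCoveringMap.monodromy_eq_of_map_eq (ex := e) (ey := e') ⟪Γ⟫ ?_
    refine congrArg Path.Homotopic.Quotient.mk (?_ : Γ.map hp.isCoveringMap.continuous =
      (γ.map F'.continuous).cast e.2 e'.2)
    ext t
    exact hΓ t
  have h := hp.unop_fundamentalGroupToMulOpposite_smul (e := e)
    (γ := FundamentalGroup.map F' x (FundamentalGroup.fromPath ⟪γ⟫))
  rw [hmon] at h
  have hval : (Multiplicative.toAdd (φ (FundamentalGroup.fromPath ⟪γ⟫))) + Complex.log (F x) =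
      L 1 + (Complex.log (F x) - L 0) := h
  apply Multiplicative.toAdd.injective
  rw [toAdd_ofAdd]
  linear_combination hval

/-- A group generated by three commuting elements is free abelian of rank three if there are
homomorphisms with a unitriangular matrix of values on the generators. -/
lemma nonempty_mulEquiv_of_triangular {G : Type*} [Group G] (y : Fin 3 → G)
    (h01 : Commute (y 1) (y 0)) (h2 : ∀ j, Commute (y 2) (y j))
    (htop : ∀ H : Subgroup G, (∀ j, y j ∈ H) → H = ⊤) {c : ℂ} (hc : c ≠ 0)
    (φ : Fin 3 → G →* Multiplicative ℂ)
    (hφ : ∀ i j, φ i (y j) = Multiplicative.ofAdd (if i ≤ j then c else 0)) :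
    Nonempty (G ≃* Multiplicative (ℤ × ℤ × ℤ)) := by
  let f : Multiplicative (ℤ × ℤ × ℤ) →* G :=
    { toFun := fun k => y 0 ^ (Multiplicative.toAdd k).1 * y 1 ^ (Multiplicative.toAdd k).2.1 *
        y 2 ^ (Multiplicative.toAdd k).2.2
      map_one' := by simp
      map_mul' := fun k l => by
        have c10 := (h01.symm.zpow_zpow (Multiplicative.toAdd l).1 (Multiplicative.toAdd k).2.1).eq
        have c20 := ((h2 0).symm.zpow_zpow (Multiplicative.toAdd l).1
          (Multiplicative.toAdd k).2.2).eq
        have c21 := ((h2 1).symm.zpow_zpow (Multiplicative.toAdd l).2.1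
          (Multiplicative.toAdd k).2.2).eq
        simp only [toAdd_mul, Prod.fst_add, Prod.snd_add, zpow_add]
        generalize y 0 ^ (Multiplicative.toAdd k).1 = p at *
        generalize y 0 ^ (Multiplicative.toAdd l).1 = p' at *
        generalize y 1 ^ (Multiplicative.toAdd k).2.1 = q at *
        generalize y 1 ^ (Multiplicative.toAdd l).2.1 = q' at *
        generalize y 2 ^ (Multiplicative.toAdd k).2.2 = r at *
        generalize y 2 ^ (Multiplicative.toAdd l).2.2 = r' at *
        calc p * p' * (q * q') * (r * r') = p * (p' * q) * (q' * r) * r' := by simp only [mul_assoc]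
          _ = p * (q * p') * (r * q') * r' := by rw [c10, c21]
          _ = p * q * (p' * r) * q' * r' := by simp only [mul_assoc]
          _ = p * q * (r * p') * q' * r' := by rw [c20]
          _ = _ := by simp only [mul_assoc] }
  have hf : ∀ k, f k = y 0 ^ (Multiplicative.toAdd k).1 * y 1 ^ (Multiplicative.toAdd k).2.1 *
        y 2 ^ (Multiplicative.toAdd k).2.2 := fun _ => rfl
  have hval : ∀ i k, Multiplicative.toAdd (φ i (f k)) =
      (Multiplicative.toAdd k).1 * (if i ≤ 0 then c else 0) +
      (Multiplicative.toAdd k).2.1 * (if i ≤ 1 then c else 0) +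
      (Multiplicative.toAdd k).2.2 * (if i ≤ 2 then c else 0) := fun i k => by
    rw [hf]
    simp only [map_mul, map_zpow, hφ, toAdd_mul, toAdd_zpow, toAdd_ofAdd, zsmul_eq_mul]
  refine ⟨(MulEquiv.ofBijective f ⟨?_, ?_⟩).symm⟩
  · rw [injective_iff_map_eq_one]
    intro k hk
    have hv : ∀ i, Multiplicative.toAdd (φ i (f k)) = 0 := fun i => by rw [hk, map_one]; rfl
    simp only [hval] at hv
    have v0 := hv 0
    have v1 := hv 1
    have v2 := hv 2
    simp [hc] at v2
    simp [hc, v2] at v1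
    simp [hc, v2, v1] at v0
    apply Multiplicative.toAdd.injective
    exact Prod.ext v0 (Prod.ext v1 v2)
  · rw [← MonoidHom.range_eq_top]
    refine htop _ fun j => ?_
    fin_cases j
    · exact ⟨Multiplicative.ofAdd (1, 0, 0), by simp [hf]⟩
    · exact ⟨Multiplicative.ofAdd (0, 1, 0), by simp [hf]⟩
    · exact ⟨Multiplicative.ofAdd (0, 0, 1), by simp [hf]⟩

/-- A continuous logarithm along the circle of radius `R` about `-d`: it changes by `2 * π * I` if `0`
lies inside the circle, and it is periodic otherwise. The term that does not dominate is split off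
as a factor near `1`, with its principal logarithm. -/
lemma exists_log_circle {R : ℝ} (hR : 0 < R) {d : ℂ} (hd : ‖d‖ ≠ R) :
    ∃ L : C(I, ℂ), (∀ t, Complex.exp (L t) = -(R * turn t) - d) ∧
      L 1 - L 0 = if ‖d‖ < R then 2 * Real.pi * Complex.I else 0 := by
  have hslit : ∀ z : ℂ, ‖z‖ < 1 → 1 + z ∈ Complex.slitPlane := fun z hz =>
    Complex.mem_slitPlane_of_norm_lt_one hz
  have hR' : (R : ℂ) ≠ 0 := by exact_mod_cast hR.ne'
  have ht0 : ∀ t, turn t ≠ 0 := fun t => Complex.exp_ne_zero _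
  have t1 : turn 1 = 1 := turn_eq_one_iff.2 ⟨1, by simp⟩
  split_ifs with h
  · have hlt : ∀ t, ‖d / (R * turn t)‖ < 1 := fun t => by
      rw [norm_div, norm_mul, norm_turn, Complex.norm_real, Real.norm_eq_abs, abs_of_pos hR,
        mul_one, div_lt_one hR]
      exact h
    refine ⟨⟨fun t => Complex.log (-R) + (((2 * Real.pi * t : ℝ) : ℂ) * Complex.I) +
      Complex.log (1 + d / (R * turn t)), ?_⟩, fun t => ?_, ?_⟩
    · refine Continuous.add (by fun_prop) (Continuous.clog ?_ fun t => hslit _ (hlt _))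
      refine continuous_const.add (Continuous.div continuous_const (by fun_prop) fun t => ?_)
      exact mul_ne_zero hR' (ht0 _)
    · simp only [ContinuousMap.coe_mk]
      rw [Complex.exp_add, Complex.exp_add, Complex.exp_log (neg_ne_zero.2 hR'),
        Complex.exp_log (Complex.slitPlane_ne_zero (hslit _ (hlt _)))]
      change -(R : ℂ) * turn t * _ = _
      have := ht0 t
      field_simp
      ring
    · simp [t1]
  · have hgt : R < ‖d‖ := lt_of_le_of_ne (not_lt.1 h) (Ne.symm hd)
    have hd0 : d ≠ 0 := norm_pos_iff.1 (hR.trans hgt)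
    have hlt : ∀ t, ‖R * turn t / d‖ < 1 := fun t => by
      rw [norm_div, norm_mul, norm_turn, Complex.norm_real, Real.norm_eq_abs, abs_of_pos hR,
        mul_one, div_lt_one (hR.trans hgt)]
      exact hgt
    refine ⟨⟨fun t => Complex.log (-d) + Complex.log (1 + R * turn t / d), ?_⟩, fun t => ?_, ?_⟩
    · refine Continuous.add continuous_const ?_
      exact Continuous.clog (by fun_prop) fun t => hslit _ (hlt _)
    · simp only [ContinuousMap.coe_mk]
      rw [Complex.exp_add, Complex.exp_log (neg_ne_zero.2 hd0),
        Complex.exp_log (Complex.slitPlane_ne_zero (hslit _ (hlt _)))]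
      field_simp
      ring
    · simp [t1]

/-! ### Winding numbers about the components of the link -/

/-- The point of the quadrant given by the two radii. -/
def radial (p : ℂ × ℂ) : ℂ := ((‖p.1‖ - 2 : ℝ) : ℂ) + ((‖p.2‖ - 2 : ℝ) : ℂ) * Complex.I

@[fun_prop]
lemma continuous_radial : Continuous radial := by
  unfold radial
  fun_prop

lemma radial_re (p : ℂ × ℂ) : (radial p).re = ‖p.1‖ - 2 := by simp [radial]

lemma radial_im (p : ℂ × ℂ) : (radial p).im = ‖p.2‖ - 2 := by simp [radial]

lemma radial_polar {w : ℂ} (hw : w ∈ quadrant) (k : ℝ × ℝ) : radial (polar w k) = w := by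
  obtain ⟨h1, h2⟩ := norm_polar hw k
  apply Complex.ext
  · rw [radial_re, h1]; ring
  · rw [radial_im, h2]; ring

lemma two_le_norm_radial {p : ℂ × ℂ} (h : p.1 = 0 ∨ p.2 = 0) : 2 ≤ ‖radial p‖ := by
  rcases h with h | h
  · have h1 := Complex.abs_re_le_norm (radial p)
    rw [radial_re, h] at h1
    norm_num at h1
    exact h1
  · have h1 := Complex.abs_im_le_norm (radial p)
    rw [radial_im, h] at h1
    norm_num at h1
    exact h1

/-- The angles of a point, in turns, chosen near the angles `k`. -/
def anglesNear (k : ℝ × ℝ) (p : ℂ × ℂ) : ℝ × ℝ :=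
  (k.1 + (p.1 * turn (-k.1)).arg / (2 * Real.pi), k.2 + (p.2 * turn (-k.2)).arg / (2 * Real.pi))

lemma norm_mul_turn_arg (z : ℂ) (u : ℝ) :
    (‖z‖ : ℝ) * turn (u + (z * turn (-u)).arg / (2 * Real.pi)) = z := by
  have h : turn u * turn (-u) = 1 := by rw [← turn_add]; simp
  have h1 : turn ((z * turn (-u)).arg / (2 * Real.pi)) =
      Complex.exp ((z * turn (-u)).arg * Complex.I) := by
    rw [turn, mul_div_cancel₀ _ (by positivity : (2 * Real.pi : ℝ) ≠ 0)]
  have h2 := Complex.norm_mul_exp_arg_mul_I (z * turn (-u))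
  rw [norm_mul, norm_turn, mul_one] at h2
  rw [turn_add, h1, mul_left_comm, h2]
  linear_combination z * h

lemma polar_anglesNear (k : ℝ × ℝ) (p : ℂ × ℂ) : polar (radial p) (anglesNear k p) = p := by
  refine Prod.ext ?_ ?_
  · change ((2 + (radial p).re : ℝ) : ℂ) * turn _ = p.1
    rw [radial_re, add_sub_cancel]
    exact norm_mul_turn_arg _ _
  · change ((2 + (radial p).im : ℝ) : ℂ) * turn _ = p.2
    rw [radial_im, add_sub_cancel]
    exact norm_mul_turn_arg _ _

lemma continuousAt_anglesNear {w : ℂ} (hw : w ∈ quadrant) (k : ℝ × ℝ) :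
    ContinuousAt (anglesNear k) (polar w k) := by
  have key : ∀ (r u : ℝ), 0 < r → (r * turn u) * turn (-u) ∈ Complex.slitPlane := by
    intro r u hr
    rw [mul_assoc, ← turn_add, add_neg_cancel, turn_zero, mul_one]
    exact Complex.ofReal_mem_slitPlane.2 hr
  have h1 := hw.1
  have h2 := hw.2
  refine ContinuousAt.prodMk ?_ ?_
  · refine continuousAt_const.add (ContinuousAt.div_const ?_ _)
    have harg := Complex.continuousAt_arg (key (2 + w.re) k.1 (by linarith))
    exact ContinuousAt.comp (x := polar w k) (f := fun p : ℂ × ℂ => p.1 * turn (-k.1)) harg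
      (by fun_prop)
  · refine continuousAt_const.add (ContinuousAt.div_const ?_ _)
    have harg := Complex.continuousAt_arg (key (2 + w.im) k.2 (by linarith))
    exact ContinuousAt.comp (x := polar w k) (f := fun p : ℂ × ℂ => p.2 * turn (-k.2)) harg
      (by fun_prop)

/-- The angles of a point are determined up to integers. -/
lemma exists_int_of_polar_eq {w : ℂ} (hw : w ∈ quadrant) {k l : ℝ × ℝ}
    (h : polar w k = polar w l) : ∃ p q : ℤ, k.1 = l.1 + p ∧ k.2 = l.2 + q := by
  have key : ∀ r : ℝ, 0 < r → ∀ u v : ℝ, (r : ℂ) * turn u = r * turn v → ∃ p : ℤ, u = v + p := by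
    intro r hr u v huv
    have hr' : (r : ℂ) ≠ 0 := by exact_mod_cast hr.ne'
    have h1 : turn (u - v) = 1 := by
      rw [sub_eq_add_neg, turn_add, mul_left_cancel₀ hr' huv, ← turn_add]
      simp
    obtain ⟨p, hp⟩ := turn_eq_one_iff.1 h1
    exact ⟨p, by linarith⟩
  have h1 := hw.1
  have h2 := hw.2
  obtain ⟨p, hp⟩ := key _ (by linarith) _ _ (congrArg Prod.fst h)
  obtain ⟨q, hq⟩ := key _ (by linarith) _ _ (congrArg Prod.snd h)
  exact ⟨p, q, hp, hq⟩

section Traced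

variable {K : Set (ℂ × ℂ)} {ζ : C(ℝ × ℝ, OrderedConf 3)}

/-- A realization of a pure braid by a homeomorphism shows that the points of the configuration
return to their places. -/
lemma IsTraced.apply_one (hK : IsTraced K ζ) {g : BraidGroup 3} {ψ : ℂ ≃ₜ ℂ} (hg : Realizes g ψ)
    (hψ : ∀ i, ψ (basePos 3 i) = basePos 3 i) (c : C(I, ℝ × ℝ)) (hc0 : c 0 = 0)
    (α : Path (baseConf 3) (baseConf 3)) (hα : braidClass α = g)
    (hαζ : ∀ t, α t = Quotient.mk _ (ζ (c t))) : ζ (c 1) = ζ 0 := by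
  obtain ⟨Ψ, -, h0, h1, -, γ, ω, hγg, hγ, hω⟩ := hg.exists_ordered
  have hω0 : ω 0 = ζ (c 0) := coords_ext fun i => by rw [hω, h0, hc0, hK.coords_zero]
  have hω1 : ω 1 = ζ 0 := coords_ext fun i => by rw [hω, h1, hψ, hK.coords_zero]
  have hhom : γ.Homotopic α := by
    rw [← Path.Homotopic.Quotient.eq]
    exact MulOpposite.op_injective (hγg.trans hα.symm)
  obtain ⟨G, -, G1, -, G3⟩ := homotopic_of_homotopic_mk hhom (ω := ω) (ω' := ζ.comp c) hω0 hγ hαζ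
  rw [← hω1, ← G3 1, G1]
  rfl

/-- The motion of the configurations is doubly periodic if it takes the same value at the
corners of a unit square. -/
lemma IsTraced.add_int (hK : IsTraced K ζ) (h1 : ζ (1, 0) = ζ 0) (h2 : ζ (0, 1) = ζ 0)
    (p q : ℤ) (u v : ℝ) : ζ (u + p, v + q) = ζ (u, v) := by
  have key : ∀ l : ℝ × ℝ, (∀ w k, polar w (k + l) = polar w k) → ζ l = ζ 0 →
      ∀ k, ζ (k + l) = ζ k := by
    intro l hl hζl k
    have h := (isCoveringMap_mk 3).eq_of_comp_eq (g₁ := fun k => ζ (k + l)) (g₂ := ζ)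
      (by fun_prop) (by fun_prop) (by
        funext k
        apply Conf.points_injective
        apply Subtype.val_injective.image_injective
        have hmem : ∀ k, Subtype.val '' Conf.points (Quotient.mk _ (ζ k)) =
            {w | ‖w‖ < 1 ∧ polar w k ∈ K} := by
          intro k
          rw [Conf.points_mk, ← range_comp]
          ext w
          constructor
          · rintro ⟨i, rfl⟩
            have hlt := norm_coords_lt (ζ k) i
            exact ⟨hlt, (hK.mem_iff _ (mem_quadrant_of_norm_le hlt.le) k).2 ⟨i, rfl⟩⟩
          · rintro ⟨hw, hwK⟩
            obtain ⟨i, hi⟩ := (hK.mem_iff _ (mem_quadrant_of_norm_le hw.le) k).1 hwK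
            exact ⟨i, hi.symm⟩
        simp only [Function.comp_apply]
        rw [hmem, hmem]
        simp only [hl]) 0 (by simpa using hζl)
    exact congrFun h k
  have k1 : Function.Periodic (fun u => ζ (u, v)) 1 := fun u => by
    have h := key (1, 0) (fun w k => by
      have := turn_eq_one_iff.2 ⟨1, rfl⟩
      simp only [Int.cast_one] at this
      simp [polar, turn_add, this]) h1 (u, v)
    simpa using h
  have k2 : Function.Periodic (fun v => ζ (u + p, v)) 1 := fun v => by
    have h := key (0, 1) (fun w k => by
      have := turn_eq_one_iff.2 ⟨1, rfl⟩
      simp only [Int.cast_one] at this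
      simp [polar, turn_add, this]) h2 (u + p, v)
    simpa using h
  have e1 := k1.int_mul p u
  have e2 := k2.int_mul q v
  simp only [mul_one] at e1 e2
  rw [e2, e1]

/-- Doubly periodic motions depend only on the point with the given angles. -/
lemma eq_of_polar_eq (hper : ∀ (p q : ℤ) (u v : ℝ), ζ (u + p, v + q) = ζ (u, v)) {w : ℂ}
    (hw : w ∈ quadrant) {k l : ℝ × ℝ} (h : polar w k = polar w l) : ζ k = ζ l := by
  obtain ⟨p, q, hp, hq⟩ := exists_int_of_polar_eq hw h
  rw [← hper p q l.1 l.2, ← hp, ← hq]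

/-- The position of a point of `ℂ × ℂ` relative to the component number `i` of the traced set. Far
from the solid torus, this is the position relative to its core. -/
def relPos (ζ : C(ℝ × ℝ, OrderedConf 3)) (i : Fin 3) (p : ℂ × ℂ) : ℂ :=
  radial p - damp 1 ‖radial p‖ * coords (ζ (anglesNear 0 p)) i

lemma relPos_polar (hper : ∀ (p q : ℤ) (u v : ℝ), ζ (u + p, v + q) = ζ (u, v)) (i : Fin 3) {w : ℂ}
    (hw : w ∈ quadrant) (k : ℝ × ℝ) :
    relPos ζ i (polar w k) = w - damp 1 ‖w‖ * coords (ζ k) i := by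
  have h := polar_anglesNear 0 (polar w k)
  rw [radial_polar hw] at h
  rw [relPos, radial_polar hw, eq_of_polar_eq hper hw h]

lemma radial_mem_quadrant {p : ℂ × ℂ} (h1 : p.1 ≠ 0) (h2 : p.2 ≠ 0) : radial p ∈ quadrant := by
  have h1 := norm_pos_iff.2 h1
  have h2 := norm_pos_iff.2 h2
  constructor
  · rw [radial_re]; linarith
  · rw [radial_im]; linarith

lemma continuous_relPos (hper : ∀ (p q : ℤ) (u v : ℝ), ζ (u + p, v + q) = ζ (u, v)) (i : Fin 3) :
    Continuous (relPos ζ i) := by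
  rw [continuous_iff_continuousAt]
  intro p
  by_cases hp : p.1 = 0 ∨ p.2 = 0
  · have hev : relPos ζ i =ᶠ[𝓝 p] radial := by
      have h : ∀ᶠ q in 𝓝 p, 1 + 1 / 12 < ‖radial q‖ :=
        (continuous_radial.norm.continuousAt (x := p)).eventually_const_lt
          (lt_of_lt_of_le (by norm_num) (two_le_norm_radial hp))
      filter_upwards [h] with q hq
      rw [relPos, damp_of_ge hq.le]
      simp
    exact (continuous_radial.continuousAt).congr hev.symm
  · push Not at hp
    have hpk := polar_anglesNear 0 p
    set k := anglesNear 0 p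
    have hev : relPos ζ i =ᶠ[𝓝 p]
        fun q => radial q - damp 1 ‖radial q‖ * coords (ζ (anglesNear k q)) i := by
      have h1 : ∀ᶠ q : ℂ × ℂ in 𝓝 p, q.1 ≠ 0 := (continuous_fst.continuousAt).eventually_ne hp.1
      have h2 : ∀ᶠ q : ℂ × ℂ in 𝓝 p, q.2 ≠ 0 := (continuous_snd.continuousAt).eventually_ne hp.2
      filter_upwards [h1, h2] with q hq1 hq2
      conv_lhs => rw [← polar_anglesNear k q]
      rw [relPos_polar hper i (radial_mem_quadrant hq1 hq2)]
    refine ContinuousAt.congr ?_ hev.symm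
    have hk : ContinuousAt (anglesNear k) p := by
      have h := continuousAt_anglesNear (radial_mem_quadrant hp.1 hp.2) k
      rwa [hpk] at h
    have hζ : ContinuousAt (fun q => coords (ζ (anglesNear k q)) i) p := by
      have h : Continuous fun l => coords (ζ l) i := by fun_prop
      exact h.continuousAt.comp hk
    have hd : ContinuousAt (fun q => ((damp 1 ‖radial q‖ : ℝ) : ℂ)) p := by fun_prop
    exact continuous_radial.continuousAt.sub (hd.mul hζ)

lemma IsTraced.relPos_ne_zero (hK : IsTraced K ζ) {p : ℂ × ℂ} (hp : p ∉ K) (i : Fin 3) :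
    relPos ζ i p ≠ 0 := by
  intro h
  rw [relPos, sub_eq_zero] at h
  have hlt := norm_coords_lt (ζ (anglesNear 0 p)) i
  rcases le_or_gt ‖radial p‖ 1 with h1 | h1
  · have hq : p.1 ≠ 0 ∧ p.2 ≠ 0 := by
      constructor <;> intro h0
      · linarith [two_le_norm_radial (p := p) (Or.inl h0)]
      · linarith [two_le_norm_radial (p := p) (Or.inr h0)]
    rw [damp_of_le h1, Complex.ofReal_one, one_mul] at h
    refine hp ?_
    rw [← polar_anglesNear 0 p, hK.mem_iff _ (radial_mem_quadrant hq.1 hq.2)]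
    exact ⟨i, h⟩
  · have hd : |damp 1 ‖radial p‖| ≤ 1 := by
      unfold damp
      rw [abs_of_nonneg (le_max_left _ _)]
      exact max_le zero_le_one (min_le_left _ _)
    have h2 := congrArg norm h
    rw [norm_mul, Complex.norm_real, Real.norm_eq_abs] at h2
    have h3 := mul_le_mul hd hlt.le (norm_nonneg _) zero_le_one
    linarith

lemma norm_basePos_sub_lt_iff (i j : Fin 3) :
    ‖basePos 3 i - (radius j - 5 / 6 : ℝ)‖ < radius j ↔ i ≤ j := by
  obtain ⟨h0, h1, h2⟩ := pt_values
  rw [basePos_eq_pt, ← Complex.ofReal_sub, Complex.norm_real, Real.norm_eq_abs, abs_lt]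
  fin_cases i <;> fin_cases j <;>
    simp only [radius, Fin.zero_eta, Fin.mk_one, Fin.reduceFinMk, h0, h1, h2, Matrix.cons_val] <;>
    norm_num <;> decide

/-- The loop number `j` winds once around the components up to number `j`. -/
theorem IsTraced.exists_winding_gen (hK : IsTraced K ζ)
    (hper : ∀ (p q : ℤ) (u v : ℝ), ζ (u + p, v + q) = ζ (u, v)) (i : Fin 3) :
    ∃ φ : FundamentalGroup (LinkCompl K) (hK.incl basePt) →* Multiplicative ℂ, ∀ j,
      φ (hK.gen j) = Multiplicative.ofAdd (if i ≤ j then 2 * Real.pi * Complex.I else 0) := by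
  let F : C(LinkCompl K, ℂ) := ⟨fun p => relPos ζ i p, (continuous_relPos hper i).comp
    continuous_subtype_val⟩
  have hF : ∀ p, F p ≠ 0 := fun p => hK.relPos_ne_zero p.2 i
  obtain ⟨φ, hφ⟩ := exists_winding (hK.incl basePt) F hF
  refine ⟨φ, fun j => ?_⟩
  have hne : ‖basePos 3 i - (radius j - 5 / 6 : ℝ)‖ ≠ radius j := by
    rcases (admissible_radius j).annulus i with h | h
    · exact h.ne
    · intro h'
      rw [h'] at h
      linarith
  obtain ⟨L, hL, hL1⟩ := exists_log_circle (admissible_radius j).pos hne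
  have hLF : ∀ t, Complex.exp (L t) = F (hK.incl (circ (admissible_radius j) t)) := fun t => by
    have hnorm : ‖(circ (admissible_radius j) t : ℂ)‖ ≤ 1 := by
      have h := circ_nested (Fin.le_last j) t
      rw [show radius (Fin.last 2) = 5 / 6 from rfl, sub_self, Complex.ofReal_zero, sub_zero] at h
      linarith
    change _ = relPos ζ i (polar (circ (admissible_radius j) t) 0)
    rw [relPos_polar hper i (circ (admissible_radius j) t).2.1, damp_of_le hnorm, hL,
      hK.coords_zero]
    change _ = (circleMap (admissible_radius j) t : ℂ) - _
    rw [circleMap_apply, turn]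
    push_cast
    ring
  -- a logarithm along the tail
  obtain ⟨T, hT, -⟩ := Complex.isCoveringMap_exp.exists_path_lifts
    ⟨fun t => ⟨F (hK.incl (tail t)), hF _⟩, by fun_prop⟩
    (Complex.log (F (hK.incl (tail 0)))) (Subtype.ext (Complex.exp_log (hF _)).symm)
  have hTF : ∀ t, Complex.exp (T t) = F (hK.incl (tail t)) := fun t =>
    congrArg Subtype.val (congrFun hT t)
  have hc : Complex.exp (T 1 - L 0) = 1 := by
    rw [Complex.exp_sub, hTF, hLF, tail.target, (circ (admissible_radius j)).source,
      div_self (hF _)]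
  have hm : Complex.exp (L 1 - L 0) = 1 := by
    rw [Complex.exp_sub, hLF, hLF, Path.target, Path.source, div_self (hF _)]
  let A : Path (T 0) (T 1) := ⟨T, rfl, rfl⟩
  let B : Path (T 1) (T 1 + (L 1 - L 0)) :=
    ⟨⟨fun t => L t + (T 1 - L 0), by fun_prop⟩, by simp, by simp; ring⟩
  let C : Path (T 1 + (L 1 - L 0)) (T 0 + (L 1 - L 0)) :=
    ⟨⟨fun t => T (σ t) + (L 1 - L 0), by fun_prop⟩, by simp, by simp⟩
  have hlift : ∀ t, Complex.exp (A.trans (B.trans C) t) =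
      F ((withTail (circ (admissible_radius j))).map hK.incl.continuous t) := fun t => by
    simp only [withTail, Path.map_coe, Function.comp_apply, Path.trans_apply]
    split_ifs
    · exact hTF _
    · change Complex.exp (L _ + (T 1 - L 0)) = _
      rw [Complex.exp_add, hc, mul_one]
      exact hLF _
    · change Complex.exp (T _ + (L 1 - L 0)) = _
      rw [Complex.exp_add, hm, mul_one]
      exact hTF _
  have h := hφ _ (A.trans (B.trans C) : C(I, ℂ)) hlift
  refine h.trans (congrArg Multiplicative.ofAdd ?_)
  change A.trans (B.trans C) 1 - A.trans (B.trans C) 0 = _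
  rw [Path.target, Path.source, add_sub_cancel_left, hL1]
  simp only [norm_basePos_sub_lt_iff]

end Traced

/-! ### Existence -/

/-- The rotation of the disk by an element of the unit circle. -/
def rotDisk (f : Circle) (z : Disk) : Disk := ⟨f * z.1, by
  rw [norm_mul, Circle.norm_coe, one_mul]
  exact z.2⟩

lemma rotDisk_injective (f : Circle) : Function.Injective (rotDisk f) := fun _ _ h =>
  Subtype.ext (mul_left_cancel₀ f.coe_ne_zero (congrArg Subtype.val h))

/-- The rotation of an unordered configuration. -/
def rotConf {m : ℕ} (f : Circle) : Conf m → Conf m :=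
  Quotient.map (fun x => ⟨rotDisk f ∘ x.1, (rotDisk_injective f).comp x.2⟩) (by
    rintro x y ⟨τ, h⟩
    exact ⟨τ, fun j => by simp [h]⟩)

lemma rotConf_one {m : ℕ} (c : Conf m) : rotConf 1 c = c := by
  induction c using Quotient.inductionOn with | _ x
  change Quotient.mk _ _ = _
  congr 1
  apply Subtype.ext
  funext i
  apply Subtype.ext
  simp [rotDisk]

lemma continuous_rotConf (m : ℕ) : Continuous fun p : Circle × Conf m => rotConf p.1 p.2 := by
  have hmk : IsOpenQuotientMap (Quotient.mk (confSetoid m)) :=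
    ⟨Quotient.mk_surjective, (isCoveringMap_mk m).continuous,
      (isCoveringMap_mk m).isLocalHomeomorph.isOpenMap⟩
  rw [(IsOpenQuotientMap.id.prodMap hmk).isQuotientMap.continuous_iff]
  refine continuous_quotient_mk'.comp (Continuous.subtype_mk (continuous_pi fun i =>
    Continuous.subtype_mk ?_ _) _)
  have h1 : Continuous fun p : Circle × OrderedConf m => coords p.2 i := by fun_prop
  have h2 : Continuous fun p : Circle × OrderedConf m => (p.1 : ℂ) := by fun_prop
  exact h2.mul h1

lemma encard_points {m : ℕ} (c : Conf m) : c.points.encard = m := by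
  induction c using Quotient.inductionOn with | _ x
  rw [Conf.points_mk, ← image_univ, x.2.encard_image, encard_univ]
  simp

/-- Every braid commutes with the full twist, and this is realized over the torus: the configuration
at the angles `(u, v)` is the one of the braid at time `u`, rotated through the angle `v`. -/
theorem exists_isTorusCoveringLink {m : ℕ} (a : BraidGroup m) :
    ∃ S, IsTorusCoveringLink m a (braidClass (halfRotation m) ^ 2) S := by
  obtain ⟨α, rfl⟩ : ∃ α, braidClass α = a := by
    obtain ⟨α, hα⟩ := Path.Homotopic.Quotient.mk_surjective a.unop
    exact ⟨α, MulOpposite.unop_injective hα⟩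
  let A : C(UnitAddCircle, Conf m) := ⟨AddCircle.liftIco 1 0 α.extend,
    AddCircle.liftIco_zero_continuous (by simp) α.continuous_extend.continuousOn⟩
  have hA : ∀ t : I, A ((t : ℝ) : UnitAddCircle) = α t := by
    intro t
    change AddCircle.liftIco 1 0 α.extend _ = _
    rcases t.2.2.lt_or_eq with h | h
    · rw [AddCircle.liftIco_zero_coe_apply ⟨t.2.1, h⟩, Path.extend_apply _ t.2]
    · have h0 : ((t : ℝ) : UnitAddCircle) = ((0 : ℝ) : UnitAddCircle) := by
        rw [h, QuotientAddGroup.mk_zero]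
        exact AddCircle.coe_period 1
      rw [h0, AddCircle.liftIco_zero_coe_apply (by simp), show t = 1 from Subtype.ext h]
      simp
  let C : C(UnitAddCircle × UnitAddCircle, Conf m) :=
    ⟨fun θ => rotConf θ.2.toCircle (A θ.1), (continuous_rotConf m).comp
      ((AddCircle.continuous_toCircle.comp continuous_snd).prodMk
        (A.continuous.comp continuous_fst))⟩
  refine ⟨_, {p | p.1 ∈ (C p.2).points}, rfl, isCoveringMap_points C,
    fun θ => encard_points (C θ), ⟨α, rfl, fun t => ?_⟩,
    ⟨(halfRotation m).trans (halfRotation m), by rw [sq]; rfl, fun t => ?_⟩⟩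
  · have h : C (((t : ℝ) : UnitAddCircle), 0) = α t := by
      change rotConf (AddCircle.toCircle 0) (A _) = _
      rw [AddCircle.toCircle_zero, rotConf_one, hA]
    rw [← h]
    rfl
  · have h : C (0, ((t : ℝ) : UnitAddCircle)) = Quotient.mk _ (rotated m (2 * t)) := by
      have h0 := hA 0
      rw [Icc.coe_zero, QuotientAddGroup.mk_zero, α.source] at h0
      change rotConf (AddCircle.toCircle _) (A 0) = _
      rw [h0, AddCircle.toCircle_apply_mk]
      change Quotient.mk _ _ = _
      congr 1
      refine coords_ext fun i => ?_
      rw [coords_rotated]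
      change ((Circle.exp _ : Circle) : ℂ) * basePos m i = _
      rw [Circle.coe_exp, mul_comm]
      congr 2
      push_cast
      ring
    have h' : ((halfRotation m).trans (halfRotation m)) t = C (0, ((t : ℝ) : UnitAddCircle)) := by
      rw [h, Path.trans_apply]
      split_ifs
      · rfl
      · change Quotient.mk _ (rotated m (2 * t - 1)) = _
        rw [← rotated_add_one, sub_add_cancel]
    rw [h']
    rfl

/-! ### Torus-covering links in `ℝ⁴` -/

/-- The identification of `ℝ⁴` with `ℂ × ℂ`. -/
def pairing : R4 ≃ₜ ℂ × ℂ where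
  toFun x := ((x 0 : ℂ) + (x 1 : ℂ) * Complex.I, (x 2 : ℂ) + (x 3 : ℂ) * Complex.I)
  invFun p := !₂[p.1.re, p.1.im, p.2.re, p.2.im]
  left_inv x := by
    ext i
    fin_cases i <;> simp
  right_inv p := by
    refine Prod.ext ?_ ?_ <;> simp
  continuous_toFun := by fun_prop
  continuous_invFun := by
    refine (PiLp.continuous_toLp 2 _).comp (continuous_pi fun i => ?_)
    fin_cases i
    · exact Complex.continuous_re.comp continuous_fst
    · exact Complex.continuous_im.comp continuous_fst
    · exact Complex.continuous_re.comp continuous_snd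
    · exact Complex.continuous_im.comp continuous_snd

lemma coe_toCircle (u : ℝ) : (AddCircle.toCircle (u : UnitAddCircle) : ℂ) = turn u := by
  rw [AddCircle.toCircle_apply_mk, Circle.coe_exp, turn]
  simp

lemma pairing_torusEmb (z : Disk) (k : ℝ × ℝ) :
    pairing (torusEmb (z, (k.1 : UnitAddCircle), (k.2 : UnitAddCircle))) = polar z k := by
  refine Prod.ext ?_ ?_ <;> apply Complex.ext <;> simp [pairing, torusEmb, polar, coe_toCircle]

/-- A torus-covering link of degree `3` is traced out by ordered configurations. -/
lemma IsTorusCoveringLink.exists_isTraced {a b : BraidGroup 3} {S : Set R4}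
    (h : IsTorusCoveringLink 3 a b S) : ∃ ζ : C(ℝ × ℝ, OrderedConf 3), IsTraced (pairing '' S) ζ ∧
      (∃ α : Path (baseConf 3) (baseConf 3), braidClass α = a ∧
        ∀ t : I, α t = Quotient.mk _ (ζ (t, 0))) ∧
      ∃ β : Path (baseConf 3) (baseConf 3), braidClass β = b ∧
        ∀ t : I, β t = Quotient.mk _ (ζ (0, t)) := by
  obtain ⟨L, rfl, hcov, hcard, ⟨α, hα, hαL⟩, ⟨β, hβ, hβL⟩⟩ := h
  obtain ⟨ζ, hζ0, hζ⟩ := exists_ordered_lift hcov hcard (orderedBase 3) (by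
    have h := hαL 0
    rw [α.source] at h
    exact h)
  have hnorm : ∀ z : Disk, (z : ℂ) ∈ quadrant := fun z => mem_quadrant_of_norm_le z.2.le
  refine ⟨ζ, ⟨hζ0, fun w hw k => ?_, ?_⟩, ⟨α, hα, fun t => ?_⟩, ⟨β, hβ, fun t => ?_⟩⟩
  · have hL : ∀ z : Disk, (z, (k.1 : UnitAddCircle), (k.2 : UnitAddCircle)) ∈ L ↔
        ∃ i, (z : ℂ) = coords (ζ k) i := fun z => by
      have h : z ∈ range (ζ k).1 ↔ (z, (k.1 : UnitAddCircle), (k.2 : UnitAddCircle)) ∈ L := by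
        rw [hζ]; rfl
      rw [← h]
      exact exists_congr fun i =>
        ⟨fun e => congrArg Subtype.val e.symm, fun e => Subtype.ext e.symm⟩
    constructor
    · rintro ⟨-, ⟨⟨z, θ₁, θ₂⟩, hl, rfl⟩, hp⟩
      obtain ⟨u, rfl⟩ := QuotientAddGroup.mk_surjective θ₁
      obtain ⟨v, rfl⟩ := QuotientAddGroup.mk_surjective θ₂
      have hp' : polar z (u, v) = polar w k := (pairing_torusEmb z (u, v)).symm.trans hp
      have hzw : (z : ℂ) = w := by
        rw [← radial_polar (hnorm z) (u, v), hp', radial_polar hw]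
      rw [← hzw] at hp' ⊢
      obtain ⟨p, q, h1, h2⟩ := exists_int_of_polar_eq (hnorm z) hp'
      have hint : ∀ (x : ℝ) (p : ℤ), ((x + p : ℝ) : UnitAddCircle) = x := fun x p => by
        have h0 : ((p : ℝ) : UnitAddCircle) = 0 := (AddCircle.coe_eq_zero_iff 1).2 ⟨p, by simp⟩
        rw [AddCircle.coe_add, h0, add_zero]
      refine (hL z).1 ?_
      rw [← hint k.1 p, ← hint k.2 q, ← h1, ← h2]
      exact hl
    · rintro ⟨i, rfl⟩
      refine ⟨_, ⟨⟨(ζ k).1 i, k.1, k.2⟩, (hL _).2 ⟨i, rfl⟩, rfl⟩, ?_⟩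
      exact pairing_torusEmb _ _
  · rintro - ⟨-, ⟨⟨z, θ₁, θ₂⟩, -, rfl⟩, rfl⟩
    obtain ⟨u, rfl⟩ := QuotientAddGroup.mk_surjective θ₁
    obtain ⟨v, rfl⟩ := QuotientAddGroup.mk_surjective θ₂
    have h := pairing_torusEmb z (u, v)
    obtain ⟨h1, h2⟩ := norm_polar (hnorm z) (u, v)
    have hre := (abs_lt.1 ((Complex.abs_re_le_norm (z : ℂ)).trans_lt z.2)).1
    have him := (abs_lt.1 ((Complex.abs_im_le_norm (z : ℂ)).trans_lt z.2)).1
    change 1 < ‖(pairing (torusEmb (z, (u : UnitAddCircle), (v : UnitAddCircle)))).1‖ ∧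
      1 < ‖(pairing (torusEmb (z, (u : UnitAddCircle), (v : UnitAddCircle)))).2‖
    rw [h, h1, h2]
    constructor <;> linarith
  · apply Conf.points_injective
    rw [hαL, Conf.points_mk, hζ]
    rfl
  · apply Conf.points_injective
    rw [hβL, Conf.points_mk, hζ]
    rfl

/-- A homeomorphism induces an isomorphism of fundamental groups. -/
lemma nonempty_mulEquiv_of_homeomorph {X Y : Type} [TopologicalSpace X] [TopologicalSpace Y]
    (h : X ≃ₜ Y) (x : X) : Nonempty (FundamentalGroup X x ≃* FundamentalGroup Y (h x)) :=
  ⟨(FundamentalGroupoidFunctor.equivOfHomotopyEquiv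
    h.toHomotopyEquiv).fullyFaithfulFunctor.mulEquivEnd ⟨x⟩⟩

/-- The group of a traced set with the boundary braids `σ₁² σ₂²ⁿ` and `Δ²`. -/
theorem IsTraced.nonempty_mulEquiv {K : Set (ℂ × ℂ)} {ζ : C(ℝ × ℝ, OrderedConf 3)}
    (hK : IsTraced K ζ) (n : ℤ) (α : Path (baseConf 3) (baseConf 3))
    (hα : braidClass α = sigma1 ^ 2 * sigma2 ^ (2 * n))
    (hαζ : ∀ t : I, α t = Quotient.mk _ (ζ (t, 0))) (β : Path (baseConf 3) (baseConf 3))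
    (hβ : braidClass β = garside ^ 2) (hβζ : ∀ t : I, β t = Quotient.mk _ (ζ (0, t))) :
    Nonempty (FundamentalGroup (LinkCompl K) (hK.incl basePt) ≃* Multiplicative (ℤ × ℤ × ℤ)) := by
  obtain ⟨ψ, hψ, hψp, -⟩ := exists_realizes_sigma2_zpow n
  have h1 : ζ (1, 0) = ζ 0 := by
    have h := hK.apply_one (realizes_sigma1.sq_of_twist.mul hψ) (fun i => ?_)
      ⟨fun t : I => ((t : ℝ), (0 : ℝ)), by fun_prop⟩ (by simp) α hα hαζ
    · simpa using h
    · have hfix : twist (-1 / 3) (1 / 2) 2 (basePos 3 i) = basePos 3 i := by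
        fin_cases i
        · refine twist_two_of_le ?_
          change ‖basePos 3 0 - _‖ ≤ _
          rw [basePos_three_zero]
          norm_num
        · refine twist_two_of_le ?_
          change ‖basePos 3 1 - _‖ ≤ _
          rw [basePos_three_one]
          norm_num
        · refine twist_of_ge 2 ?_
          change _ ≤ ‖basePos 3 2 - _‖
          rw [basePos_three_two]
          norm_num
      change ψ (twist (-1 / 3) (1 / 2) 2 (basePos 3 i)) = _
      rw [hfix, hψp]
  have h2 : ζ (0, 1) = ζ 0 := by
    have h := hK.apply_one realizes_garside.sq_of_twist (fun i => ?_)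
      ⟨fun t : I => ((0 : ℝ), (t : ℝ)), by fun_prop⟩ (by simp) β hβ hβζ
    · simpa using h
    · refine twist_two_of_le ?_
      have h := norm_basePos_sub_lt_iff i 2
      rw [show radius 2 = 5 / 6 from rfl, sub_self, Complex.ofReal_zero] at h
      exact (h.2 (Fin.le_last i)).le
  choose φ hφ using hK.exists_winding_gen (hK.add_int h1 h2)
  exact nonempty_mulEquiv_of_triangular hK.gen (hK.commute_gen_one n α hα hαζ)
    (hK.commute_gen_two β hβ hβζ) hK.eq_top Complex.two_pi_I_ne_zero φ hφ

end TorusCovering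

end

theorem theorem1 (n : ℤ) :
    (∃ S : Set TorusCovering.R4,
      TorusCovering.IsTorusCoveringLink 3
        (TorusCovering.sigma1 ^ 2 * TorusCovering.sigma2 ^ (2 * n))
        (TorusCovering.garside ^ 2) S) ∧
    ∀ S : Set TorusCovering.R4,
      TorusCovering.IsTorusCoveringLink 3
        (TorusCovering.sigma1 ^ 2 * TorusCovering.sigma2 ^ (2 * n))
        (TorusCovering.garside ^ 2) S →
      ∀ x : (Sᶜ : Set TorusCovering.R4),
        Nonempty (FundamentalGroup (Sᶜ : Set TorusCovering.R4) x ≃* Multiplicative (ℤ × ℤ × ℤ)) := by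
  constructor
  · rw [← TorusCovering.braidClass_halfRotation]
    exact TorusCovering.exists_isTorusCoveringLink _
  · intro S hS x
    obtain ⟨ζ, hK, ⟨α, hα, hαζ⟩, ⟨β, hβ, hβζ⟩⟩ := hS.exists_isTraced
    obtain ⟨e⟩ := hK.nonempty_mulEquiv n α hα hαζ β hβ hβζ
    have := hK.pathConnectedSpace
    let h : (Sᶜ : Set TorusCovering.R4) ≃ₜ
        TorusCovering.LinkCompl (TorusCovering.pairing '' S) :=
      TorusCovering.pairing.subtype fun y =>
        not_congr (TorusCovering.pairing.injective.mem_set_image).symm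
    obtain ⟨e'⟩ := TorusCovering.nonempty_mulEquiv_of_homeomorph h x
    exact ⟨e'.trans
      ((FundamentalGroup.fundamentalGroupMulEquivOfPathConnected _ _).trans e)⟩
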